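/- **Setting.** All sets lie in a fixed universe. Let $B$ be a non-degenerate Boolean algebra ($0\neq 1$) with complement $b'$. A *partition* of $b\in B$ is a set of non-zero, pairwise disjoint elements with join $b$; for an arbitrary subset $P \subseteq B$ write $P^-=P\setminus\{0\}$. A *zero-dimensional topology* $\mathcal J$ on $B$ is a collection of partitions of $1$ which contains every finite partition of $1$ and is such that: (a) if $P\in\mathcal J$ and $Q_b\in\mathcal J$ for each $b\in P$, then $\{b\wedge c: b\in P, c\in Q_b\}^-\in\mathcal J$; (b) if $P\in\mathcal J$ and $\alpha\colon P\to I$ is surjective, then each join $\bigvee\alpha^{-1}(i)$ exists and $\{\bigvee\alpha^{-1}(i):i\in I\}\in\mathcal J$. The pair $B_{\mathcal J}$ is a *Grothendieck Boolean algebra*. Write $\mathcal J_b$ for the set of those subsets $P$ of members of $\mathcal J$ which have join $b$. A *$B_{\mathcal J}$-set* is a set $X$ with operations $(b,x,y)\mapsto b(x,y)$ ($b\in B$) satisfying $b(x,x)=x$, $b(b(x,y),z)=b(x,z)$, $b(x,b(y,z))=b(x,z)$, $1(x,y)=x$, $b'(x,y)=b(y,x)$, $(b\wedge c)(x,y)=b(c(x,y),y)$,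 and with an operation $P\colon X^P\to X$ for each infinite $P\in\mathcal J$ satisfying $P(\lambda b.\,x)=x$, $P(\lambda b.\,b(x_b,y_b))=P(\lambda b.\,x_b)$ and $b(P(x),x_b)=x_b$ for all $b\in P$. Write $x\equiv_b y$ for $b(x,y)=y$. A *Grothendieck matched pair* $\langle B_{\mathcal J}|M\rangle$ consists of $B_{\mathcal J}$ as above, a monoid $M$ whose underlying set has a $B_{\mathcal J}$-set structure, and a left action $(m,b)\mapsto m^*b$ of $M$ on $B$ by Boolean homomorphisms such that $P\in\mathcal J$ implies $\{m^*b:b\in P\}^-\in\mathcal J$, subject to $b(m,n)p=b(mp,np)$, $m\,(b(n,p))=(m^*b)(mn,mp)$ and $b(m,n)^*c=(b\wedge m^*c)\vee(b'\wedge n^*c)$. A *$\langle B_{\mathcal J}|M\rangle$-set* is a $B_{\mathcal J}$-set $X$ with a left $M$-action such that $b(m,n)\cdot x=b(m\cdot x,n\cdot x)$ and $m\cdot b(x,y)=(m^*b)(m\cdot x,m\cdot y)$. With the structure-preserving maps as morphisms, $B_{\mathcal J}$-sets and $\langle B_{\mathcal J}|M\rangle$-sets form cartesian closed categories. A finite-product-preserving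 functor $U$ between cartesian closed categories is *cartesian closed* if, for all $Y,Z$, the map $U(Z^Y)\to (UZ)^{UY}$ which is the transpose of $U(Z^Y)\times UY\cong U(Z^Y\times Y)\xrightarrow{U(\mathrm{ev})}UZ$ is invertible. *The associated Grothendieck Boolean restriction monoid $S_{\mathcal J}$.* Its elements are the pairs $m|_b$ with $b\in B$ and $m\in M/{\equiv_b}$; $m|_b\cdot n|_c=(mn)|_{b\wedge m^*c}$, the unit is $1|_1$, the zero is $1|_0$, and $(m|_b)^+=1|_b$. It is ordered by $s\leqslant t$ iff $s^+t=s$, and $B$ is identified with the set of its restriction idempotents $s^+$ via $b\mapsto 1|_b$. A subset $A$ is *admissible* if $s^+t^+=0$ for all distinct $s,t\in A$ and $\{s^+:s\in A\}^-$ is contained in a member of $\mathcal J$. An element $s$ is a *partial isomorphism* if there is $t$ with $st=s^+$ and $ts=t^+$. $S_{\mathcal J}$ is *étale* if each element is the join of an admissible set of partial isomorphisms. *The classifying localic category.* Let $\mathrm{Idl}_{\mathcal J}(B)$ be the frame of ideals $I$ of $B$ which are $\mathcal J$-closed ($P\in\mathcal J_b$ and $P\subseteq I$ imply $b\in I$),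 made into a $B_{\mathcal J}$-set via $I\equiv_b K$ iff $I\cap{\downarrow}b=K\cap{\downarrow}b$. The locale of objects $C_0$ is given by $\mathrm{Idl}_{\mathcal J}(B)$; the locale of arrows $C_1$ by the $B_{\mathcal J}$-set homomorphisms $M\to\mathrm{Idl}_{\mathcal J}(B)$, ordered pointwise; the source by $s^*(I)=\lambda m.\,I$; the target by $t^*(I)=\lambda m.\,m^*I$, where $m^*I$ is the $\mathcal J$-closed ideal generated by $\{m^*b:b\in I\}$; the identities by $i^*(f)=f(1)$; the locale of composable pairs $C_1\times_{C_0}C_1$ by the functions $f\colon M\times M\to\mathrm{Idl}_{\mathcal J}(B)$ such that $m\equiv_b m'$ implies $f(m,n)\equiv_b f(m',n)$ and $n\equiv_b n'$ implies $f(m,n)\equiv_{m^*b}f(m,n')$; and composition by $f\mapsto\lambda m,n.\,f(mn)$. *The classifying topological category*, in the finitary case where $\mathcal J$ consists of the finite partitions only. Its space of objects is the Stone space of ultrafilters on $B$. Its arrows are the pairs $(\mathcal U,m)$ with $\mathcal U$ an ultrafilter on $B$ and $m\in M$, where $(\mathcal U,m)$ and $(\mathcal U,n)$ are identified when $m\equiv_b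 n$ for some $b\in\mathcal U$; the space of arrows has as basic open sets the $\{(\mathcal U,m):b\in\mathcal U\}$ for $b\in B$, $m\in M$. The source and target of $(\mathcal U,m)$ are $\mathcal U$ and $m_!\mathcal U=\{b:m^*b\in\mathcal U\}$, the identity of $\mathcal U$ is $(\mathcal U,1)$, and the composite of $(\mathcal U,m)$ followed by $(m_!\mathcal U,n)$ is $(\mathcal U,mn)$. **Theorem.** For every Grothendieck matched pair $\langle B_{\mathcal J}|M\rangle$ the following are equivalent: (i) the forgetful functor $\langle B_{\mathcal J}|M\rangle\text{-}\mathrm{Set}\to B_{\mathcal J}\text{-}\mathrm{Set}$ is cartesian closed; (ii) for all $m\in M$ there are $\{b_i:i\in I\}\in\mathcal J$ and families $(n_i\in M:i\in I)$ and $(c_i\in B:i\in I)$ such that $b_i\leqslant m^*c_i$, $mn_i\equiv_{b_i}1$ and $n_im\equiv_{c_i}1$ for all $i$; (iii) the associated Grothendieck Boolean restriction monoid $S_{\mathcal J}$ is étale; (iv) the classifying localic category is a groupoid, i.e. there is an inversion map of locales $C_1\to C_1$ which makes it an internal groupoid in the category of locales. Moreover, if $\mathcal J$ consists of the finite partitions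 only, then (iv) is also equivalent to each of: (iv$'$) every arrow of the classifying topological category is invertible; (iv$''$) the classifying topological category is a topological groupoid, i.e. every arrow is invertible and inversion is continuous. -/

import Mathlib

open CategoryTheory

universe u

namespace MatchedPairs

/-! ## Grothendieck Boolean algebras -/

/-- `P` is a partition of `b`: a set of non-zero, pairwise disjoint elements with join `b`. -/
def IsPartition {B : Type u} [BooleanAlgebra B] (P : Set B) (b : B) : Prop :=
  ⊥ ∉ P ∧ IsLUB P b ∧ ∀ c ∈ P, ∀ d ∈ P, c ≠ d → c ⊓ d = ⊥

/-- A zero-dimensional topology on a Boolean algebra. -/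
structure ZeroDimTopology (B : Type u) [BooleanAlgebra B] where
  /-- the chosen partitions (of `⊤`) -/
  parts : Set (Set B)
  isPartition : ∀ P ∈ parts, IsPartition P ⊤
  finite_mem : ∀ P : Set B, P.Finite → IsPartition P ⊤ → P ∈ parts
  bind_mem : ∀ P ∈ parts, ∀ Q : B → Set B, (∀ b ∈ P, Q b ∈ parts) →
    {d | ∃ b ∈ P, ∃ c ∈ Q b, d = b ⊓ c} \ {⊥} ∈ parts
  image_mem : ∀ P ∈ parts, ∀ (I : Type u) (α : P → I), Function.Surjective α →
    ∃ j : I → B, (∀ i, IsLUB {b | ∃ h : b ∈ P, α ⟨b, h⟩ = i} (j i)) ∧ Set.range j ∈ parts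

namespace ZeroDimTopology

variable {B : Type u} [BooleanAlgebra B] (J : ZeroDimTopology B)

/-- The set `J_b` of partitions of `b` contained in a partition in `J`. -/
def partsOf (b : B) : Set (Set B) :=
  {P | (∃ Q ∈ J.parts, P ⊆ Q) ∧ IsLUB P b}

theorem pair_mem (x : B) : ({x, xᶜ} \ {⊥} : Set B) ∈ J.parts := by
  apply J.finite_mem
  · exact (Set.toFinite _).subset Set.sdiff_subset
  · refine ⟨by simp, ?_, ?_⟩
    · constructor
      · intro y _
        exact le_top
      · intro y hy
        have h1 : x ≤ y := by
          by_cases h : x = ⊥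
          · simp [h]
          · exact hy ⟨by simp, h⟩
        have h2 : xᶜ ≤ y := by
          by_cases h : xᶜ = ⊥
          · simp [h]
          · exact hy ⟨by simp, h⟩
        calc ⊤ = x ⊔ xᶜ := by simp
          _ ≤ y := sup_le h1 h2
    · rintro c ⟨hc, -⟩ d ⟨hd, -⟩ hne
      simp only [Set.mem_insert_iff, Set.mem_singleton_iff] at hc hd
      rcases hc with rfl | rfl <;> rcases hd with rfl | rfl <;> simp_all

theorem partsOf_inf {b : B} {P : Set B} (hP : P ∈ J.partsOf b) (x : B) :
    ((fun p => p ⊓ x) '' P) \ {⊥} ∈ J.partsOf (b ⊓ x) := by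
  obtain ⟨⟨Q, hQ, hPQ⟩, hb⟩ := hP
  refine ⟨⟨_, J.bind_mem Q hQ (fun _ => {x, xᶜ} \ {⊥}) (fun _ _ => J.pair_mem x), ?_⟩, ?_, ?_⟩
  · rintro _ ⟨⟨p, hp, rfl⟩, hne⟩
    refine ⟨⟨p, hPQ hp, x, ⟨by simp, ?_⟩, rfl⟩, hne⟩
    rintro rfl
    simp at hne
  · rintro _ ⟨⟨p, hp, rfl⟩, -⟩
    exact inf_le_inf_right _ (hb.1 hp)
  · intro e he
    have : b ≤ e ⊔ xᶜ := by
      apply hb.2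
      intro p hp
      by_cases h : p ⊓ x = ⊥
      · exact (le_compl_iff_disjoint_right.2 (disjoint_iff.2 h)).trans le_sup_right
      · have h1 : p ⊓ x ≤ e := he ⟨⟨p, hp, rfl⟩, h⟩
        calc p ≤ (p ⊓ x) ⊔ xᶜ := by rw [sup_inf_right]; simp
          _ ≤ _ := sup_le_sup_right h1 _
    calc b ⊓ x ≤ (e ⊔ xᶜ) ⊓ x := inf_le_inf_right _ this
      _ = e ⊓ x := by rw [inf_sup_right]; simp
      _ ≤ e := inf_le_left

end ZeroDimTopology

/-! ## `B`-sets and `B_J`-sets -/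

/-- `B`-set structure: `cond b x y` is `b(x, y)`, read "if `b` then `x` else `y`". -/
structure BStr (B : Type u) [BooleanAlgebra B] (X : Type u) where
  cond : B → X → X → X
  cond_self : ∀ b x, cond b x x = x
  cond_cond_left : ∀ b x y z, cond b (cond b x y) z = cond b x z
  cond_cond_right : ∀ b x y z, cond b x (cond b y z) = cond b x z
  cond_top : ∀ x y, cond ⊤ x y = x
  cond_compl : ∀ b x y, cond bᶜ x y = cond b y x
  cond_inf : ∀ b c x y, cond (b ⊓ c) x y = cond b (cond c x y) y

namespace BStr

variable {B : Type u} [BooleanAlgebra B] {X : Type u} (σ : BStr B X)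

/-- The relation `x ≡_b y`. -/
def Eqv (b : B) (x y : X) : Prop := σ.cond b x y = y

variable {σ}

theorem Eqv.refl (b : B) (x : X) : σ.Eqv b x x := σ.cond_self b x

theorem Eqv.symm {b : B} {x y : X} (h : σ.Eqv b x y) : σ.Eqv b y x := by
  have h' : σ.cond b x y = y := h
  have := σ.cond_cond_left b x y x
  rw [h', σ.cond_self] at this
  exact this

theorem Eqv.trans {b : B} {x y z : X} (h : σ.Eqv b x y) (h2 : σ.Eqv b y z) : σ.Eqv b x z := by
  have h1 : σ.cond b x y = y := h
  have := σ.cond_cond_left b x y z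
  rw [h1] at this
  exact this.symm.trans h2

theorem Eqv.mono {b c : B} {x y : X} (h : σ.Eqv b x y) (hc : c ≤ b) : σ.Eqv c x y := by
  have h1 : σ.cond b x y = y := h
  have := σ.cond_inf c b x y
  rw [inf_eq_left.2 hc, h1, σ.cond_self] at this
  exact this

theorem eqv_top {x y : X} : σ.Eqv ⊤ x y ↔ x = y := by
  unfold Eqv
  rw [σ.cond_top]

theorem eqv_bot (x y : X) : σ.Eqv ⊥ x y := by
  unfold Eqv
  rw [← compl_top, σ.cond_compl, σ.cond_top]

theorem cond_eqv_left (b : B) (x y : X) : σ.Eqv b (σ.cond b x y) x := by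
  unfold Eqv
  rw [σ.cond_cond_left, σ.cond_self]

theorem cond_eqv_right (b : B) (x y : X) : σ.Eqv bᶜ (σ.cond b x y) y := by
  unfold Eqv
  rw [σ.cond_compl, σ.cond_cond_right, σ.cond_self]

theorem eq_of_eqv {b : B} {x y : X} (h : σ.Eqv b x y) (h' : σ.Eqv bᶜ x y) : x = y := by
  have h1 : σ.cond b x y = y := h
  have h2 : σ.cond bᶜ y x = x := h'.symm
  rw [σ.cond_compl] at h2
  rw [← h2, h1]

/-- To show `x ≡_c y`, replace `x` by `c(x, y)`. -/
theorem eqv_cond_of_inf {b c : B} {x y : X} (h : σ.Eqv (c ⊓ b) x y) :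
    σ.Eqv b (σ.cond c x y) y := by
  have h1 : σ.cond (c ⊓ b) x y = y := h
  unfold Eqv
  rw [← σ.cond_inf, inf_comm, h1]

theorem eqv_split {b c : B} {x y : X} (h : σ.Eqv (c ⊓ b) x y) (h' : σ.Eqv (c ⊓ bᶜ) x y) :
    σ.Eqv c x y :=
  eq_of_eqv (eqv_cond_of_inf h) (eqv_cond_of_inf h')

theorem eqv_sup {b c : B} {x y : X} (h : σ.Eqv b x y) (h' : σ.Eqv c x y) :
    σ.Eqv (b ⊔ c) x y := by
  apply eqv_split (b := b)
  · exact h.mono inf_le_right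
  · apply h'.mono
    rw [inf_sup_right]
    simp

theorem cond_congr {b c : B} {x x' y y' : X} (h : σ.Eqv c x x') (h' : σ.Eqv c y y') :
    σ.Eqv c (σ.cond b x y) (σ.cond b x' y') := by
  apply eqv_split (b := b)
  · exact (((cond_eqv_left b x y).mono inf_le_right).trans (h.mono inf_le_left)).trans
      ((cond_eqv_left b x' y').mono inf_le_right).symm
  · exact (((cond_eqv_right b x y).mono inf_le_right).trans (h'.mono inf_le_left)).trans
      ((cond_eqv_right b x' y').mono inf_le_right).symm

theorem cond_congr_index {b b' c : B} (h : c ⊓ b = c ⊓ b') (x y : X) :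
    σ.Eqv c (σ.cond b x y) (σ.cond b' x y) := by
  have h2 : c ⊓ bᶜ = c ⊓ b'ᶜ := by
    have : c \ b = c \ b' := by rw [← sdiff_inf_self_left c b, h, sdiff_inf_self_left]
    simpa [sdiff_eq] using this
  apply eqv_split (b := b)
  · exact ((cond_eqv_left b x y).mono inf_le_right).trans
      ((cond_eqv_left b' x y).mono (h ▸ inf_le_right)).symm
  · exact ((cond_eqv_right b x y).mono inf_le_right).trans
      ((cond_eqv_right b' x y).mono (h2 ▸ inf_le_right)).symm

/-- `z = c(x, y)` as soon as `z ≡_c x` and `z ≡_{c'} y`. -/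
theorem eq_cond {c : B} {x y z : X} (h : σ.Eqv c z x) (h' : σ.Eqv cᶜ z y) :
    z = σ.cond c x y :=
  eq_of_eqv (h.trans (cond_eqv_left c x y).symm) (h'.trans (cond_eqv_right c x y).symm)

theorem cond_interchange (b c : B) (x y z w : X) :
    σ.cond b (σ.cond c x y) (σ.cond c z w) = σ.cond c (σ.cond b x z) (σ.cond b y w) :=
  eq_cond (cond_congr (cond_eqv_left _ _ _) (cond_eqv_left _ _ _))
    (cond_congr (cond_eqv_right _ _ _) (cond_eqv_right _ _ _))

end BStr

/-- `B_J`-set structure: a `B`-set with an operation `X^P → X` for every infinite `P ∈ J`. -/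
structure BJStr {B : Type u} [BooleanAlgebra B] (J : ZeroDimTopology B) (X : Type u)
    extends BStr B X where
  glue : ∀ P : Set B, P ∈ J.parts → P.Infinite → (P → X) → X
  glue_const : ∀ (P : Set B) hP hi x, glue P hP hi (fun _ => x) = x
  glue_cond : ∀ (P : Set B) hP hi (x y : P → X),
    glue P hP hi (fun b => cond b (x b) (y b)) = glue P hP hi x
  cond_glue : ∀ (P : Set B) hP hi (x : P → X) (b : P), cond b (glue P hP hi x) (x b) = x b

namespace BJStr

open BStr

variable {B : Type u} [BooleanAlgebra B] {J : ZeroDimTopology B} {X Y : Type u}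

theorem eq_glue (σ : BJStr J X) {P : Set B} (hP : P ∈ J.parts) (hi : P.Infinite) (x : P → X)
    {z : X} (h : ∀ b : P, σ.Eqv b z (x b)) : z = σ.glue P hP hi x := by
  have h1 := σ.glue_cond P hP hi (fun _ => z) x
  rw [σ.glue_const, show (fun b : P => σ.cond b z (x b)) = x from funext h] at h1
  exact h1.symm

/-- Equality may be checked locally on a partition in `J`. -/
theorem eq_of_parts (σ : BJStr J X) {P : Set B} (hP : P ∈ J.parts) {x y : X}
    (h : ∀ b ∈ P, σ.Eqv b x y) : x = y := by
  rcases P.finite_or_infinite with hi | hi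
  · have key : ∀ s : Finset B, (∀ b ∈ s, σ.Eqv b x y) → σ.Eqv (s.sup id) x y := by
      classical
      intro s
      induction s using Finset.induction with
      | empty => intro _; exact eqv_bot x y
      | insert a s _ ih =>
        intro hs
        rw [Finset.sup_insert]
        exact eqv_sup (hs a (by simp)) (ih fun b hb => hs b (by simp [hb]))
    have h1 := key hi.toFinset (fun b hb => h b (by simpa using hb))
    have h2 : (⊤ : B) ≤ hi.toFinset.sup id :=
      (J.isPartition P hP).2.1.2 (fun b hb => Finset.le_sup (f := id) (by simpa using hb))
    exact eqv_top.1 (h1.mono h2)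
  · rw [σ.eq_glue hP hi (fun _ => y) (z := x) (fun b => h b b.2), σ.glue_const]

/-- Elements may be glued along any partition in `J`, finite or not. -/
theorem exists_glue [Nontrivial B] (σ : BJStr J X) {P : Set B} (hP : P ∈ J.parts) (x : P → X) :
    ∃ z, ∀ b : P, σ.Eqv b z (x b) := by
  rcases P.finite_or_infinite with hi | hi
  · obtain ⟨hb, hl, hd⟩ := J.isPartition P hP
    have hne : P.Nonempty := by
      by_contra h
      rw [Set.not_nonempty_iff_eq_empty] at h
      rw [h, isLUB_empty_iff] at hl
      exact bot_ne_top (le_antisymm bot_le (hl ⊥))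
    obtain ⟨b₀, hb₀⟩ := hne
    have key : ∀ s : Finset B, (↑s ⊆ P) → ∃ z, ∀ b : P, b.1 ∈ s → σ.Eqv b z (x b) := by
      classical
      intro s
      induction s using Finset.induction with
      | empty => intro _; exact ⟨x ⟨b₀, hb₀⟩, by simp⟩
      | insert a s ha ih =>
        intro hs
        have haP : a ∈ P := hs (by simp)
        obtain ⟨z, hz⟩ := ih (fun b hb => hs (by
          have : b ∈ s := hb
          simp [this]))
        refine ⟨σ.cond a (x ⟨a, haP⟩) z, fun b hbs => ?_⟩
        rcases eq_or_ne b.1 a with h | h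
        · have : b = ⟨a, haP⟩ := Subtype.ext h
          subst this
          exact cond_eqv_left _ _ _
        · have hbs' : b.1 ∈ s := by
            rcases Finset.mem_insert.1 hbs with h' | h'
            · exact absurd h' h
            · exact h'
          have hle : b.1 ≤ aᶜ :=
            le_compl_iff_disjoint_right.2 (disjoint_iff.2 (hd b b.2 a haP h))
          exact ((cond_eqv_right _ _ _).mono hle).trans (hz b hbs')
    obtain ⟨z, hz⟩ := key hi.toFinset (by simp)
    exact ⟨z, fun b => hz b (by simp)⟩
  · exact ⟨σ.glue P hP hi x, fun b => σ.cond_glue P hP hi x b⟩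

theorem eqv_of_parts (σ : BJStr J X) {P : Set B} (hP : P ∈ J.parts) {c : B} {x y : X}
    (h : ∀ b ∈ P, σ.Eqv (c ⊓ b) x y) : σ.Eqv c x y :=
  σ.eq_of_parts hP (fun b hb => eqv_cond_of_inf (h b hb))

theorem glue_congr (σ : BJStr J X) {P : Set B} (hP : P ∈ J.parts) (hi : P.Infinite) {c : B}
    {x y : P → X} (h : ∀ b, σ.Eqv c (x b) (y b)) :
    σ.Eqv c (σ.glue P hP hi x) (σ.glue P hP hi y) := by
  apply σ.eqv_of_parts hP
  intro b hb
  have h1 : σ.Eqv b (σ.glue P hP hi x) (x ⟨b, hb⟩) := σ.cond_glue P hP hi x ⟨b, hb⟩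
  have h2 : σ.Eqv b (σ.glue P hP hi y) (y ⟨b, hb⟩) := σ.cond_glue P hP hi y ⟨b, hb⟩
  exact ((h1.mono inf_le_right).trans ((h ⟨b, hb⟩).mono inf_le_left)).trans
    (h2.mono inf_le_right).symm

/-- The one-element `B_J`-set. -/
def unit (J : ZeroDimTopology B) : BJStr J PUnit.{u + 1} where
  cond _ _ _ := PUnit.unit
  cond_self _ _ := rfl
  cond_cond_left _ _ _ _ := rfl
  cond_cond_right _ _ _ _ := rfl
  cond_top _ _ := rfl
  cond_compl _ _ _ := rfl
  cond_inf _ _ _ _ := rfl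
  glue _ _ _ _ := PUnit.unit
  glue_const _ _ _ _ := rfl
  glue_cond _ _ _ _ _ := rfl
  cond_glue _ _ _ _ _ := rfl

/-- The product of two `B_J`-sets. -/
def prod (σ : BJStr J X) (τ : BJStr J Y) : BJStr J (X × Y) where
  cond b p q := (σ.cond b p.1 q.1, τ.cond b p.2 q.2)
  cond_self _ _ := Prod.ext (σ.cond_self _ _) (τ.cond_self _ _)
  cond_cond_left _ _ _ _ := Prod.ext (σ.cond_cond_left _ _ _ _) (τ.cond_cond_left _ _ _ _)
  cond_cond_right _ _ _ _ := Prod.ext (σ.cond_cond_right _ _ _ _) (τ.cond_cond_right _ _ _ _)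
  cond_top _ _ := Prod.ext (σ.cond_top _ _) (τ.cond_top _ _)
  cond_compl _ _ _ := Prod.ext (σ.cond_compl _ _ _) (τ.cond_compl _ _ _)
  cond_inf _ _ _ _ := Prod.ext (σ.cond_inf _ _ _ _) (τ.cond_inf _ _ _ _)
  glue P hP hi x := (σ.glue P hP hi fun b => (x b).1, τ.glue P hP hi fun b => (x b).2)
  glue_const _ _ _ _ := Prod.ext (σ.glue_const _ _ _ _) (τ.glue_const _ _ _ _)
  glue_cond _ _ _ _ _ := Prod.ext (σ.glue_cond _ _ _ _ _) (τ.glue_cond _ _ _ _ _)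
  cond_glue _ _ _ _ _ := Prod.ext (σ.cond_glue _ _ _ _ _) (τ.cond_glue _ _ _ _ _)

end BJStr

/-- Homomorphisms of `B_J`-sets. -/
@[ext]
structure BJHom {B : Type u} [BooleanAlgebra B] {J : ZeroDimTopology B} {X Y : Type u}
    (σ : BJStr J X) (τ : BJStr J Y) where
  toFun : X → Y
  map_cond : ∀ b x y, toFun (σ.cond b x y) = τ.cond b (toFun x) (toFun y)
  map_glue : ∀ (P : Set B) hP hi (x : P → X),
    toFun (σ.glue P hP hi x) = τ.glue P hP hi (fun b => toFun (x b))

namespace BJHom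

open BStr

variable {B : Type u} [BooleanAlgebra B] {J : ZeroDimTopology B} {X Y Z : Type u}
  {σ : BJStr J X} {τ : BJStr J Y} {υ : BJStr J Z}

/-- A map preserving the finitary operations preserves the infinitary ones. -/
theorem map_glue_of_map_cond (f : X → Y)
    (hf : ∀ b x y, f (σ.cond b x y) = τ.cond b (f x) (f y)) (P : Set B) (hP : P ∈ J.parts)
    (hi : P.Infinite) (x : P → X) :
    f (σ.glue P hP hi x) = τ.glue P hP hi (fun b => f (x b)) := by
  apply τ.eq_glue
  intro b
  unfold Eqv
  rw [← hf, σ.cond_glue]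

/-- A map preserving the finitary operations is a homomorphism. -/
def ofCond (σ : BJStr J X) (τ : BJStr J Y) (f : X → Y)
    (hf : ∀ b x y, f (σ.cond b x y) = τ.cond b (f x) (f y)) : BJHom σ τ :=
  ⟨f, hf, map_glue_of_map_cond f hf⟩

def id (σ : BJStr J X) : BJHom σ σ := ⟨_root_.id, fun _ _ _ => rfl, fun _ _ _ _ => rfl⟩

def comp (f : BJHom σ τ) (g : BJHom τ υ) : BJHom σ υ where
  toFun x := g.toFun (f.toFun x)
  map_cond b x y := by rw [f.map_cond, g.map_cond]
  map_glue P hP hi x := by rw [f.map_glue, g.map_glue]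

/-- The `B_J`-set of homomorphisms, with pointwise operations. -/
def homStr (σ : BJStr J X) (τ : BJStr J Y) : BJStr J (BJHom σ τ) where
  cond b f g := ofCond σ τ (fun x => τ.cond b (f.toFun x) (g.toFun x)) fun c x y => by
    rw [f.map_cond, g.map_cond, cond_interchange]
  cond_self _ _ := BJHom.ext (funext fun _ => τ.cond_self _ _)
  cond_cond_left _ _ _ _ := BJHom.ext (funext fun _ => τ.cond_cond_left _ _ _ _)
  cond_cond_right _ _ _ _ := BJHom.ext (funext fun _ => τ.cond_cond_right _ _ _ _)
  cond_top _ _ := BJHom.ext (funext fun _ => τ.cond_top _ _)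
  cond_compl _ _ _ := BJHom.ext (funext fun _ => τ.cond_compl _ _ _)
  cond_inf _ _ _ _ := BJHom.ext (funext fun _ => τ.cond_inf _ _ _ _)
  glue P hP hi f := ofCond σ τ (fun x => τ.glue P hP hi fun b => (f b).toFun x) fun c x y => by
    apply eq_cond
    · apply τ.glue_congr
      intro b
      rw [(f b).map_cond]
      exact cond_eqv_left _ _ _
    · apply τ.glue_congr
      intro b
      rw [(f b).map_cond]
      exact cond_eqv_right _ _ _
  glue_const _ _ _ _ := BJHom.ext (funext fun _ => τ.glue_const _ _ _ _)
  glue_cond _ _ _ _ _ := BJHom.ext (funext fun _ => τ.glue_cond _ _ _ _ _)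
  cond_glue _ _ _ _ _ := BJHom.ext (funext fun _ => τ.cond_glue _ _ _ _ _)

end BJHom

/-! ## Matched pairs and their sets -/

/-- A Grothendieck matched pair of algebras; `act m b` is `m^* b`. -/
structure MatchedPair (B M : Type u) [BooleanAlgebra B] [Monoid M] where
  J : ZeroDimTopology B
  str : BJStr J M
  act : M → BoundedLatticeHom B B
  act_one : ∀ b, act 1 b = b
  act_mul : ∀ m n b, act (m * n) b = act m (act n b)
  act_parts : ∀ m, ∀ P ∈ J.parts, (act m '' P) \ {⊥} ∈ J.parts
  cond_mul : ∀ b m n p, str.cond b m n * p = str.cond b (m * p) (n * p)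
  mul_cond : ∀ m b n p, m * str.cond b n p = str.cond (act m b) (m * n) (m * p)
  act_cond : ∀ b m n c, act (str.cond b m n) c = (b ⊓ act m c) ⊔ (bᶜ ⊓ act n c)

/-- The structure of a set over a matched pair; `smul m x` is `m · x`. -/
structure BJMStr {B M : Type u} [BooleanAlgebra B] [Monoid M] (𝔓 : MatchedPair B M)
    (X : Type u) extends BJStr 𝔓.J X where
  smul : M → X → X
  one_smul : ∀ x, smul 1 x = x
  mul_smul : ∀ m n x, smul (m * n) x = smul m (smul n x)
  cond_smul : ∀ b m n x, smul (𝔓.str.cond b m n) x = cond b (smul m x) (smul n x)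
  smul_cond : ∀ m b x y, smul m (cond b x y) = cond (𝔓.act m b) (smul m x) (smul m y)

namespace MatchedPair

open BStr

variable {B M : Type u} [BooleanAlgebra B] [Monoid M] (𝔓 : MatchedPair B M)

theorem mul_right_eqv {b : B} {m n : M} (h : 𝔓.str.Eqv b m n) (p : M) :
    𝔓.str.Eqv b (m * p) (n * p) := by
  have h' : 𝔓.str.cond b m n = n := h
  unfold Eqv
  rw [← 𝔓.cond_mul, h']

theorem mul_left_eqv (m : M) {b : B} {n p : M} (h : 𝔓.str.Eqv b n p) :
    𝔓.str.Eqv (𝔓.act m b) (m * n) (m * p) := by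
  have h' : 𝔓.str.cond b n p = p := h
  unfold Eqv
  rw [← 𝔓.mul_cond, h']

theorem inf_act_eq {b : B} {m n : M} (h : 𝔓.str.Eqv b m n) (c : B) :
    b ⊓ 𝔓.act m c = b ⊓ 𝔓.act n c := by
  have h' : 𝔓.str.cond b m n = n := h
  have := 𝔓.act_cond b m n c
  rw [h'] at this
  rw [this, inf_sup_left, ← inf_assoc, ← inf_assoc]
  simp

end MatchedPair

section

open BStr

variable {B M : Type u} [BooleanAlgebra B] [Monoid M] {𝔓 : MatchedPair B M} {X Y Z : Type u}

theorem BJMStr.smul_eqv (σ : BJMStr 𝔓 X) (m : M) {b : B} {x y : X} (h : σ.Eqv b x y) :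
    σ.Eqv (𝔓.act m b) (σ.smul m x) (σ.smul m y) := by
  have h' : σ.cond b x y = y := h
  unfold Eqv
  rw [← σ.smul_cond, h']

/-- Equivalence may be checked locally on the inverse image of a partition. -/
theorem BJStr.eqv_of_act (σ : BJStr 𝔓.J X) (m : M) {P : Set B} (hP : P ∈ 𝔓.J.parts) {c : B}
    {x y : X} (h : ∀ b ∈ P, σ.Eqv (c ⊓ 𝔓.act m b) x y) : σ.Eqv c x y := by
  apply σ.eqv_of_parts (𝔓.act_parts m P hP)
  rintro _ ⟨⟨b, hb, rfl⟩, -⟩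
  exact h b hb

theorem BJStr.eq_of_act (σ : BJStr 𝔓.J X) (m : M) {P : Set B} (hP : P ∈ 𝔓.J.parts)
    {x y : X} (h : ∀ b ∈ P, σ.Eqv (𝔓.act m b) x y) : x = y :=
  eqv_top.1 (σ.eqv_of_act m hP fun b hb => by simpa using h b hb)

theorem BJStr.exists_glue_act [Nontrivial B] (σ : BJStr 𝔓.J X) (m : M) {P : Set B}
    (hP : P ∈ 𝔓.J.parts) (x : P → X) : ∃ z, ∀ b : P, σ.Eqv (𝔓.act m b) z (x b) := by
  have hP' := 𝔓.act_parts m P hP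
  choose f hf using fun d : ((𝔓.act m '' P) \ {⊥} : Set B) => d.2.1
  obtain ⟨z, hz⟩ := σ.exists_glue hP' (fun d => x ⟨f d, (hf d).1⟩)
  refine ⟨z, fun b => ?_⟩
  by_cases h : 𝔓.act m b = ⊥
  · rw [h]
    exact eqv_bot _ _
  · let d : ((𝔓.act m '' P) \ {⊥} : Set B) := ⟨𝔓.act m b, ⟨b, b.2, rfl⟩, h⟩
    have h1 : σ.Eqv (𝔓.act m b) z (x ⟨f d, (hf d).1⟩) := hz d
    have h2 : f d = b := by
      by_contra hne
      apply h
      have h3 := (𝔓.J.isPartition P hP).2.2 _ (hf d).1 b b.2 hne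
      have h4 : 𝔓.act m (f d) = 𝔓.act m b := (hf d).2
      rw [← inf_idem (𝔓.act m b)]
      nth_rw 1 [← h4]
      rw [← map_inf, h3, map_bot]
    have h3 : (⟨f d, (hf d).1⟩ : P) = b := Subtype.ext h2
    rwa [h3] at h1

/-- The one-element set. -/
def BJMStr.unit (𝔓 : MatchedPair B M) : BJMStr 𝔓 PUnit.{u + 1} where
  toBJStr := BJStr.unit 𝔓.J
  smul _ _ := PUnit.unit
  one_smul _ := rfl
  mul_smul _ _ _ := rfl
  cond_smul _ _ _ _ := rfl
  smul_cond _ _ _ _ := rfl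

/-- Products. -/
def BJMStr.prod (σ : BJMStr 𝔓 X) (τ : BJMStr 𝔓 Y) : BJMStr 𝔓 (X × Y) where
  toBJStr := σ.toBJStr.prod τ.toBJStr
  smul m p := (σ.smul m p.1, τ.smul m p.2)
  one_smul _ := Prod.ext (σ.one_smul _) (τ.one_smul _)
  mul_smul _ _ _ := Prod.ext (σ.mul_smul _ _ _) (τ.mul_smul _ _ _)
  cond_smul _ _ _ _ := Prod.ext (σ.cond_smul _ _ _ _) (τ.cond_smul _ _ _ _)
  smul_cond _ _ _ _ := Prod.ext (σ.smul_cond _ _ _ _) (τ.smul_cond _ _ _ _)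

/-- The monoid `M` acting on itself by left multiplication. -/
def BJMStr.regular (𝔓 : MatchedPair B M) : BJMStr 𝔓 M where
  toBJStr := 𝔓.str
  smul m n := m * n
  one_smul := _root_.one_mul
  mul_smul := mul_assoc
  cond_smul := 𝔓.cond_mul
  smul_cond := 𝔓.mul_cond

/-- Homomorphisms of sets over a matched pair. -/
@[ext]
structure BJMHom (σ : BJMStr 𝔓 X) (τ : BJMStr 𝔓 Y) extends BJHom σ.toBJStr τ.toBJStr where
  map_smul : ∀ m x, toFun (σ.smul m x) = τ.smul m (toFun x)

namespace BJMHom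

variable {σ : BJMStr 𝔓 X} {τ : BJMStr 𝔓 Y} {υ : BJMStr 𝔓 Z}

theorem ext' {f g : BJMHom σ τ} (h : ∀ x, f.toFun x = g.toFun x) : f = g :=
  BJMHom.ext (funext h)

def id (σ : BJMStr 𝔓 X) : BJMHom σ σ := ⟨BJHom.id _, fun _ _ => rfl⟩

def comp (f : BJMHom σ τ) (g : BJMHom τ υ) : BJMHom σ υ where
  toBJHom := f.toBJHom.comp g.toBJHom
  map_smul m x := (congrArg g.toFun (f.map_smul m x)).trans (g.map_smul m _)

/-- A map preserving the finitary operations is a homomorphism. -/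
def ofCond (σ : BJMStr 𝔓 X) (τ : BJMStr 𝔓 Y) (f : X → Y)
    (hf : ∀ b x y, f (σ.cond b x y) = τ.cond b (f x) (f y))
    (hm : ∀ m x, f (σ.smul m x) = τ.smul m (f x)) : BJMHom σ τ :=
  ⟨BJHom.ofCond _ _ f hf, hm⟩

theorem map_eqv (f : BJMHom σ τ) {b : B} {x y : X} (h : σ.Eqv b x y) :
    τ.Eqv b (f.toFun x) (f.toFun y) := by
  have h' : σ.cond b x y = y := h
  unfold Eqv
  rw [← f.map_cond, h']

theorem map_pair_cond (f : BJMHom ((BJMStr.regular 𝔓).prod σ) τ) (b : B) (m n : M) (x y : X) :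
    f.toFun (𝔓.str.cond b m n, σ.cond b x y) = τ.cond b (f.toFun (m, x)) (f.toFun (n, y)) :=
  f.map_cond b (m, x) (n, y)

theorem map_pair_smul (f : BJMHom ((BJMStr.regular 𝔓).prod σ) τ) (k m : M) (x : X) :
    f.toFun (k * m, σ.smul k x) = τ.smul k (f.toFun (m, x)) :=
  f.map_smul k (m, x)

variable [Nontrivial B]

/-- The glueing of a family of elements of the function space: at `(m, y)` it is the unique
element which agrees with `f_b (m, y)` on `m^* b` for each `b ∈ P`. -/
noncomputable def expGlue (P : Set B) (hP : P ∈ 𝔓.J.parts)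
    (f : P → BJMHom ((BJMStr.regular 𝔓).prod σ) τ) : BJMHom ((BJMStr.regular 𝔓).prod σ) τ :=
  have spec := fun p : M × X => (τ.exists_glue_act p.1 hP fun b => (f b).toFun p).choose_spec
  ofCond _ _ (fun p => (τ.exists_glue_act p.1 hP fun b => (f b).toFun p).choose)
    (by
      intro c p q
      apply eq_cond
      · apply τ.eqv_of_act p.1 hP
        intro b hb
        have h1 := spec (((BJMStr.regular 𝔓).prod σ).cond c p q) ⟨b, hb⟩
        have h2 := spec p ⟨b, hb⟩
        have h3 : c ⊓ 𝔓.act p.1 b = c ⊓ 𝔓.act (𝔓.str.cond c p.1 q.1) b :=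
          𝔓.inf_act_eq (cond_eqv_left c p.1 q.1).symm b
        refine ((h1.mono (h3 ▸ inf_le_right)).trans ?_).trans (h2.mono inf_le_right).symm
        rw [(f ⟨b, hb⟩).map_cond]
        exact (cond_eqv_left _ _ _).mono inf_le_left
      · apply τ.eqv_of_act q.1 hP
        intro b hb
        have h1 := spec (((BJMStr.regular 𝔓).prod σ).cond c p q) ⟨b, hb⟩
        have h2 := spec q ⟨b, hb⟩
        have h3 : cᶜ ⊓ 𝔓.act q.1 b = cᶜ ⊓ 𝔓.act (𝔓.str.cond c p.1 q.1) b :=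
          𝔓.inf_act_eq (cond_eqv_right c p.1 q.1).symm b
        refine ((h1.mono (h3 ▸ inf_le_right)).trans ?_).trans (h2.mono inf_le_right).symm
        rw [(f ⟨b, hb⟩).map_cond]
        exact (cond_eqv_right _ _ _).mono inf_le_left)
    (by
      intro k p
      apply τ.eq_of_act (k * p.1) hP
      intro b hb
      have h1 := spec (((BJMStr.regular 𝔓).prod σ).smul k p) ⟨b, hb⟩
      have h2 := τ.smul_eqv k (spec p ⟨b, hb⟩)
      rw [← (f ⟨b, hb⟩).map_smul, ← 𝔓.act_mul] at h2
      exact h1.trans h2.symm)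

theorem expGlue_spec (P : Set B) (hP : P ∈ 𝔓.J.parts)
    (f : P → BJMHom ((BJMStr.regular 𝔓).prod σ) τ) (p : M × X) (b : P) :
    τ.Eqv (𝔓.act p.1 b) ((expGlue P hP f).toFun p) ((f b).toFun p) :=
  (τ.exists_glue_act p.1 hP fun b => (f b).toFun p).choose_spec b

/-- The function space `Z^Y`: homomorphisms `M × Y → Z`, where `(m · f)(n, y) = f(nm, y)` and
`f ≡_b g` iff `f(m, y) ≡_{m^* b} g(m, y)` for all `m` and `y`. -/
noncomputable def expStr (σ : BJMStr 𝔓 X) (τ : BJMStr 𝔓 Y) :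
    BJMStr 𝔓 (BJMHom ((BJMStr.regular 𝔓).prod σ) τ) where
  cond b f g := ofCond _ _ (fun p => τ.cond (𝔓.act p.1 b) (f.toFun p) (g.toFun p))
    (by
      rintro c ⟨m, x⟩ ⟨n, y⟩
      change τ.cond (𝔓.act (𝔓.str.cond c m n) b) (f.toFun (𝔓.str.cond c m n, σ.cond c x y))
        (g.toFun (𝔓.str.cond c m n, σ.cond c x y)) = _
      rw [map_pair_cond, map_pair_cond]
      apply eq_cond
      · exact (cond_congr (cond_eqv_left _ _ _) (cond_eqv_left _ _ _)).trans
          (cond_congr_index (𝔓.inf_act_eq (cond_eqv_left c m n) b) _ _)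
      · exact (cond_congr (cond_eqv_right _ _ _) (cond_eqv_right _ _ _)).trans
          (cond_congr_index (𝔓.inf_act_eq (cond_eqv_right c m n) b) _ _))
    (by
      rintro k ⟨m, x⟩
      change τ.cond (𝔓.act (k * m) b) (f.toFun (k * m, σ.smul k x))
        (g.toFun (k * m, σ.smul k x)) = _
      rw [map_pair_smul, map_pair_smul, τ.smul_cond, 𝔓.act_mul])
  cond_self _ _ := ext' fun _ => τ.cond_self _ _
  cond_cond_left _ _ _ _ := ext' fun _ => τ.cond_cond_left _ _ _ _
  cond_cond_right _ _ _ _ := ext' fun _ => τ.cond_cond_right _ _ _ _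
  cond_top f g := ext' fun p => by
    change τ.cond (𝔓.act p.1 ⊤) _ _ = _
    rw [map_top, τ.cond_top]
  cond_compl b f g := ext' fun p => by
    change τ.cond (𝔓.act p.1 bᶜ) _ _ = τ.cond (𝔓.act p.1 b) _ _
    rw [map_compl', τ.cond_compl]
  cond_inf b c f g := ext' fun p => by
    change τ.cond (𝔓.act p.1 (b ⊓ c)) _ _ =
      τ.cond (𝔓.act p.1 b) (τ.cond (𝔓.act p.1 c) _ _) _
    rw [map_inf, τ.cond_inf]
  glue P hP _ f := expGlue P hP f
  glue_const P hP hi f := ext' fun p =>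
    τ.eq_of_act p.1 hP fun b hb => expGlue_spec P hP (fun _ => f) p ⟨b, hb⟩
  glue_cond P hP hi f g := ext' fun p =>
    τ.eq_of_act p.1 hP fun b hb => ((expGlue_spec P hP _ p ⟨b, hb⟩).trans
      (cond_eqv_left (𝔓.act p.1 b) ((f ⟨b, hb⟩).toFun p) ((g ⟨b, hb⟩).toFun p))).trans
        (expGlue_spec P hP f p ⟨b, hb⟩).symm
  cond_glue P hP hi f b := ext' fun p => expGlue_spec P hP f p b
  smul m f := ofCond _ _ (fun p => f.toFun (p.1 * m, p.2))
    (by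
      rintro c ⟨n, x⟩ ⟨p, y⟩
      change f.toFun (𝔓.str.cond c n p * m, σ.cond c x y) = _
      rw [𝔓.cond_mul, map_pair_cond])
    (by
      rintro k ⟨n, x⟩
      change f.toFun (k * n * m, σ.smul k x) = _
      rw [mul_assoc, map_pair_smul])
  one_smul f := ext' fun p => by
    change f.toFun (p.1 * 1, p.2) = _
    rw [mul_one]
  mul_smul m n f := ext' fun p => by
    change f.toFun (p.1 * (m * n), p.2) = f.toFun (p.1 * m * n, p.2)
    rw [mul_assoc]
  cond_smul b m n f := ext' fun p => by
    change f.toFun (p.1 * 𝔓.str.cond b m n, p.2) =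
      τ.cond (𝔓.act p.1 b) (f.toFun (p.1 * m, p.2)) (f.toFun (p.1 * n, p.2))
    rw [𝔓.mul_cond, ← map_pair_cond, σ.cond_self]
  smul_cond m b f g := ext' fun p => by
    change τ.cond (𝔓.act (p.1 * m) b) (f.toFun (p.1 * m, p.2)) (g.toFun (p.1 * m, p.2)) =
      τ.cond (𝔓.act p.1 (𝔓.act m b)) (f.toFun (p.1 * m, p.2)) (g.toFun (p.1 * m, p.2))
    rw [𝔓.act_mul]

/-- Transposition: `f : Y × W → Z` corresponds to `w ↦ ((m, y) ↦ f (y, m · w))`, and evaluation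
is `(y, g) ↦ g (1, y)`. -/
noncomputable def curryEquiv (σ : BJMStr 𝔓 X) (υ : BJMStr 𝔓 Z) (τ : BJMStr 𝔓 Y) :
    BJMHom (σ.prod υ) τ ≃ BJMHom υ (expStr σ τ) where
  toFun f := ofCond υ (expStr σ τ)
    (fun w => ofCond ((BJMStr.regular 𝔓).prod σ) τ (fun p => f.toFun (p.2, υ.smul p.1 w))
      (by
        rintro b ⟨m, x⟩ ⟨n, y⟩
        refine Eq.trans ?_ (f.map_cond b (x, υ.smul m w) (y, υ.smul n w))
        exact congrArg (fun z => f.toFun (σ.cond b x y, z)) (υ.cond_smul b m n w))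
      (by
        rintro k ⟨m, x⟩
        refine Eq.trans ?_ (f.map_smul k (x, υ.smul m w))
        exact congrArg (fun z => f.toFun (σ.smul k x, z)) (υ.mul_smul k m w)))
    (by
      intro b v w
      apply ext'
      rintro ⟨m, x⟩
      refine Eq.trans ?_ (f.map_cond (𝔓.act m b) (x, υ.smul m v) (x, υ.smul m w))
      change f.toFun (x, υ.smul m (υ.cond b v w)) =
        f.toFun (σ.cond (𝔓.act m b) x x, υ.cond (𝔓.act m b) _ _)
      rw [υ.smul_cond, σ.cond_self])
    (by
      intro k w
      apply ext'
      rintro ⟨m, x⟩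
      exact congrArg (fun z => f.toFun (x, z)) (υ.mul_smul m k w).symm)
  invFun g := ofCond (σ.prod υ) τ (fun p => (g.toFun p.2).toFun (1, p.1))
    (by
      rintro b ⟨x, v⟩ ⟨y, w⟩
      have h2 : ∀ f : BJMHom ((BJMStr.regular 𝔓).prod σ) τ,
          f.toFun (1, σ.cond b x y) = τ.cond b (f.toFun (1, x)) (f.toFun (1, y)) := by
        intro f
        rw [← map_pair_cond, 𝔓.str.cond_self]
      change (g.toFun (υ.cond b v w)).toFun (1, σ.cond b x y) =
        τ.cond b ((g.toFun v).toFun (1, x)) ((g.toFun w).toFun (1, y))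
      rw [g.map_cond]
      change τ.cond (𝔓.act 1 b) ((g.toFun v).toFun (1, σ.cond b x y))
        ((g.toFun w).toFun (1, σ.cond b x y)) = _
      rw [𝔓.act_one, h2, h2, τ.cond_cond_left, τ.cond_cond_right])
    (by
      rintro k ⟨x, w⟩
      change (g.toFun (υ.smul k w)).toFun (1, σ.smul k x) =
        τ.smul k ((g.toFun w).toFun (1, x))
      rw [g.map_smul, ← map_pair_smul]
      change (g.toFun w).toFun (1 * k, _) = _
      rw [_root_.one_mul, mul_one])
  left_inv f := ext' fun p => congrArg (fun z => f.toFun (p.1, z)) (υ.one_smul p.2)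
  right_inv g := ext' fun w => ext' fun p => by
    change (g.toFun (υ.smul p.1 w)).toFun (1, p.2) = (g.toFun w).toFun p
    rw [g.map_smul]
    change (g.toFun w).toFun (1 * p.1, p.2) = _
    rw [_root_.one_mul]

end BJMHom

end

/-! ## The two cartesian closed categories and the forgetful functor -/

/-- Bundled `B_J`-sets. -/
structure BJSet {B : Type u} [BooleanAlgebra B] (J : ZeroDimTopology B) where
  carrier : Type u
  str : BJStr J carrier

/-- Bundled sets over a matched pair. -/
structure BJMSet {B M : Type u} [BooleanAlgebra B] [Monoid M] (𝔓 : MatchedPair B M) where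
  carrier : Type u
  str : BJMStr 𝔓 carrier

namespace BJSet

variable {B : Type u} [BooleanAlgebra B] {J : ZeroDimTopology B}

instance : Category.{u} (BJSet J) where
  Hom X Y := BJHom X.str Y.str
  id X := BJHom.id X.str
  comp f g := BJHom.comp f g

theorem hom_ext {X Y : BJSet J} {f g : X ⟶ Y} (h : ∀ x, BJHom.toFun f x = BJHom.toFun g x) :
    f = g :=
  BJHom.ext (funext h)

/-- The terminal `B_J`-set. -/
def unit (J : ZeroDimTopology B) : BJSet J := ⟨PUnit, BJStr.unit J⟩

/-- Binary products of `B_J`-sets. -/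
def prod (X Y : BJSet J) : BJSet J := ⟨X.carrier × Y.carrier, X.str.prod Y.str⟩

def fst (X Y : BJSet J) : prod X Y ⟶ X :=
  { toFun := fun p => p.1, map_cond := fun _ _ _ => rfl, map_glue := fun _ _ _ _ => rfl }

def snd (X Y : BJSet J) : prod X Y ⟶ Y :=
  { toFun := fun p => p.2, map_cond := fun _ _ _ => rfl, map_glue := fun _ _ _ _ => rfl }

def lift {W X Y : BJSet J} (f : W ⟶ X) (g : W ⟶ Y) : W ⟶ prod X Y :=
  { toFun := fun w => (BJHom.toFun f w, BJHom.toFun g w)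
    map_cond := fun b x y => Prod.ext (BJHom.map_cond f b x y) (BJHom.map_cond g b x y)
    map_glue := fun P hP hi x => Prod.ext (BJHom.map_glue f P hP hi x)
      (BJHom.map_glue g P hP hi x) }

def unitIsTerminal (J : ZeroDimTopology B) : Limits.IsTerminal (unit J) :=
  Limits.IsTerminal.ofUniqueHom
    (fun _ =>
      { toFun := fun _ => PUnit.unit
        map_cond := fun _ _ _ => rfl
        map_glue := fun _ _ _ _ => rfl })
    (fun _ _ => hom_ext fun _ => rfl)

def prodIsLimit (X Y : BJSet J) : Limits.IsLimit (Limits.BinaryFan.mk (fst X Y) (snd X Y)) :=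
  Limits.BinaryFan.IsLimit.mk _ (fun f g => lift f g) (fun _ _ => rfl) (fun _ _ => rfl)
    (fun _ _ _ h₁ h₂ => hom_ext fun w =>
      Prod.ext (congrArg (fun k => BJHom.toFun k w) h₁) (congrArg (fun k => BJHom.toFun k w) h₂))

instance : CartesianMonoidalCategory (BJSet J) :=
  CartesianMonoidalCategory.ofChosenFiniteProducts ⟨_, unitIsTerminal J⟩
    fun X Y => ⟨_, prodIsLimit X Y⟩

/-- The exponential `Y^X` of `B_J`-sets. -/
def exp (X Y : BJSet J) : BJSet J := ⟨BJHom X.str Y.str, BJHom.homStr X.str Y.str⟩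

def curryEquiv (X W Y : BJSet J) :
    ((MonoidalCategory.tensorLeft X).obj W ⟶ Y) ≃ (W ⟶ exp X Y) where
  toFun f := BJHom.ofCond _ _
    (fun w => BJHom.ofCond _ _ (fun x => BJHom.toFun f (x, w)) (by
      intro b x y
      have := BJHom.map_cond f b (x, w) (y, w)
      rw [← this]
      exact congrArg (fun z => BJHom.toFun f (X.str.cond b x y, z)) (W.str.cond_self b w).symm))
    (by
      intro b v w
      apply BJHom.ext
      funext x
      have := BJHom.map_cond f b (x, v) (x, w)
      refine Eq.trans ?_ this
      exact congrArg (fun z => BJHom.toFun f (z, W.str.cond b v w)) (X.str.cond_self b x).symm)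
  invFun g := BJHom.ofCond _ _ (fun p => BJHom.toFun (BJHom.toFun g p.2) p.1) (by
      rintro b ⟨x, v⟩ ⟨y, w⟩
      have h1 := BJHom.map_cond g b v w
      change BJHom.toFun (BJHom.toFun g (W.str.cond b v w)) (X.str.cond b x y) =
        Y.str.cond b (BJHom.toFun (BJHom.toFun g v) x) (BJHom.toFun (BJHom.toFun g w) y)
      rw [h1]
      change Y.str.cond b (BJHom.toFun (BJHom.toFun g v) (X.str.cond b x y))
        (BJHom.toFun (BJHom.toFun g w) (X.str.cond b x y)) = _
      rw [BJHom.map_cond, BJHom.map_cond, Y.str.cond_cond_left, Y.str.cond_cond_right])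
  left_inv _ := rfl
  right_inv _ := rfl

instance : MonoidalClosed (BJSet J) where
  closed X :=
    { rightAdj := Adjunction.rightAdjointOfEquiv (curryEquiv X) (fun _ _ _ _ _ => rfl)
      adj := Adjunction.adjunctionOfEquivRight (curryEquiv X) (fun _ _ _ _ _ => rfl) }

end BJSet

namespace BJMSet

variable {B M : Type u} [BooleanAlgebra B] [Monoid M] {𝔓 : MatchedPair B M}

instance : Category.{u} (BJMSet 𝔓) where
  Hom X Y := BJMHom X.str Y.str
  id X := BJMHom.id X.str
  comp f g := BJMHom.comp f g

/-- The underlying function of a morphism. -/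
def fn {X Y : BJMSet 𝔓} (f : X ⟶ Y) : X.carrier → Y.carrier :=
  (BJMHom.toBJHom f).toFun

theorem hom_ext {X Y : BJMSet 𝔓} {f g : X ⟶ Y} (h : ∀ x, fn f x = fn g x) : f = g :=
  BJMHom.ext' h

/-- The terminal object. -/
def unit (𝔓 : MatchedPair B M) : BJMSet 𝔓 := ⟨PUnit, BJMStr.unit 𝔓⟩

/-- Binary products. -/
def prod (X Y : BJMSet 𝔓) : BJMSet 𝔓 := ⟨X.carrier × Y.carrier, X.str.prod Y.str⟩

def fst (X Y : BJMSet 𝔓) : prod X Y ⟶ X :=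
  BJMHom.ofCond _ _ (fun p => p.1) (fun _ _ _ => rfl) (fun _ _ => rfl)

def snd (X Y : BJMSet 𝔓) : prod X Y ⟶ Y :=
  BJMHom.ofCond _ _ (fun p => p.2) (fun _ _ _ => rfl) (fun _ _ => rfl)

def lift {W X Y : BJMSet 𝔓} (f : W ⟶ X) (g : W ⟶ Y) : W ⟶ prod X Y :=
  BJMHom.ofCond _ _ (fun w => (fn f w, fn g w))
    (fun b x y => Prod.ext (f.map_cond b x y) (g.map_cond b x y))
    (fun m x => Prod.ext (f.map_smul m x) (g.map_smul m x))

def unitIsTerminal (𝔓 : MatchedPair B M) : Limits.IsTerminal (unit 𝔓) :=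
  Limits.IsTerminal.ofUniqueHom
    (fun _ => BJMHom.ofCond _ _ (fun _ => PUnit.unit) (fun _ _ _ => rfl) (fun _ _ => rfl))
    (fun _ _ => hom_ext fun _ => rfl)

def prodIsLimit (X Y : BJMSet 𝔓) : Limits.IsLimit (Limits.BinaryFan.mk (fst X Y) (snd X Y)) :=
  Limits.BinaryFan.IsLimit.mk _ (fun f g => lift f g) (fun _ _ => rfl) (fun _ _ => rfl)
    (fun _ _ _ h₁ h₂ => hom_ext fun w =>
      Prod.ext (congrArg (fun k => fn k w) h₁) (congrArg (fun k => fn k w) h₂))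

instance : CartesianMonoidalCategory (BJMSet 𝔓) :=
  CartesianMonoidalCategory.ofChosenFiniteProducts ⟨_, unitIsTerminal 𝔓⟩
    fun X Y => ⟨_, prodIsLimit X Y⟩

variable [Nontrivial B]

/-- The exponential `Y^X`: homomorphisms `M × X → Y`. -/
noncomputable def exp (X Y : BJMSet 𝔓) : BJMSet 𝔓 :=
  ⟨BJMHom ((BJMStr.regular 𝔓).prod X.str) Y.str, BJMHom.expStr X.str Y.str⟩

/-- Transposition: `f : X × W → Y` corresponds to `w ↦ ((m, x) ↦ f (x, m · w))`. -/
noncomputable def curryEquiv (X W Y : BJMSet 𝔓) :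
    ((MonoidalCategory.tensorLeft X).obj W ⟶ Y) ≃ (W ⟶ exp X Y) :=
  BJMHom.curryEquiv X.str W.str Y.str

theorem curryEquiv_naturality (X : BJMSet 𝔓) (W' W Y : BJMSet 𝔓) (f : W' ⟶ W)
    (g : (MonoidalCategory.tensorLeft X).obj W ⟶ Y) :
    curryEquiv X W' Y ((MonoidalCategory.tensorLeft X).map f ≫ g) = f ≫ curryEquiv X W Y g :=
  hom_ext fun w => BJMHom.ext' fun p =>
    congrArg (fun z => fn g (p.2, z)) (BJMHom.map_smul f p.1 w)

noncomputable instance : MonoidalClosed (BJMSet 𝔓) where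
  closed X :=
    { rightAdj := Adjunction.rightAdjointOfEquiv (curryEquiv X) (curryEquiv_naturality X)
      adj := Adjunction.adjunctionOfEquivRight (curryEquiv X) (curryEquiv_naturality X) }

end BJMSet

/-- The forgetful functor. -/
def forget {B M : Type u} [BooleanAlgebra B] [Monoid M] (𝔓 : MatchedPair B M) :
    BJMSet 𝔓 ⥤ BJSet 𝔓.J where
  obj X := ⟨X.carrier, X.str.toBJStr⟩
  map f := BJMHom.toBJHom f

instance {B M : Type u} [BooleanAlgebra B] [Monoid M] (𝔓 : MatchedPair B M) :
    Limits.PreservesLimitsOfShape (Discrete Limits.WalkingPair) (forget 𝔓) where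
  preservesLimit {K} := by
    have h : Limits.PreservesLimit (Limits.pair (K.obj ⟨.left⟩) (K.obj ⟨.right⟩)) (forget 𝔓) := by
      apply Limits.preservesLimit_of_preserves_limit_cone (BJMSet.prodIsLimit _ _)
      refine (Limits.isLimitMapConeBinaryFanEquiv (forget 𝔓) (BJMSet.fst _ _)
        (BJMSet.snd _ _)).symm ?_
      exact BJSet.prodIsLimit _ _
    exact Limits.preservesLimit_of_iso_diagram (forget 𝔓) (Limits.diagramIsoPair K).symm

/-! ## The syntactic condition -/

/-- For all `m ∈ M` there are `{b_i : i ∈ I} ∈ J` and families `n_i ∈ M`, `c_i ∈ B` with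
`b_i ≤ m^* c_i`, `m n_i ≡_{b_i} 1` and `n_i m ≡_{c_i} 1` for all `i`. -/
def MatchedPair.HasPartialInverses {B M : Type u} [BooleanAlgebra B] [Monoid M]
    (𝔓 : MatchedPair B M) : Prop :=
  ∀ m : M, ∃ (I : Type u) (b : I → B) (n : I → M) (c : I → B), Set.range b ∈ 𝔓.J.parts ∧
    ∀ i, b i ≤ 𝔓.act m (c i) ∧ 𝔓.str.Eqv (b i) (m * n i) 1 ∧ 𝔓.str.Eqv (c i) (n i * m) 1

/-! ## Restriction monoids -/

/-- (Left) restriction monoids with zero; `plus s` is `s⁺`. -/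
class RestrictionMonoid (S : Type u) extends MonoidWithZero S where
  plus : S → S
  plus_mul_self : ∀ s, plus s * s = s
  plus_plus_mul : ∀ s t, plus (plus s * t) = plus s * plus t
  plus_comm : ∀ s t, plus s * plus t = plus t * plus s
  mul_plus : ∀ s t, s * plus t = plus (s * t) * s
  plus_zero : plus 0 = 0

namespace RestrictionMonoid

variable {S : Type u} [RestrictionMonoid S]

/-- The order `s ≤ t` iff `s⁺ t = s`. -/
def Le (s t : S) : Prop := plus s * t = s

/-- `s` is the join of `A` with respect to the order of `S`. -/
def IsJoin (A : Set S) (s : S) : Prop :=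
  (∀ a ∈ A, Le a s) ∧ ∀ t, (∀ a ∈ A, Le a t) → Le s t

/-- `A` is admissible with respect to a family `J` of partitions of the Boolean algebra of
restriction idempotents: its elements are pairwise disjoint, and `{a⁺ : a ∈ A} \ {0}` is contained
in some member of `J`. -/
def Admissible (J : Set (Set S)) (A : Set S) : Prop :=
  (∀ a ∈ A, ∀ b ∈ A, a ≠ b → plus a * plus b = 0) ∧ ∃ Q ∈ J, (plus '' A) \ {0} ⊆ Q

/-- Partial isomorphisms. -/
def IsPartialIso (s : S) : Prop := ∃ t : S, s * t = plus s ∧ t * s = plus t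

/-- Every element is an admissible join of partial isomorphisms. -/
def IsEtale (J : Set (Set S)) : Prop :=
  ∀ s : S, ∃ A : Set S, Admissible J A ∧ (∀ a ∈ A, IsPartialIso a) ∧ IsJoin A s

end RestrictionMonoid

namespace MatchedPair

open BStr

variable {B M : Type u} [BooleanAlgebra B] [Monoid M] (𝔓 : MatchedPair B M)

/-- `(b, m)` and `(c, n)` represent the same element `m|_b = n|_c` iff `b = c` and `m ≡_b n`. -/
def restrSetoid : Setoid (B × M) where
  r p q := p.1 = q.1 ∧ 𝔓.str.Eqv p.1 p.2 q.2
  iseqv :=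
    { refl := fun _ => ⟨rfl, Eqv.refl _ _⟩
      symm := fun h => ⟨h.1.symm, h.1 ▸ h.2.symm⟩
      trans := fun h k => ⟨h.1.trans k.1, h.2.trans (h.1 ▸ k.2)⟩ }

/-- The associated restriction monoid, with elements `m|_b` for `b ∈ B` and `m ∈ M / ≡_b`. -/
def Restr : Type u := Quotient 𝔓.restrSetoid

variable {𝔓}

/-- The element `m|_b`. -/
def Restr.mk (b : B) (m : M) : 𝔓.Restr := Quotient.mk 𝔓.restrSetoid (b, m)

theorem Restr.mk_eq {b c : B} {m n : M} :
    (Restr.mk b m : 𝔓.Restr) = Restr.mk c n ↔ b = c ∧ 𝔓.str.Eqv b m n :=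
  ⟨fun h => Quotient.exact h, fun h => Quotient.sound h⟩

theorem Restr.ind {p : 𝔓.Restr → Prop} (h : ∀ b m, p (Restr.mk b m)) (s : 𝔓.Restr) : p s :=
  Quotient.ind (fun q => h q.1 q.2) s

/-- `m|_b * n|_c = (mn)|_{b ∧ m^* c}`, `1 = 1|_1`, `0 = 1|_0` and `(m|_b)⁺ = 1|_b`. -/
instance : RestrictionMonoid 𝔓.Restr where
  mul := Quotient.map₂ (fun p q => (p.1 ⊓ 𝔓.act p.2 q.1, p.2 * q.2)) (by
    rintro ⟨b, m⟩ ⟨b', m'⟩ ⟨rfl, h⟩ ⟨c, n⟩ ⟨c', n'⟩ ⟨rfl, h'⟩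
    refine ⟨𝔓.inf_act_eq h c, ?_⟩
    exact ((𝔓.mul_left_eqv m h').mono inf_le_right).trans
      ((𝔓.mul_right_eqv h n').mono inf_le_left))
  one := Restr.mk ⊤ 1
  zero := Restr.mk ⊥ 1
  plus := Quotient.map (fun p => (p.1, 1)) (by
    rintro ⟨b, m⟩ ⟨b', m'⟩ ⟨rfl, h⟩
    exact ⟨rfl, Eqv.refl _ _⟩)
  mul_assoc := by
    refine Restr.ind fun b m => Restr.ind fun c n => Restr.ind fun d p => ?_
    refine Restr.mk_eq.2 ⟨?_, ?_⟩
    · change b ⊓ 𝔓.act m c ⊓ 𝔓.act (m * n) d = b ⊓ 𝔓.act m (c ⊓ 𝔓.act n d)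
      rw [map_inf, 𝔓.act_mul, inf_assoc]
    · change 𝔓.str.Eqv _ (m * n * p) (m * (n * p))
      rw [mul_assoc]
      exact Eqv.refl _ _
  one_mul := by
    refine Restr.ind fun b m => ?_
    refine Restr.mk_eq.2 ⟨?_, ?_⟩
    · change ⊤ ⊓ 𝔓.act 1 b = b
      rw [𝔓.act_one, top_inf_eq]
    · change 𝔓.str.Eqv _ (1 * m) m
      rw [one_mul]
      exact Eqv.refl _ _
  mul_one := by
    refine Restr.ind fun b m => ?_
    refine Restr.mk_eq.2 ⟨?_, ?_⟩
    · change b ⊓ 𝔓.act m ⊤ = b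
      rw [map_top, inf_top_eq]
    · change 𝔓.str.Eqv _ (m * 1) m
      rw [mul_one]
      exact Eqv.refl _ _
  zero_mul := by
    refine Restr.ind fun b m => ?_
    refine Restr.mk_eq.2 ⟨bot_inf_eq _, ?_⟩
    exact (eqv_bot _ _).mono (bot_inf_eq _).le
  mul_zero := by
    refine Restr.ind fun b m => ?_
    have h : b ⊓ 𝔓.act m ⊥ = ⊥ := by rw [map_bot, inf_bot_eq]
    exact Restr.mk_eq.2 ⟨h, (eqv_bot _ _).mono h.le⟩
  plus_mul_self := by
    refine Restr.ind fun b m => ?_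
    refine Restr.mk_eq.2 ⟨?_, ?_⟩
    · change b ⊓ 𝔓.act 1 b = b
      rw [𝔓.act_one, inf_idem]
    · change 𝔓.str.Eqv _ (1 * m) m
      rw [one_mul]
      exact Eqv.refl _ _
  plus_plus_mul := by
    refine Restr.ind fun b m => Restr.ind fun c n => ?_
    refine Restr.mk_eq.2 ⟨rfl, ?_⟩
    change 𝔓.str.Eqv _ 1 (1 * 1)
    rw [one_mul]
    exact Eqv.refl _ _
  plus_comm := by
    refine Restr.ind fun b m => Restr.ind fun c n => ?_
    refine Restr.mk_eq.2 ⟨?_, Eqv.refl _ _⟩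
    change b ⊓ 𝔓.act 1 c = c ⊓ 𝔓.act 1 b
    rw [𝔓.act_one, 𝔓.act_one, inf_comm]
  mul_plus := by
    refine Restr.ind fun b m => Restr.ind fun c n => ?_
    refine Restr.mk_eq.2 ⟨?_, ?_⟩
    · change b ⊓ 𝔓.act m c = b ⊓ 𝔓.act m c ⊓ 𝔓.act 1 b
      rw [𝔓.act_one, inf_assoc, inf_comm (𝔓.act m c), ← inf_assoc, inf_idem]
    · change 𝔓.str.Eqv _ (m * 1) (1 * m)
      rw [one_mul, mul_one]
      exact Eqv.refl _ _
  plus_zero := rfl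

variable (𝔓)

/-- The zero-dimensional topology, transported along `b ↦ 1|_b` to the restriction idempotents. -/
def restrParts : Set (Set 𝔓.Restr) :=
  {Q | ∃ P ∈ 𝔓.J.parts, Q = (fun b => Restr.mk b 1) '' P}

end MatchedPair

/-! ## The classifying topological category -/

/-- Ultrafilters on a Boolean algebra. -/
@[ext]
structure BoolUltrafilter (B : Type u) [BooleanAlgebra B] where
  carrier : Set B
  top_mem : ⊤ ∈ carrier
  inf_mem : ∀ {b c}, b ∈ carrier → c ∈ carrier → b ⊓ c ∈ carrier
  mem_of_le : ∀ {b c}, b ∈ carrier → b ≤ c → c ∈ carrier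
  compl_mem_iff : ∀ {b}, bᶜ ∈ carrier ↔ b ∉ carrier

/-- The Stone topology. -/
instance {B : Type u} [BooleanAlgebra B] : TopologicalSpace (BoolUltrafilter B) :=
  TopologicalSpace.generateFrom (Set.range fun b : B => {U | b ∈ U.carrier})

namespace MatchedPair

open BStr

variable {B M : Type u} [BooleanAlgebra B] [Monoid M] (𝔓 : MatchedPair B M)

/-- `m_! U = {b : m^* b ∈ U}`. -/
def push (m : M) (U : BoolUltrafilter B) : BoolUltrafilter B where
  carrier := {b | 𝔓.act m b ∈ U.carrier}
  top_mem := by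
    change 𝔓.act m ⊤ ∈ U.carrier
    rw [map_top]
    exact U.top_mem
  inf_mem {b c} hb hc := by
    change 𝔓.act m (b ⊓ c) ∈ U.carrier
    rw [map_inf]
    exact U.inf_mem hb hc
  mem_of_le hb hbc := U.mem_of_le hb (OrderHomClass.mono (𝔓.act m) hbc)
  compl_mem_iff {b} := by
    change 𝔓.act m bᶜ ∈ U.carrier ↔ 𝔓.act m b ∉ U.carrier
    rw [map_compl', U.compl_mem_iff]

/-- The objects of the classifying topological category: the Stone space of `B`. -/
structure Cls (𝔓 : MatchedPair B M) : Type u where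
  point : BoolUltrafilter B

/-- Arrows from `U` to `V`: elements `m` with `m_! U = V`, where `m` and `n` are identified when
`m ≡_b n` for some `b ∈ U`. -/
def arrowSetoid (U V : BoolUltrafilter B) : Setoid {m : M // 𝔓.push m U = V} where
  r m n := ∃ b ∈ U.carrier, 𝔓.str.Eqv b m.1 n.1
  iseqv :=
    { refl := fun _ => ⟨⊤, U.top_mem, Eqv.refl _ _⟩
      symm := fun ⟨b, hb, h⟩ => ⟨b, hb, h.symm⟩
      trans := fun ⟨b, hb, h⟩ ⟨c, hc, k⟩ =>
        ⟨b ⊓ c, U.inf_mem hb hc, (h.mono inf_le_left).trans (k.mono inf_le_right)⟩ }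

theorem push_one (U : BoolUltrafilter B) : 𝔓.push 1 U = U := by
  ext b
  change 𝔓.act 1 b ∈ U.carrier ↔ _
  rw [𝔓.act_one]

theorem push_mul (m n : M) (U : BoolUltrafilter B) :
    𝔓.push (m * n) U = 𝔓.push n (𝔓.push m U) := by
  ext b
  change 𝔓.act (m * n) b ∈ U.carrier ↔ 𝔓.act m (𝔓.act n b) ∈ U.carrier
  rw [𝔓.act_mul]

instance : Category.{u} 𝔓.Cls where
  Hom U V := Quotient (𝔓.arrowSetoid U.point V.point)
  id U := Quotient.mk _ ⟨1, 𝔓.push_one U.point⟩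
  comp {U V W} f g := Quotient.map₂
    (fun (m : {m : M // 𝔓.push m U.point = V.point})
        (n : {n : M // 𝔓.push n V.point = W.point}) =>
      (⟨m.1 * n.1, by rw [push_mul, m.2, n.2]⟩ : {m : M // 𝔓.push m U.point = W.point}))
    (by
      rintro ⟨m, hm⟩ ⟨m', hm'⟩ ⟨b, hb, h⟩ ⟨n, hn⟩ ⟨n', hn'⟩ ⟨c, hc, k⟩
      have hc' : 𝔓.act m c ∈ U.point.carrier := by
        rw [← hm] at hc
        exact hc
      exact ⟨𝔓.act m c ⊓ b, U.point.inf_mem hc' hb,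
        ((𝔓.mul_left_eqv m k).mono inf_le_left).trans
          ((𝔓.mul_right_eqv h n').mono inf_le_right)⟩) f g
  id_comp f := by
    induction f using Quotient.ind with
    | _ m => exact congrArg (Quotient.mk _) (Subtype.ext (one_mul m.1))
  comp_id f := by
    induction f using Quotient.ind with
    | _ m => exact congrArg (Quotient.mk _) (Subtype.ext (mul_one m.1))
  assoc f g h := by
    induction f using Quotient.ind with
    | _ m =>
      induction g using Quotient.ind with
      | _ n =>
        induction h using Quotient.ind with
        | _ p => exact congrArg (Quotient.mk _) (Subtype.ext (mul_assoc m.1 n.1 p.1))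

/-- The space of objects is the Stone space of `B`. -/
instance : TopologicalSpace 𝔓.Cls := TopologicalSpace.induced Cls.point inferInstance

/-- The space of arrows. -/
structure Arr (𝔓 : MatchedPair B M) : Type u where
  src : 𝔓.Cls
  tgt : 𝔓.Cls
  hom : src ⟶ tgt

/-- The arrow `(U, m) : U ⟶ m_! U`. -/
def Arr.mk' (U : BoolUltrafilter B) (m : M) : 𝔓.Arr :=
  ⟨⟨U⟩, ⟨𝔓.push m U⟩, Quotient.mk (𝔓.arrowSetoid U (𝔓.push m U)) ⟨m, rfl⟩⟩

/-- The set of arrows `(U, m)` with `b ∈ U`. -/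
def basicArr (b : B) (m : M) : Set 𝔓.Arr :=
  {f | ∃ U : BoolUltrafilter B, b ∈ U.carrier ∧ f = Arr.mk' 𝔓 U m}

/-- The topology on the space of arrows, generated by the sets `{(U, m) : b ∈ U}`. -/
instance : TopologicalSpace 𝔓.Arr :=
  TopologicalSpace.generateFrom (Set.range fun p : B × M => 𝔓.basicArr p.1 p.2)

variable {𝔓}

theorem Arr.exists_rep (f : 𝔓.Arr) : ∃ U m, f = Arr.mk' 𝔓 U m := by
  obtain ⟨⟨U⟩, ⟨V⟩, f⟩ := f
  induction f using Quotient.ind with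
  | _ m =>
    obtain ⟨m, hm⟩ := m
    change 𝔓.push m U = V at hm
    subst hm
    exact ⟨U, m, rfl⟩

theorem Arr.mk'_eq {U : BoolUltrafilter B} {m n : M} {b : B} (hb : b ∈ U.carrier)
    (h : 𝔓.str.Eqv b m n) : Arr.mk' 𝔓 U m = Arr.mk' 𝔓 U n := by
  have h1 : 𝔓.push m U = 𝔓.push n U := by
    ext c
    change 𝔓.act m c ∈ U.carrier ↔ 𝔓.act n c ∈ U.carrier
    have h2 := 𝔓.inf_act_eq h c
    constructor
    · intro hc
      exact U.mem_of_le (h2 ▸ U.inf_mem hb hc) inf_le_right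
    · intro hc
      exact U.mem_of_le (h2.symm ▸ U.inf_mem hb hc) inf_le_right
  have key : ∀ (V : BoolUltrafilter B) (hm : 𝔓.push m U = V) (hn : 𝔓.push n U = V),
      (⟨⟨U⟩, ⟨V⟩, Quotient.mk (𝔓.arrowSetoid U V) ⟨m, hm⟩⟩ : 𝔓.Arr) =
        ⟨⟨U⟩, ⟨V⟩, Quotient.mk (𝔓.arrowSetoid U V) ⟨n, hn⟩⟩ := by
    intro V hm hn
    have : Quotient.mk (𝔓.arrowSetoid U V) ⟨m, hm⟩ = Quotient.mk (𝔓.arrowSetoid U V) ⟨n, hn⟩ :=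
      Quotient.sound ⟨b, hb, h⟩
    rw [this]
  have key2 : ∀ (V : BoolUltrafilter B) (hn : 𝔓.push n U = V),
      (⟨⟨U⟩, ⟨V⟩, Quotient.mk (𝔓.arrowSetoid U V) ⟨n, hn⟩⟩ : 𝔓.Arr) = Arr.mk' 𝔓 U n := by
    rintro V rfl
    rfl
  exact (key _ rfl h1.symm).trans (key2 _ h1.symm)

theorem isOpen_basicArr (b : B) (m : M) : IsOpen (𝔓.basicArr b m) :=
  TopologicalSpace.isOpen_generateFrom_of_mem ⟨(b, m), rfl⟩

theorem continuous_src : Continuous (Arr.src : 𝔓.Arr → 𝔓.Cls) := by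
  refine continuous_induced_rng.2 (continuous_generateFrom_iff.2 ?_)
  rintro _ ⟨b, rfl⟩
  have : (Cls.point ∘ Arr.src) ⁻¹' {U : BoolUltrafilter B | b ∈ U.carrier} =
      ⋃ m, 𝔓.basicArr b m := by
    ext f
    obtain ⟨U, m, rfl⟩ := f.exists_rep
    constructor
    · intro h
      exact Set.mem_iUnion.2 ⟨m, U, h, rfl⟩
    · intro h
      obtain ⟨n, V, hV, h⟩ := Set.mem_iUnion.1 h
      rw [h]
      exact hV
  rw [this]
  exact isOpen_iUnion fun m => isOpen_basicArr b m

theorem continuous_tgt : Continuous (Arr.tgt : 𝔓.Arr → 𝔓.Cls) := by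
  refine continuous_induced_rng.2 (continuous_generateFrom_iff.2 ?_)
  rintro _ ⟨b, rfl⟩
  have : (Cls.point ∘ Arr.tgt) ⁻¹' {U : BoolUltrafilter B | b ∈ U.carrier} =
      ⋃ m, 𝔓.basicArr (𝔓.act m b) m := by
    ext f
    obtain ⟨U, m, rfl⟩ := f.exists_rep
    constructor
    · intro h
      exact Set.mem_iUnion.2 ⟨m, U, h, rfl⟩
    · intro h
      obtain ⟨n, V, hV, h⟩ := Set.mem_iUnion.1 h
      rw [h]
      exact hV
  rw [this]
  exact isOpen_iUnion fun m => isOpen_basicArr _ m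

/-- Composition, on the space of composable pairs. -/
def Arr.comp (p : {p : 𝔓.Arr × 𝔓.Arr // p.1.tgt = p.2.src}) : 𝔓.Arr :=
  ⟨p.1.1.src, p.1.2.tgt, p.1.1.hom ≫ eqToHom p.2 ≫ p.1.2.hom⟩

theorem Arr.comp_mk' (U V : BoolUltrafilter B) (m n : M)
    (h : (Arr.mk' 𝔓 U m).tgt = (Arr.mk' 𝔓 V n).src) :
    Arr.comp ⟨(Arr.mk' 𝔓 U m, Arr.mk' 𝔓 V n), h⟩ = Arr.mk' 𝔓 U (m * n) := by
  have hV : 𝔓.push m U = V := congrArg Cls.point h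
  subst hV
  have key : ∀ (V : BoolUltrafilter B) (hV : 𝔓.push (m * n) U = V),
      (⟨⟨U⟩, ⟨V⟩, Quotient.mk (𝔓.arrowSetoid U V) ⟨m * n, hV⟩⟩ : 𝔓.Arr) =
        Arr.mk' 𝔓 U (m * n) := by
    rintro V rfl
    rfl
  refine Eq.trans ?_ (key (𝔓.push n (𝔓.push m U)) (𝔓.push_mul m n U))
  have key2 : ∀ {X Y Z : 𝔓.Cls} (f : X ⟶ Y) (g : Y ⟶ Z),
      Arr.comp ⟨((⟨X, Y, f⟩ : 𝔓.Arr), (⟨Y, Z, g⟩ : 𝔓.Arr)), rfl⟩ = ⟨X, Z, f ≫ g⟩ := by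
    intro X Y Z f g
    simp [Arr.comp]
  exact key2 _ _

theorem Arr.mk'_inj {U V : BoolUltrafilter B} {m n : M} (h : Arr.mk' 𝔓 U m = Arr.mk' 𝔓 V n) :
    U = V ∧ ∃ b ∈ U.carrier, 𝔓.str.Eqv b m n := by
  have hU : U = V := congrArg (fun f => f.src.point) h
  refine ⟨hU, ?_⟩
  have h1 : ∃ k : 𝔓.push n (Arr.mk' 𝔓 V n).src.point = (Arr.mk' 𝔓 V n).tgt.point,
      (Arr.mk' 𝔓 V n).hom = Quotient.mk (𝔓.arrowSetoid _ _) ⟨n, k⟩ := ⟨rfl, rfl⟩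
  rw [← h] at h1
  obtain ⟨k, hk⟩ := h1
  exact Quotient.exact hk

theorem continuous_comp :
    Continuous (Arr.comp : {p : 𝔓.Arr × 𝔓.Arr // p.1.tgt = p.2.src} → 𝔓.Arr) := by
  refine continuous_generateFrom_iff.2 ?_
  rintro _ ⟨⟨b, k⟩, rfl⟩
  refine isOpen_iff_mem_nhds.2 ?_
  rintro ⟨⟨f, g⟩, hfg⟩ hp
  obtain ⟨U, m, rfl⟩ := f.exists_rep
  obtain ⟨V, n, rfl⟩ := g.exists_rep
  obtain ⟨W, hW, h⟩ := hp
  rw [Arr.comp_mk'] at h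
  obtain ⟨rfl, c, hc, hcn⟩ := Arr.mk'_inj h
  have hopen : IsOpen ((Subtype.val : {p : 𝔓.Arr × 𝔓.Arr // p.1.tgt = p.2.src} → _) ⁻¹'
      (𝔓.basicArr (b ⊓ c) m ×ˢ 𝔓.basicArr ⊤ n)) :=
    ((isOpen_basicArr _ _).prod (isOpen_basicArr _ _)).preimage continuous_subtype_val
  refine Filter.mem_of_superset (hopen.mem_nhds
    ⟨⟨U, U.inf_mem hW hc, rfl⟩, ⟨V, V.top_mem, rfl⟩⟩) ?_
  rintro ⟨⟨f, g⟩, hfg'⟩ ⟨⟨U', hU', hf⟩, ⟨V', -, hg⟩⟩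
  change f = _ at hf
  change g = _ at hg
  subst hf hg
  refine ⟨U', U'.mem_of_le hU' inf_le_left, ?_⟩
  rw [Arr.comp_mk']
  exact Arr.mk'_eq (U'.mem_of_le hU' inf_le_right) hcn

theorem Arr.id_eq (U : 𝔓.Cls) : (⟨U, U, 𝟙 U⟩ : 𝔓.Arr) = Arr.mk' 𝔓 U.point 1 := by
  have key : ∀ (V : BoolUltrafilter B) (hV : 𝔓.push 1 U.point = V),
      (⟨⟨U.point⟩, ⟨V⟩, Quotient.mk (𝔓.arrowSetoid U.point V) ⟨1, hV⟩⟩ : 𝔓.Arr) =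
        Arr.mk' 𝔓 U.point 1 := by
    rintro V rfl
    rfl
  exact key U.point (𝔓.push_one U.point)

theorem continuous_id : Continuous (fun U : 𝔓.Cls => (⟨U, U, 𝟙 U⟩ : 𝔓.Arr)) := by
  refine continuous_generateFrom_iff.2 ?_
  rintro _ ⟨⟨b, k⟩, rfl⟩
  refine isOpen_iff_mem_nhds.2 ?_
  rintro U ⟨V, hV, h⟩
  replace h := (Arr.id_eq U).symm.trans h
  obtain ⟨rfl, c, hc, hcn⟩ := Arr.mk'_inj h
  have hopen : IsOpen (Cls.point ⁻¹' {U : BoolUltrafilter B | b ⊓ c ∈ U.carrier} :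
      Set 𝔓.Cls) :=
    IsOpen.preimage continuous_induced_dom
      (TopologicalSpace.isOpen_generateFrom_of_mem (Set.mem_range_self (b ⊓ c)))
  refine Filter.mem_of_superset (hopen.mem_nhds (U.point.inf_mem hV hc)) ?_
  intro W hW
  refine ⟨W.point, W.point.mem_of_le hW inf_le_left, ?_⟩
  exact (Arr.id_eq W).trans <| Arr.mk'_eq (W.point.mem_of_le hW inf_le_right) hcn

variable (𝔓)

/-- The classifying topological category is a topological groupoid: every arrow is invertible, and
inversion is continuous on the space of arrows. -/
def IsTopologicalGroupoid : Prop :=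
  ∃ inv : ∀ {U V : 𝔓.Cls}, (U ⟶ V) → (V ⟶ U),
    (∀ {U V : 𝔓.Cls} (f : U ⟶ V), f ≫ inv f = 𝟙 U ∧ inv f ≫ f = 𝟙 V) ∧
    Continuous fun f : 𝔓.Arr => (⟨f.tgt, f.src, inv f.hom⟩ : 𝔓.Arr)

end MatchedPair

/-! ## Localic categories -/

/-- A category internal to locales, given by frames and frame homomorphisms in the opposite
direction: `Obj`, `Arr` and `Comp` are the frames of opens of the locales of objects, arrows and
composable pairs; `fst` and `snd` are the inverse image maps of the projections to the first and
second arrow of a composable pair, `mul` that of composition. -/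
structure LocalicCategory where
  Obj : Type u
  Arr : Type u
  Comp : Type u
  [frameObj : Order.Frame Obj]
  [frameArr : Order.Frame Arr]
  [frameComp : Order.Frame Comp]
  src : FrameHom Obj Arr
  tgt : FrameHom Obj Arr
  ident : FrameHom Arr Obj
  fst : FrameHom Arr Comp
  snd : FrameHom Arr Comp
  mul : FrameHom Arr Comp
  /-- composable pairs form the pullback of `tgt` and `src` -/
  fst_tgt : ∀ I, fst (tgt I) = snd (src I)
  exists_lift : ∀ (A : Type u) [Order.Frame A] (φ ψ : FrameHom Arr A),
    (∀ I, φ (tgt I) = ψ (src I)) →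
      ∃ h : FrameHom Comp A, (∀ f, h (fst f) = φ f) ∧ ∀ f, h (snd f) = ψ f
  lift_unique : ∀ (A : Type u) [Order.Frame A] (h k : FrameHom Comp A),
    (∀ f, h (fst f) = k (fst f)) → (∀ f, h (snd f) = k (snd f)) → h = k
  ident_src : ∀ I, ident (src I) = I
  ident_tgt : ∀ I, ident (tgt I) = I
  mul_src : ∀ I, mul (src I) = fst (src I)
  mul_tgt : ∀ I, mul (tgt I) = snd (tgt I)
  one_mul : ∀ h : FrameHom Comp Arr, (∀ f, h (fst f) = src (ident f)) → (∀ f, h (snd f) = f) →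
    ∀ f, h (mul f) = f
  mul_one : ∀ h : FrameHom Comp Arr, (∀ f, h (fst f) = f) → (∀ f, h (snd f) = tgt (ident f)) →
    ∀ f, h (mul f) = f
  /-- associativity, for generalised elements `φ, χ, ψ` of the locale of arrows -/
  assoc : ∀ (A : Type u) [Order.Frame A] (φ χ ψ : FrameHom Arr A) (p q r s : FrameHom Comp A),
    (∀ f, p (fst f) = φ f) → (∀ f, p (snd f) = χ f) →
    (∀ f, q (fst f) = χ f) → (∀ f, q (snd f) = ψ f) →
    (∀ f, r (fst f) = p (mul f)) → (∀ f, r (snd f) = ψ f) →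
    (∀ f, s (fst f) = φ f) → (∀ f, s (snd f) = q (mul f)) → ∀ f, r (mul f) = s (mul f)

/-- A localic category is a groupoid if there is an inversion map `inv` of locales on its locale of
arrows; here `l` and `r` are the inverse image maps of `(id, inv)` and `(inv, id)` into the
locale of composable pairs. -/
def LocalicCategory.IsGroupoid (C : LocalicCategory.{u}) : Prop :=
  letI := C.frameObj
  letI := C.frameArr
  letI := C.frameComp
  ∃ inv : FrameHom C.Arr C.Arr,
    (∀ I, inv (C.src I) = C.tgt I) ∧ (∀ I, inv (C.tgt I) = C.src I) ∧
    (∃ l : FrameHom C.Comp C.Arr, (∀ f, l (C.fst f) = f) ∧ (∀ f, l (C.snd f) = inv f) ∧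
      ∀ f, l (C.mul f) = C.src (C.ident f)) ∧
    ∃ r : FrameHom C.Comp C.Arr, (∀ f, r (C.fst f) = inv f) ∧ (∀ f, r (C.snd f) = f) ∧
      ∀ f, r (C.mul f) = C.tgt (C.ident f)

/-! ## The classifying localic category -/

/-- `J`-closed ideals of `B`. -/
@[ext]
structure ClosedIdeal {B : Type u} [BooleanAlgebra B] (J : ZeroDimTopology B) where
  carrier : Set B
  bot_mem : ⊥ ∈ carrier
  sup_mem : ∀ {b c}, b ∈ carrier → c ∈ carrier → b ⊔ c ∈ carrier
  mem_of_le : ∀ {b c}, b ∈ carrier → c ≤ b → c ∈ carrier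
  closed : ∀ {b} {P : Set B}, P ∈ J.partsOf b → P ⊆ carrier → b ∈ carrier

namespace ClosedIdeal

variable {B : Type u} [BooleanAlgebra B] {J : ZeroDimTopology B}

instance : SetLike (ClosedIdeal J) B where
  coe := carrier
  coe_injective _ _ h := ClosedIdeal.ext h

instance : PartialOrder (ClosedIdeal J) := PartialOrder.ofSetLike (ClosedIdeal J) B

theorem le_def {I K : ClosedIdeal J} : I ≤ K ↔ ∀ b ∈ I, b ∈ K := Iff.rfl

instance : InfSet (ClosedIdeal J) where
  sInf S :=
    { carrier := {b | ∀ I ∈ S, b ∈ I}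
      bot_mem := fun I _ => I.bot_mem
      sup_mem := fun hb hc I hI => I.sup_mem (hb I hI) (hc I hI)
      mem_of_le := fun hb hc I hI => I.mem_of_le (hb I hI) hc
      closed := fun hP h I hI => I.closed hP fun _ hp => h hp I hI }

theorem mem_sInf {S : Set (ClosedIdeal J)} {b : B} : b ∈ sInf S ↔ ∀ I ∈ S, b ∈ I := Iff.rfl

instance : CompleteLattice (ClosedIdeal J) :=
  completeLatticeOfInf _ fun _ =>
    ⟨fun _ hI _ hb => hb _ hI, fun _ hK _ hb _ hI => hK hI hb⟩

theorem mem_inf {I K : ClosedIdeal J} {b : B} : b ∈ I ⊓ K ↔ b ∈ I ∧ b ∈ K := by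
  constructor
  · intro h
    exact ⟨(inf_le_left : I ⊓ K ≤ I) h, (inf_le_right : I ⊓ K ≤ K) h⟩
  · rintro ⟨h, k⟩
    have : sInf {I, K} ≤ I ⊓ K := le_inf (sInf_le (by simp)) (sInf_le (by simp))
    refine this ?_
    rw [mem_sInf]
    simp [h, k]

/-- The closed ideal of all `b` with `b ∧ x ∈ K` for all `x ∈ I`. -/
def imp (I K : ClosedIdeal J) : ClosedIdeal J where
  carrier := {b | ∀ x ∈ I, b ⊓ x ∈ K}
  bot_mem x _ := by
    rw [bot_inf_eq]
    exact K.bot_mem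
  sup_mem {b c} hb hc x hx := by
    rw [inf_sup_right]
    exact K.sup_mem (hb x hx) (hc x hx)
  mem_of_le hb hc x hx := K.mem_of_le (hb x hx) (inf_le_inf_right x hc)
  closed {b P} hP h x hx := by
    refine K.closed (J.partsOf_inf hP x) ?_
    rintro _ ⟨⟨p, hp, rfl⟩, -⟩
    exact h hp x hx

theorem le_imp {I K L : ClosedIdeal J} : I ≤ imp K L ↔ I ⊓ K ≤ L := by
  constructor
  · intro h b hb
    have hb := mem_inf.1 hb
    have := h hb.1 b hb.2
    rwa [inf_idem] at this
  · intro h b hb x hx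
    exact h (mem_inf.2 ⟨I.mem_of_le hb inf_le_left, K.mem_of_le hx inf_le_right⟩)

instance : Order.Frame (ClosedIdeal J) :=
  Order.Frame.ofMinimalAxioms
    { inf_sSup_le_iSup_inf := fun I S => by
        rw [inf_comm, ← le_imp]
        refine sSup_le fun K hK => ?_
        rw [le_imp, inf_comm]
        exact le_iSup₂ (f := fun K (_ : K ∈ S) => I ⊓ K) K hK }

variable (J) in
/-- The principal ideal `↓ b`. -/
def principal (b : B) : ClosedIdeal J where
  carrier := {c | c ≤ b}
  bot_mem := bot_le
  sup_mem := sup_le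
  mem_of_le hb hc := hc.trans hb
  closed hP h := hP.2.2 h

theorem mem_principal {b c : B} : c ∈ principal J b ↔ c ≤ b := Iff.rfl

theorem principal_le {b : B} {I : ClosedIdeal J} : principal J b ≤ I ↔ b ∈ I :=
  ⟨fun h => h (le_refl b), fun h _ hc => I.mem_of_le h hc⟩

theorem principal_inf (b c : B) : principal J (b ⊓ c) = principal J b ⊓ principal J c := by
  apply SetLike.ext
  intro d
  rw [mem_inf, mem_principal, mem_principal, mem_principal, le_inf_iff]

/-- `I ≡_b K` iff `I ∩ ↓ b = K ∩ ↓ b`. -/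
def Eqv (b : B) (I K : ClosedIdeal J) : Prop := I ⊓ principal J b = K ⊓ principal J b

theorem eqv_iff {b : B} {I K : ClosedIdeal J} :
    Eqv b I K ↔ I ⊓ principal J b ≤ K ∧ K ⊓ principal J b ≤ I := by
  constructor
  · intro h
    exact ⟨h.le.trans inf_le_left, h.ge.trans inf_le_left⟩
  · rintro ⟨h, k⟩
    exact le_antisymm (le_inf h inf_le_right) (le_inf k inf_le_right)

theorem Eqv.sSup {ι : Type*} {b : B} {S : Set ι} {f g : ι → ClosedIdeal J}
    (h : ∀ i ∈ S, Eqv b (f i) (g i)) : Eqv b (⨆ i ∈ S, f i) (⨆ i ∈ S, g i) := by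
  unfold Eqv
  rw [iSup₂_inf_eq, iSup₂_inf_eq]
  exact iSup_congr fun i => iSup_congr (h i)

theorem Eqv.sInf {ι : Type*} {b : B} {S : Set ι} {f g : ι → ClosedIdeal J}
    (h : ∀ i ∈ S, Eqv b (f i) (g i)) : Eqv b (⨅ i ∈ S, f i) (⨅ i ∈ S, g i) := by
  rw [eqv_iff]
  constructor
  · exact le_iInf₂ fun i hi => (inf_le_inf_right _ (iInf₂_le i hi)).trans (eqv_iff.1 (h i hi)).1
  · exact le_iInf₂ fun i hi => (inf_le_inf_right _ (iInf₂_le i hi)).trans (eqv_iff.1 (h i hi)).2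

end ClosedIdeal

namespace MatchedPair

open ClosedIdeal

variable {B M : Type u} [BooleanAlgebra B] [Monoid M] (𝔓 : MatchedPair B M)

theorem act_partsOf (m : M) {b : B} {P : Set B} (hP : P ∈ 𝔓.J.partsOf b) :
    (𝔓.act m '' P) \ {⊥} ∈ 𝔓.J.partsOf (𝔓.act m b) := by
  obtain ⟨⟨Q, hQ, hPQ⟩, hb⟩ := hP
  have hQ' := 𝔓.act_parts m Q hQ
  refine ⟨⟨_, hQ', ?_⟩, ?_, ?_⟩
  · exact Set.sdiff_subset_sdiff_left (Set.image_mono hPQ)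
  · rintro _ ⟨⟨p, hp, rfl⟩, -⟩
    exact OrderHomClass.mono (𝔓.act m) (hb.1 hp)
  · intro e he
    have h1 : (⊤ : B) ≤ (𝔓.act m b ⊓ eᶜ)ᶜ := by
      apply (𝔓.J.isPartition _ hQ').2.1.2
      rintro _ ⟨⟨q, hq, rfl⟩, hne⟩
      rw [le_compl_iff_disjoint_right, disjoint_iff]
      by_cases hqP : q ∈ P
      · have h2 : 𝔓.act m q ≤ e := he ⟨⟨q, hqP, rfl⟩, hne⟩
        rw [← le_bot_iff]
        calc 𝔓.act m q ⊓ (𝔓.act m b ⊓ eᶜ) ≤ e ⊓ eᶜ := inf_le_inf h2 inf_le_right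
          _ = ⊥ := inf_compl_self e
          _ ≤ ⊥ := le_rfl
      · have h2 : b ≤ qᶜ := by
          apply hb.2
          intro p hp
          rw [le_compl_iff_disjoint_right, disjoint_iff]
          exact (𝔓.J.isPartition Q hQ).2.2 p (hPQ hp) q hq (by rintro rfl; exact hqP hp)
        have h3 : q ⊓ b = ⊥ := by
          rw [inf_comm]
          exact disjoint_iff.1 (le_compl_iff_disjoint_right.1 h2)
        rw [← inf_assoc, ← map_inf, h3, map_bot, bot_inf_eq]
    have h2 : 𝔓.act m b ⊓ eᶜ = ⊥ := by
      rw [← compl_top, ← top_le_iff.1 h1, compl_compl]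
    have h3 := disjoint_iff.2 h2
    exact (disjoint_compl_right_iff).1 h3

/-- The closed ideal `{b : m^* b ∈ K}`. -/
def coact (m : M) (K : ClosedIdeal 𝔓.J) : ClosedIdeal 𝔓.J where
  carrier := {b | 𝔓.act m b ∈ K}
  bot_mem := by
    change 𝔓.act m ⊥ ∈ K
    rw [map_bot]
    exact K.bot_mem
  sup_mem {b c} hb hc := by
    change 𝔓.act m (b ⊔ c) ∈ K
    rw [map_sup]
    exact K.sup_mem hb hc
  mem_of_le hb hc := K.mem_of_le hb (OrderHomClass.mono (𝔓.act m) hc)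
  closed {b P} hP h := by
    refine K.closed (𝔓.act_partsOf m hP) ?_
    rintro _ ⟨⟨p, hp, rfl⟩, -⟩
    exact h hp

/-- `m^* I`: the closed ideal generated by the elements `m^* b` for `b ∈ I`. -/
def actIdeal (m : M) (I : ClosedIdeal 𝔓.J) : ClosedIdeal 𝔓.J :=
  sInf {K | ∀ b ∈ I, 𝔓.act m b ∈ K}

theorem actIdeal_le {m : M} {I K : ClosedIdeal 𝔓.J} :
    𝔓.actIdeal m I ≤ K ↔ ∀ b ∈ I, 𝔓.act m b ∈ K :=
  ⟨fun h b hb => h (mem_sInf.2 fun _ hL => hL b hb), fun h => sInf_le h⟩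

theorem act_mem_actIdeal {m : M} {I : ClosedIdeal 𝔓.J} {b : B} (hb : b ∈ I) :
    𝔓.act m b ∈ 𝔓.actIdeal m I :=
  𝔓.actIdeal_le.1 le_rfl b hb

theorem gc_actIdeal (m : M) : GaloisConnection (𝔓.actIdeal m) (𝔓.coact m) :=
  fun _ _ => 𝔓.actIdeal_le

theorem actIdeal_principal (m : M) (b : B) :
    𝔓.actIdeal m (principal 𝔓.J b) = principal 𝔓.J (𝔓.act m b) := by
  apply le_antisymm
  · exact 𝔓.actIdeal_le.2 fun c hc => OrderHomClass.mono (𝔓.act m) (mem_principal.1 hc)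
  · exact principal_le.2 (𝔓.act_mem_actIdeal (mem_principal.2 le_rfl))

theorem actIdeal_top (m : M) : 𝔓.actIdeal m ⊤ = ⊤ := by
  have h : ∀ I : ClosedIdeal 𝔓.J, ⊤ ∈ I → I = ⊤ := fun I hI =>
    top_le_iff.1 fun b _ => I.mem_of_le hI le_top
  apply h
  rw [← map_top (𝔓.act m)]
  exact 𝔓.act_mem_actIdeal ((le_top : principal 𝔓.J ⊤ ≤ ⊤) (mem_principal.2 le_rfl))

theorem actIdeal_inf (m : M) (I K : ClosedIdeal 𝔓.J) :
    𝔓.actIdeal m (I ⊓ K) = 𝔓.actIdeal m I ⊓ 𝔓.actIdeal m K := by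
  apply le_antisymm
  · exact (𝔓.gc_actIdeal m).monotone_l.map_inf_le I K
  · rw [← le_imp, actIdeal_le]
    intro b hb
    rw [← principal_le, le_imp, inf_comm, ← le_imp, actIdeal_le]
    intro c hc
    rw [← principal_le, le_imp, ← principal_inf, principal_le, inf_comm, ← map_inf]
    exact 𝔓.act_mem_actIdeal (mem_inf.2 ⟨K.mem_of_le hc inf_le_left, I.mem_of_le hb inf_le_right⟩)

theorem actIdeal_one (I : ClosedIdeal 𝔓.J) : 𝔓.actIdeal 1 I = I := by
  apply le_antisymm
  · rw [actIdeal_le]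
    intro b hb
    rwa [𝔓.act_one]
  · intro b hb
    have := 𝔓.act_mem_actIdeal (m := 1) hb
    rwa [𝔓.act_one] at this

theorem actIdeal_mul (m n : M) (I : ClosedIdeal 𝔓.J) :
    𝔓.actIdeal (m * n) I = 𝔓.actIdeal m (𝔓.actIdeal n I) := by
  apply le_antisymm
  · rw [actIdeal_le]
    intro b hb
    rw [𝔓.act_mul]
    exact 𝔓.act_mem_actIdeal (𝔓.act_mem_actIdeal hb)
  · rw [𝔓.gc_actIdeal m _ _, actIdeal_le]
    intro b hb
    have := 𝔓.act_mem_actIdeal (m := m * n) hb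
    rwa [𝔓.act_mul] at this

theorem actIdeal_eqv {b : B} {m n : M} (h : 𝔓.str.Eqv b m n) (I : ClosedIdeal 𝔓.J) :
    Eqv b (𝔓.actIdeal m I) (𝔓.actIdeal n I) := by
  have key : ∀ {m n : M}, 𝔓.str.Eqv b m n →
      𝔓.actIdeal m I ⊓ principal 𝔓.J b ≤ 𝔓.actIdeal n I := by
    intro m n h
    rw [← le_imp, actIdeal_le]
    intro c hc
    rw [← principal_le, le_imp, ← principal_inf, principal_le, inf_comm, 𝔓.inf_act_eq h c]
    exact (𝔓.actIdeal n I).mem_of_le (𝔓.act_mem_actIdeal hc) inf_le_right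
  exact eqv_iff.2 ⟨key h, key h.symm⟩

theorem eqv_actIdeal (m : M) {b : B} {I K : ClosedIdeal 𝔓.J} (h : Eqv b I K) :
    Eqv (𝔓.act m b) (𝔓.actIdeal m I) (𝔓.actIdeal m K) := by
  unfold Eqv at *
  rw [← actIdeal_principal, ← actIdeal_inf, ← actIdeal_inf, h]

/-- The frame of opens of the locale of arrows: `B_J`-set homomorphisms from `M` to the
`B_J`-set of closed ideals, ordered pointwise. -/
def arrFrame : CompleteSublattice (M → ClosedIdeal 𝔓.J) :=
  CompleteSublattice.mk' {f | ∀ b m n, 𝔓.str.Eqv b m n → Eqv b (f m) (f n)}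
    (fun S hS b m n h => by
      simp only [sSup_eq_iSup, iSup_apply]
      exact Eqv.sSup fun f hf => hS hf b m n h)
    (fun S hS b m n h => by
      simp only [sInf_eq_iInf, iInf_apply]
      exact Eqv.sInf fun f hf => hS hf b m n h)

/-- The frame of opens of the locale of composable pairs: functions `F` on `M × M` such that each
`F (-, n)` is a homomorphism from `M` to the closed ideals, and each `F (m, -)` is a homomorphism
from `M` to the closed ideals re-indexed along `m^*`. -/
def compFrame : CompleteSublattice (M → M → ClosedIdeal 𝔓.J) :=
  CompleteSublattice.mk'
    {F | (∀ n b m m', 𝔓.str.Eqv b m m' → Eqv b (F m n) (F m' n)) ∧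
      ∀ m b n n', 𝔓.str.Eqv b n n' → Eqv (𝔓.act m b) (F m n) (F m n')}
    (fun S hS => by
      constructor
      · intro n b m m' h
        simp only [sSup_eq_iSup, iSup_apply]
        exact Eqv.sSup fun f hf => (hS hf).1 n b m m' h
      · intro m b n n' h
        simp only [sSup_eq_iSup, iSup_apply]
        exact Eqv.sSup fun f hf => (hS hf).2 m b n n' h)
    (fun S hS => by
      constructor
      · intro n b m m' h
        simp only [sInf_eq_iInf, iInf_apply]
        exact Eqv.sInf fun f hf => (hS hf).1 n b m m' h
      · intro m b n n' h
        simp only [sInf_eq_iInf, iInf_apply]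
        exact Eqv.sInf fun f hf => (hS hf).2 m b n n' h)

variable {𝔓}

theorem arr_ext {f g : 𝔓.arrFrame} (h : ∀ m, f.1 m = g.1 m) : f = g := Subtype.ext (funext h)

theorem comp_ext {f g : 𝔓.compFrame} (h : ∀ m n, f.1 m n = g.1 m n) : f = g :=
  Subtype.ext (funext fun m => funext (h m))

theorem arr_sSup (S : Set 𝔓.arrFrame) (m : M) : (sSup S).1 m = ⨆ f ∈ S, f.1 m := by
  rw [CompleteSublattice.coe_sSup']
  simp only [iSup_apply]

theorem comp_sSup (S : Set 𝔓.compFrame) (m n : M) : (sSup S).1 m n = ⨆ f ∈ S, f.1 m n := by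
  rw [CompleteSublattice.coe_sSup']
  simp only [iSup_apply]

instance : Order.Frame 𝔓.arrFrame :=
  Order.Frame.ofMinimalAxioms
    { inf_sSup_le_iSup_inf := fun f S => by
        intro m
        rw [CompleteSublattice.coe_iSup]
        simp only [CompleteSublattice.coe_iSup, iSup_apply]
        change f.1 m ⊓ (sSup S).1 m ≤ ⨆ g, ⨆ (_ : g ∈ S), f.1 m ⊓ g.1 m
        rw [arr_sSup, inf_iSup₂_eq] }

instance : Order.Frame 𝔓.compFrame :=
  Order.Frame.ofMinimalAxioms
    { inf_sSup_le_iSup_inf := fun f S => by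
        intro m n
        rw [CompleteSublattice.coe_iSup]
        simp only [CompleteSublattice.coe_iSup, iSup_apply]
        change f.1 m n ⊓ (sSup S).1 m n ≤ ⨆ g, ⨆ (_ : g ∈ S), f.1 m n ⊓ g.1 m n
        rw [comp_sSup, inf_iSup₂_eq] }

variable (𝔓)

/-- `s^* I = λ m. I`. -/
def srcHom : FrameHom (ClosedIdeal 𝔓.J) 𝔓.arrFrame where
  toFun I := ⟨fun _ => I, fun _ _ _ _ => rfl⟩
  map_inf' _ _ := rfl
  map_top' := rfl
  map_sSup' S := arr_ext fun m => by rw [arr_sSup, iSup_image, ← sSup_eq_iSup]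

/-- `t^* I = λ m. m^* I`. -/
def tgtHom : FrameHom (ClosedIdeal 𝔓.J) 𝔓.arrFrame where
  toFun I := ⟨fun m => 𝔓.actIdeal m I, fun _ _ _ h => 𝔓.actIdeal_eqv h I⟩
  map_inf' I K := arr_ext fun m => 𝔓.actIdeal_inf m I K
  map_top' := arr_ext fun m => 𝔓.actIdeal_top m
  map_sSup' S := arr_ext fun m => by
    rw [arr_sSup, iSup_image]
    exact (𝔓.gc_actIdeal m).l_sSup

/-- `i^* f = f(1)`. -/
def identHom : FrameHom 𝔓.arrFrame (ClosedIdeal 𝔓.J) where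
  toFun f := f.1 1
  map_inf' _ _ := rfl
  map_top' := rfl
  map_sSup' S := by rw [arr_sSup, sSup_image]

/-- The first projection. -/
def fstHom : FrameHom 𝔓.arrFrame 𝔓.compFrame where
  toFun f := ⟨fun m _ => f.1 m, fun _ b m m' h => f.2 b m m' h, fun _ _ _ _ _ => rfl⟩
  map_inf' _ _ := rfl
  map_top' := rfl
  map_sSup' S := comp_ext fun m n => by
    rw [comp_sSup, iSup_image]
    exact arr_sSup S m

/-- The second projection. -/
def sndHom : FrameHom 𝔓.arrFrame 𝔓.compFrame where
  toFun f := ⟨fun m n => 𝔓.actIdeal m (f.1 n), fun n _ _ _ h => 𝔓.actIdeal_eqv h (f.1 n),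
    fun m b n n' h => 𝔓.eqv_actIdeal m (f.2 b n n' h)⟩
  map_inf' f g := comp_ext fun m n => 𝔓.actIdeal_inf m (f.1 n) (g.1 n)
  map_top' := comp_ext fun m _ => 𝔓.actIdeal_top m
  map_sSup' S := comp_ext fun m n => by
    rw [comp_sSup, iSup_image]
    change 𝔓.actIdeal m ((sSup S).1 n) = _
    rw [arr_sSup]
    exact (𝔓.gc_actIdeal m).l_iSup₂

/-- `m^* f = λ m n. f(mn)`. -/
def mulHom : FrameHom 𝔓.arrFrame 𝔓.compFrame where
  toFun f := ⟨fun m n => f.1 (m * n), fun n b m m' h => f.2 b _ _ (𝔓.mul_right_eqv h n),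
    fun m _ _ _ h => f.2 _ _ _ (𝔓.mul_left_eqv m h)⟩
  map_inf' _ _ := rfl
  map_top' := rfl
  map_sSup' S := comp_ext fun m n => by
    rw [comp_sSup, iSup_image]
    exact arr_sSup S (m * n)

/-- The open set of all `(U, n)` with `m ≡_U n`: the image of the section `m` of the source map. -/
def sec (m : M) : 𝔓.arrFrame where
  val n :=
    { carrier := {b | 𝔓.str.Eqv b m n}
      bot_mem := BStr.eqv_bot _ _
      sup_mem := BStr.eqv_sup
      mem_of_le := BStr.Eqv.mono
      closed := by
        rintro b P ⟨⟨Q, hQ, hPQ⟩, hb⟩ h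
        apply 𝔓.str.eqv_of_parts hQ
        intro q hq
        by_cases hqP : q ∈ P
        · exact (h hqP).mono inf_le_right
        · have h2 : b ≤ qᶜ := by
            apply hb.2
            intro p hp
            rw [le_compl_iff_disjoint_right, disjoint_iff]
            exact (𝔓.J.isPartition Q hQ).2.2 p (hPQ hp) q hq (by rintro rfl; exact hqP hp)
          rw [disjoint_iff.1 (le_compl_iff_disjoint_right.1 h2)]
          exact BStr.eqv_bot _ _ }
  property := by
    intro b n n' h
    rw [eqv_iff]
    constructor
    · intro c hc
      obtain ⟨h1, h2⟩ := mem_inf.1 hc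
      exact BStr.Eqv.trans h1 (h.mono h2)
    · intro c hc
      obtain ⟨h1, h2⟩ := mem_inf.1 hc
      exact BStr.Eqv.trans h1 (h.symm.mono h2)

variable {𝔓}

theorem mem_sec {m n : M} {b : B} : b ∈ (𝔓.sec m).1 n ↔ 𝔓.str.Eqv b m n := Iff.rfl

theorem top_le_sec_self (m : M) : (⊤ : ClosedIdeal 𝔓.J) ≤ (𝔓.sec m).1 m :=
  fun _ _ => BStr.Eqv.refl _ _

theorem iSup_sec : (⨆ m, 𝔓.sec m) = ⊤ := by
  apply top_le_iff.1
  intro m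
  rw [CompleteSublattice.coe_iSup, iSup_apply]
  exact (top_le_sec_self m).trans (le_iSup (fun n => (𝔓.sec n).1 m) m)

theorem sec_inf_le {f : 𝔓.arrFrame} (m n : M) : (𝔓.sec m).1 n ⊓ f.1 m ≤ f.1 n := by
  intro b hb
  obtain ⟨h1, h2⟩ := mem_inf.1 hb
  exact (eqv_iff.1 (f.2 b m n h1)).1 (mem_inf.2 ⟨h2, mem_principal.2 le_rfl⟩)

theorem eq_iSup_sec (f : 𝔓.arrFrame) : f = ⨆ m, 𝔓.sec m ⊓ 𝔓.srcHom (f.1 m) := by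
  apply le_antisymm
  · intro n
    rw [CompleteSublattice.coe_iSup, iSup_apply]
    refine le_trans ?_ (le_iSup (fun m => (𝔓.sec m ⊓ 𝔓.srcHom (f.1 m)).1 n) n)
    exact le_inf (le_top.trans (top_le_sec_self n)) le_rfl
  · refine iSup_le fun m n => ?_
    exact sec_inf_le m n

theorem sec_inf_src_le_tgt (m : M) (I : ClosedIdeal 𝔓.J) :
    𝔓.sec m ⊓ 𝔓.srcHom (𝔓.actIdeal m I) = 𝔓.sec m ⊓ 𝔓.tgtHom I := by
  apply arr_ext
  intro n
  apply le_antisymm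
  · exact le_inf inf_le_left (sec_inf_le (f := 𝔓.tgtHom I) m n)
  · refine le_inf inf_le_left ?_
    intro b hb
    obtain ⟨h1, h2⟩ := mem_inf.1 hb
    exact (eqv_iff.1 (𝔓.actIdeal_eqv h1 I)).2 (mem_inf.2 ⟨h2, mem_principal.2 le_rfl⟩)

theorem eq_iSup_comp (F : 𝔓.compFrame) :
    F = ⨆ m, ⨆ n, 𝔓.fstHom (𝔓.sec m) ⊓ 𝔓.sndHom (𝔓.sec n) ⊓
      𝔓.fstHom (𝔓.srcHom (F.1 m n)) := by
  apply le_antisymm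
  · intro m n
    simp only [CompleteSublattice.coe_iSup, iSup_apply]
    refine le_trans ?_ (le_iSup₂ (f := fun m' n' => (𝔓.fstHom (𝔓.sec m') ⊓
      𝔓.sndHom (𝔓.sec n') ⊓ 𝔓.fstHom (𝔓.srcHom (F.1 m' n'))).1 m n) m n)
    refine le_inf (le_inf (le_top.trans (top_le_sec_self m)) ?_) le_rfl
    refine le_top.trans ?_
    rw [← 𝔓.actIdeal_top m]
    exact (𝔓.gc_actIdeal m).monotone_l (top_le_sec_self n)
  · refine iSup₂_le fun m n m' n' => ?_
    change (𝔓.sec m).1 m' ⊓ 𝔓.actIdeal m' ((𝔓.sec n).1 n') ⊓ F.1 m n ≤ F.1 m' n'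
    have h1 : (𝔓.sec m).1 m' ⊓ F.1 m n ≤ F.1 m' n := by
      intro b hb
      obtain ⟨h1, h2⟩ := mem_inf.1 hb
      exact (eqv_iff.1 (F.2.1 n b m m' h1)).1 (mem_inf.2 ⟨h2, mem_principal.2 le_rfl⟩)
    have h2 : 𝔓.actIdeal m' ((𝔓.sec n).1 n') ⊓ F.1 m' n ≤ F.1 m' n' := by
      rw [← le_imp, actIdeal_le]
      intro b hb
      rw [← principal_le, le_imp, inf_comm]
      exact (eqv_iff.1 (F.2.2 m' b n n' hb)).1
    refine le_trans ?_ h2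
    exact le_inf (inf_le_left.trans inf_le_right)
      (le_trans (inf_le_inf_right _ inf_le_left) h1)

end MatchedPair

namespace MatchedPair

open ClosedIdeal

variable {B M : Type u} [BooleanAlgebra B] [Monoid M] {𝔓 : MatchedPair B M}

theorem comp_local_le (F : 𝔓.compFrame) (m n m' n' : M) :
    (𝔓.sec m).1 m' ⊓ 𝔓.actIdeal m' ((𝔓.sec n).1 n') ⊓ F.1 m n ≤ F.1 m' n' := by
  have h1 : (𝔓.sec m).1 m' ⊓ F.1 m n ≤ F.1 m' n := by
    intro b hb
    obtain ⟨h1, h2⟩ := mem_inf.1 hb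
    exact (eqv_iff.1 (F.2.1 n b m m' h1)).1 (mem_inf.2 ⟨h2, mem_principal.2 le_rfl⟩)
  have h2 : 𝔓.actIdeal m' ((𝔓.sec n).1 n') ⊓ F.1 m' n ≤ F.1 m' n' := by
    rw [← le_imp, actIdeal_le]
    intro b hb
    rw [← principal_le, le_imp, inf_comm]
    exact (eqv_iff.1 (F.2.2 m' b n n' hb)).1
  refine le_trans ?_ h2
  exact le_inf (inf_le_left.trans inf_le_right) (le_trans (inf_le_inf_right _ inf_le_left) h1)

theorem comp_local_ge (F : 𝔓.compFrame) (m n m' n' : M) :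
    (𝔓.sec m).1 m' ⊓ 𝔓.actIdeal m' ((𝔓.sec n).1 n') ⊓ F.1 m' n' ≤ F.1 m n := by
  have h1 : (𝔓.sec m).1 m' ⊓ F.1 m' n ≤ F.1 m n := by
    intro b hb
    obtain ⟨h1, h2⟩ := mem_inf.1 hb
    exact (eqv_iff.1 (F.2.1 n b m m' h1)).2 (mem_inf.2 ⟨h2, mem_principal.2 le_rfl⟩)
  have h2 : 𝔓.actIdeal m' ((𝔓.sec n).1 n') ⊓ F.1 m' n' ≤ F.1 m' n := by
    rw [← le_imp, actIdeal_le]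
    intro b hb
    rw [← principal_le, le_imp, inf_comm]
    exact (eqv_iff.1 (F.2.2 m' b n n' hb)).2
  refine le_trans ?_ h1
  exact le_inf (inf_le_left.trans inf_le_left) (le_trans (inf_le_inf_right _ inf_le_right) h2)

theorem comp_local (F : 𝔓.compFrame) (m n : M) :
    𝔓.fstHom (𝔓.sec m) ⊓ 𝔓.sndHom (𝔓.sec n) ⊓ F =
      𝔓.fstHom (𝔓.sec m) ⊓ 𝔓.sndHom (𝔓.sec n) ⊓ 𝔓.fstHom (𝔓.srcHom (F.1 m n)) := by
  apply le_antisymm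
  · refine le_inf inf_le_left fun m' n' => ?_
    exact comp_local_ge F m n m' n'
  · refine le_inf inf_le_left fun m' n' => ?_
    exact comp_local_le F m n m' n'

theorem hom_local {A : Type u} [Order.Frame A] (h : FrameHom 𝔓.compFrame A) (F : 𝔓.compFrame)
    {e : A} {m n : M} (h1 : e ≤ h (𝔓.fstHom (𝔓.sec m))) (h2 : e ≤ h (𝔓.sndHom (𝔓.sec n))) :
    e ⊓ h F = e ⊓ h (𝔓.fstHom (𝔓.srcHom (F.1 m n))) := by
  have h3 := congrArg h (comp_local F m n)
  simp only [map_inf] at h3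
  have h4 : e ⊓ (h (𝔓.fstHom (𝔓.sec m)) ⊓ h (𝔓.sndHom (𝔓.sec n))) = e :=
    inf_eq_left.2 (le_inf h1 h2)
  rw [← h4, inf_assoc, h3, inf_assoc e, ← inf_assoc]

theorem le_mul_sec (m n : M) :
    𝔓.fstHom (𝔓.sec m) ⊓ 𝔓.sndHom (𝔓.sec n) ≤ 𝔓.mulHom (𝔓.sec (m * n)) := by
  intro m' n'
  have h := comp_local_le (𝔓.mulHom (𝔓.sec (m * n))) m n m' n'
  refine le_trans ?_ h
  exact le_inf le_rfl (le_top.trans (top_le_sec_self _))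

variable {A : Type u} [Order.Frame A]

theorem iSup_hom_sec (φ : FrameHom 𝔓.arrFrame A) : (⨆ m, φ (𝔓.sec m)) = ⊤ := by
  rw [← map_iSup, iSup_sec, map_top]

theorem lift_aux (φ ψ : FrameHom 𝔓.arrFrame A) (hφψ : ∀ I, φ (𝔓.tgtHom I) = ψ (𝔓.srcHom I))
    (F : 𝔓.compFrame) (m n m' n' : M) :
    φ (𝔓.sec m) ⊓ ψ (𝔓.sec n) ⊓ (φ (𝔓.sec m') ⊓ ψ (𝔓.sec n') ⊓ φ (𝔓.srcHom (F.1 m' n'))) ≤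
      φ (𝔓.srcHom (F.1 m n)) := by
  have hsec : ∀ m m' : M, 𝔓.sec m ⊓ 𝔓.sec m' ≤ 𝔓.srcHom ((𝔓.sec m').1 m) := by
    intro m m' k b hb
    obtain ⟨h1, h2⟩ := mem_inf.1 hb
    exact BStr.Eqv.trans h2 (BStr.Eqv.symm h1)
  have h1 : φ (𝔓.sec m) ⊓ φ (𝔓.sec m') ≤ φ (𝔓.srcHom ((𝔓.sec m').1 m)) := by
    rw [← map_inf]
    exact OrderHomClass.mono φ (hsec m m')
  have h2 : φ (𝔓.sec m) ⊓ (ψ (𝔓.sec n) ⊓ ψ (𝔓.sec n')) ≤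
      φ (𝔓.srcHom (𝔓.actIdeal m ((𝔓.sec n').1 n))) := by
    have h3 : ψ (𝔓.sec n) ⊓ ψ (𝔓.sec n') ≤ φ (𝔓.tgtHom ((𝔓.sec n').1 n)) := by
      rw [← map_inf, hφψ]
      exact OrderHomClass.mono ψ (hsec n n')
    refine (inf_le_inf_left _ h3).trans ?_
    rw [← map_inf, ← sec_inf_src_le_tgt, map_inf]
    exact inf_le_right
  have h4 := OrderHomClass.mono φ (OrderHomClass.mono 𝔓.srcHom (comp_local_le F m' n' m n))
  refine le_trans ?_ h4
  simp only [map_inf]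
  refine le_inf (le_inf ?_ ?_) (inf_le_right.trans inf_le_right)
  · refine le_trans ?_ h1
    exact le_inf (inf_le_left.trans inf_le_left)
      (inf_le_right.trans (inf_le_left.trans inf_le_left))
  · refine le_trans ?_ h2
    exact le_inf (inf_le_left.trans inf_le_left) (le_inf (inf_le_left.trans inf_le_right)
      (inf_le_right.trans (inf_le_left.trans inf_le_right)))

/-- The map into the pullback induced by a compatible pair of maps. -/
def liftHom (φ ψ : FrameHom 𝔓.arrFrame A) (hφψ : ∀ I, φ (𝔓.tgtHom I) = ψ (𝔓.srcHom I)) :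
    FrameHom 𝔓.compFrame A where
  toFun F := ⨆ m, ⨆ n, φ (𝔓.sec m) ⊓ ψ (𝔓.sec n) ⊓ φ (𝔓.srcHom (F.1 m n))
  map_inf' F G := by
    apply le_antisymm
    · refine iSup₂_le fun m n => le_inf ?_ ?_
      · refine le_trans (inf_le_inf_left _ ?_) (le_iSup₂ (f := fun m n => φ (𝔓.sec m) ⊓ ψ (𝔓.sec n) ⊓
          φ (𝔓.srcHom (F.1 m n))) m n)
        exact OrderHomClass.mono φ (OrderHomClass.mono 𝔓.srcHom inf_le_left)
      · refine le_trans (inf_le_inf_left _ ?_) (le_iSup₂ (f := fun m n => φ (𝔓.sec m) ⊓ ψ (𝔓.sec n) ⊓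
          φ (𝔓.srcHom (G.1 m n))) m n)
        exact OrderHomClass.mono φ (OrderHomClass.mono 𝔓.srcHom inf_le_right)
    · simp only [iSup_inf_eq, inf_iSup_eq]
      refine iSup₂_le fun m' n' => iSup₂_le fun m n => ?_
      refine le_trans ?_ (le_iSup₂ (f := fun m n => φ (𝔓.sec m) ⊓ ψ (𝔓.sec n) ⊓
        φ (𝔓.srcHom ((F ⊓ G).1 m n))) m n)
      change _ ≤ _ ⊓ φ (𝔓.srcHom (F.1 m n ⊓ G.1 m n))
      simp only [map_inf]
      refine le_inf (inf_le_left.trans inf_le_left) (le_inf (inf_le_left.trans inf_le_right) ?_)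
      exact (inf_le_inf_right _ inf_le_left).trans (lift_aux φ ψ hφψ G m n m' n')
  map_top' := by
    have h : ∀ m n : M, φ (𝔓.srcHom ((⊤ : 𝔓.compFrame).1 m n)) = ⊤ := fun m n =>
      (congrArg φ (map_top 𝔓.srcHom)).trans (map_top φ)
    simp only [h, inf_top_eq, ← inf_iSup_eq, iSup_hom_sec]
  map_sSup' S := by
    rw [sSup_image]
    simp only [comp_sSup, map_iSup, inf_iSup_eq]
    apply le_antisymm
    · refine iSup₂_le fun m n => iSup₂_le fun F hF => ?_
      exact (le_iSup₂ (f := fun m n => φ (𝔓.sec m) ⊓ ψ (𝔓.sec n) ⊓ φ (𝔓.srcHom (F.1 m n)))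
        m n).trans (le_iSup₂ (f := fun (F : 𝔓.compFrame) (_ : F ∈ S) => ⨆ m, ⨆ n,
          φ (𝔓.sec m) ⊓ ψ (𝔓.sec n) ⊓ φ (𝔓.srcHom (F.1 m n))) F hF)
    · refine iSup₂_le fun F hF => iSup₂_le fun m n => ?_
      refine le_trans ?_ (le_iSup₂ m n)
      exact le_iSup₂ (f := fun (F : 𝔓.compFrame) (_ : F ∈ S) =>
        φ (𝔓.sec m) ⊓ ψ (𝔓.sec n) ⊓ φ (𝔓.srcHom (F.1 m n))) F hF

theorem liftHom_apply (φ ψ : FrameHom 𝔓.arrFrame A)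
    (hφψ : ∀ I, φ (𝔓.tgtHom I) = ψ (𝔓.srcHom I)) (F : 𝔓.compFrame) :
    liftHom φ ψ hφψ F = ⨆ m, ⨆ n, φ (𝔓.sec m) ⊓ ψ (𝔓.sec n) ⊓ φ (𝔓.srcHom (F.1 m n)) := rfl

theorem liftHom_fst (φ ψ : FrameHom 𝔓.arrFrame A)
    (hφψ : ∀ I, φ (𝔓.tgtHom I) = ψ (𝔓.srcHom I)) (f : 𝔓.arrFrame) :
    liftHom φ ψ hφψ (𝔓.fstHom f) = φ f := by
  rw [liftHom_apply]
  change (⨆ m, ⨆ n, φ (𝔓.sec m) ⊓ ψ (𝔓.sec n) ⊓ φ (𝔓.srcHom (f.1 m))) = _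
  simp only [← iSup_inf_eq, ← inf_iSup_eq, iSup_hom_sec, inf_top_eq]
  conv_rhs => rw [eq_iSup_sec f]
  simp only [map_iSup, map_inf]

theorem liftHom_snd (φ ψ : FrameHom 𝔓.arrFrame A)
    (hφψ : ∀ I, φ (𝔓.tgtHom I) = ψ (𝔓.srcHom I)) (f : 𝔓.arrFrame) :
    liftHom φ ψ hφψ (𝔓.sndHom f) = ψ f := by
  rw [liftHom_apply]
  have h : ∀ m n, φ (𝔓.sec m) ⊓ ψ (𝔓.sec n) ⊓ φ (𝔓.srcHom ((𝔓.sndHom f).1 m n)) =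
      φ (𝔓.sec m) ⊓ ψ (𝔓.sec n ⊓ 𝔓.srcHom (f.1 n)) := by
    intro m n
    change _ ⊓ φ (𝔓.srcHom (𝔓.actIdeal m (f.1 n))) = _
    rw [inf_right_comm, ← map_inf, sec_inf_src_le_tgt, map_inf, hφψ, map_inf, inf_assoc,
      inf_comm (ψ (𝔓.srcHom _))]
  simp only [h, ← inf_iSup_eq, ← iSup_inf_eq, iSup_hom_sec, top_inf_eq]
  conv_rhs => rw [eq_iSup_sec f]
  rw [map_iSup]

theorem hom_comp_ext {h k : FrameHom 𝔓.compFrame A} (h1 : ∀ f, h (𝔓.fstHom f) = k (𝔓.fstHom f))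
    (h2 : ∀ f, h (𝔓.sndHom f) = k (𝔓.sndHom f)) : h = k := by
  ext F
  rw [eq_iSup_comp F]
  simp only [map_iSup, map_inf, h1, h2]

variable (𝔓)

/-- Restriction along `(i s, id)`. -/
def leftUnit : FrameHom 𝔓.compFrame 𝔓.arrFrame where
  toFun F := ⟨fun n => F.1 1 n, fun b n n' h => by
    have := F.2.2 1 b n n' h
    rwa [𝔓.act_one] at this⟩
  map_inf' _ _ := rfl
  map_top' := rfl
  map_sSup' S := arr_ext fun n => by
    rw [arr_sSup, iSup_image]
    exact comp_sSup S 1 n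

/-- Restriction along `(id, i t)`. -/
def rightUnit : FrameHom 𝔓.compFrame 𝔓.arrFrame where
  toFun F := ⟨fun m => F.1 m 1, fun b m m' h => F.2.1 1 b m m' h⟩
  map_inf' _ _ := rfl
  map_top' := rfl
  map_sSup' S := arr_ext fun m => by
    rw [arr_sSup, iSup_image]
    exact comp_sSup S m 1

/-- The classifying localic category. -/
def classifyingLocalicCategory : LocalicCategory.{u} where
  Obj := ClosedIdeal 𝔓.J
  Arr := 𝔓.arrFrame
  Comp := 𝔓.compFrame
  src := 𝔓.srcHom
  tgt := 𝔓.tgtHom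
  ident := 𝔓.identHom
  fst := 𝔓.fstHom
  snd := 𝔓.sndHom
  mul := 𝔓.mulHom
  fst_tgt _ := rfl
  exists_lift A _ φ ψ h := ⟨liftHom φ ψ h, liftHom_fst φ ψ h, liftHom_snd φ ψ h⟩
  lift_unique A _ h k h1 h2 := hom_comp_ext h1 h2
  ident_src _ := rfl
  ident_tgt I := 𝔓.actIdeal_one I
  mul_src _ := rfl
  mul_tgt I := comp_ext fun m n => 𝔓.actIdeal_mul m n I
  one_mul h h1 h2 f := by
    have : h = 𝔓.leftUnit := hom_comp_ext (fun f => h1 f)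
      (fun f => (h2 f).trans (arr_ext fun n => (𝔓.actIdeal_one (f.1 n)).symm))
    rw [this]
    exact arr_ext fun n => congrArg f.1 (_root_.one_mul n)
  mul_one h h1 h2 f := by
    have : h = 𝔓.rightUnit := hom_comp_ext (fun f => h1 f) (fun f => h2 f)
    rw [this]
    exact arr_ext fun n => congrArg f.1 (_root_.mul_one n)
  assoc A _ φ χ ψ p q r s p1 p2 q1 q2 r1 r2 s1 s2 f := by
    have hr : ∀ m n k : M, φ (𝔓.sec m) ⊓ χ (𝔓.sec n) ⊓ ψ (𝔓.sec k) ⊓ r (𝔓.mulHom f) =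
        φ (𝔓.sec m) ⊓ χ (𝔓.sec n) ⊓ ψ (𝔓.sec k) ⊓ φ (𝔓.srcHom (f.1 (m * n * k))) := by
      intro m n k
      rw [hom_local r (m := m * n) (n := k), r1]
      · change _ ⊓ p (𝔓.fstHom (𝔓.srcHom (f.1 (m * n * k)))) = _
        rw [p1]
      · rw [r1]
        refine le_trans ?_ (OrderHomClass.mono p (le_mul_sec m n))
        rw [map_inf, p1, p2]
        exact inf_le_left
      · rw [r2]
        exact inf_le_right
    have hs : ∀ m n k : M, φ (𝔓.sec m) ⊓ χ (𝔓.sec n) ⊓ ψ (𝔓.sec k) ⊓ s (𝔓.mulHom f) =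
        φ (𝔓.sec m) ⊓ χ (𝔓.sec n) ⊓ ψ (𝔓.sec k) ⊓ φ (𝔓.srcHom (f.1 (m * n * k))) := by
      intro m n k
      rw [hom_local s (m := m) (n := n * k), s1]
      · change _ ⊓ φ (𝔓.srcHom (f.1 (m * (n * k)))) = _
        rw [mul_assoc]
      · rw [s1]
        exact inf_le_left.trans inf_le_left
      · rw [s2]
        refine le_trans ?_ (OrderHomClass.mono q (le_mul_sec n k))
        rw [map_inf, q1, q2]
        exact inf_le_inf_right _ inf_le_right
    have hcov : (⨆ m, ⨆ n, ⨆ k, φ (𝔓.sec m) ⊓ χ (𝔓.sec n) ⊓ ψ (𝔓.sec k)) = ⊤ := by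
      simp only [← inf_iSup_eq, iSup_hom_sec, inf_top_eq]
    rw [← top_inf_eq (r (𝔓.mulHom f)), ← top_inf_eq (s (𝔓.mulHom f)), ← hcov]
    simp only [iSup_inf_eq, hr, hs]

end MatchedPair

end MatchedPairs

/-!
All conditions are compared with the existence of partial inverses, in the following form: for every
`m` there is a partition in `J` over each piece `b` of which `m` has a *local inverse* `n`
(`IsLocalInverse m n b c`, see `hasPartialInverses_iff`). Local inverses restrict, compose, and are
unique where they are defined (`IsLocalInverse.unique`), so constructions made from them glue along partitions.

* Exponential comparison. The comparison map sends `h : M × Y → Z` to `h (1, -)`, so it is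
  invertible iff every homomorphism `g : Y → Z` of `B_J`-sets extends uniquely from `{1} × Y` to
  `M × Y` (`monoidalClosedFunctor_forget_iff`). Given local inverses the extension must be
  `(m, y) ↦ m · g (m⁻¹ · y)`, and this works (`extend`). Conversely, the frame of arrows is the
  cofree set on the `B_J`-set of closed ideals, so homomorphisms `M × M → arrFrame` amount to local
  conditions on pairs `(k, l)`. The condition that `l` is locally of the form `k * n` is stable
  under translation and holds for `k = 1`, so by uniqueness the homomorphism `dividesHom` which it
  defines is constantly `⊤`; at `(m, 1)` this says that `1` is locally of the form `m * n`.
  Local right inverses of all elements are two-sided, by the usual argument for monoids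
  (`hasPartialInverses_of_right_inverses`).
* Restriction monoid. The partial isomorphisms are the `m|_b` such that `m` has a local inverse
  over `b` (`Restr.isPartialIso_mk`), and an admissible family with join `m|_1` has as its supports
  a whole partition in `J`.
* Localic category. Inversion is defined by `(inv f)(m) = m^* f(m⁻¹)`, glued along the regions where
  `m⁻¹` makes sense (`invHom`). Conversely the open sets `inv (sec n)` cover, which provides a
  partition over whose pieces the inverse of `m` is represented by elements `n`
  (`hasPartialInverses_of_isGroupoid`).
* Topological category. If the partitions are finite, each ultrafilter contains a piece of each
  partition, so that local inverses give inverse arrows, depending continuously on the arrow.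
  Conversely, if all arrows `(U, m)` are invertible then no ultrafilter avoids the ideal of those
  `b` which are locally regions of invertibility of `m`, and so this ideal contains `⊤`
  (`hasPartialInverses_of_isGroupoid_cls`).
-/

namespace MatchedPairs

/-! ### The exponential comparison map of the forgetful functor -/

section Comparison

open MonoidalCategory CartesianMonoidalCategory

variable {B M : Type u} [BooleanAlgebra B] [Monoid M] {𝔓 : MatchedPair B M}

theorem BJSet.isIso_iff_bijective {J : ZeroDimTopology B} {X Y : BJSet J} (f : X ⟶ Y) :
    IsIso f ↔ Function.Bijective (BJHom.toFun f) := by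
  constructor
  · intro h
    refine Function.bijective_iff_has_inverse.2 ⟨BJHom.toFun (inv f), fun x => ?_, fun y => ?_⟩
    · exact congrArg (fun k : X ⟶ X => BJHom.toFun k x) (IsIso.hom_inv_id f)
    · exact congrArg (fun k : Y ⟶ Y => BJHom.toFun k y) (IsIso.inv_hom_id f)
  · intro h
    obtain ⟨g, hl, hr⟩ := Function.bijective_iff_has_inverse.1 h
    have hg : ∀ b x y, g (Y.str.cond b x y) = X.str.cond b (g x) (g y) := by
      intro b x y
      apply h.1
      rw [hr, BJHom.map_cond, hr, hr]
    exact ⟨BJHom.ofCond _ _ g hg, BJSet.hom_ext hl, BJSet.hom_ext hr⟩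

theorem inv_prodComparison_forget_apply (X Y : BJMSet 𝔓) (p : X.carrier × Y.carrier) :
    BJHom.toFun (inv (prodComparison (forget 𝔓) X Y)) p = p :=
  congrArg (fun k : (forget 𝔓).obj (X ⊗ Y) ⟶ _ => BJHom.toFun k p)
    (IsIso.hom_inv_id (prodComparison (forget 𝔓) X Y))

theorem BJSet.ev_apply {J : ZeroDimTopology B} (X Y : BJSet J)
    (p : X.carrier × BJHom X.str Y.str) :
    BJHom.toFun ((ihom.ev X).app Y) p = p.2.toFun p.1 := by
  have : (ihom.ev X).app Y = (BJSet.curryEquiv X _ Y).symm (𝟙 _) :=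
    Adjunction.adjunctionOfEquivRight_counit_app (BJSet.curryEquiv X) (fun _ _ _ _ _ => rfl) Y
  rw [this]
  rfl

variable [Nontrivial B]

theorem BJMSet.ev_apply (X Y : BJMSet 𝔓)
    (p : X.carrier × BJMHom ((BJMStr.regular 𝔓).prod X.str) Y.str) :
    BJMSet.fn ((ihom.ev X).app Y) p = p.2.toFun (1, p.1) := by
  have : (ihom.ev X).app Y = (BJMSet.curryEquiv X _ Y).symm (𝟙 _) :=
    Adjunction.adjunctionOfEquivRight_counit_app (BJMSet.curryEquiv X)
      (BJMSet.curryEquiv_naturality X) Y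
  rw [this]
  rfl

/-- The exponential comparison map of the forgetful functor sends `h : M × Y → Z` to `h(1, -)`. -/
theorem expComparison_forget_apply (Y Z : BJMSet 𝔓)
    (h : BJMHom ((BJMStr.regular 𝔓).prod Y.str) Z.str) (y : Y.carrier) :
    BJHom.toFun (X := Y.carrier) (Y := Z.carrier) (σ := Y.str.toBJStr) (τ := Z.str.toBJStr)
      (BJHom.toFun ((expComparison (forget 𝔓) Y).natTrans.app Z) h) y = h.toFun (1, y) := by
  have h1 := congrArg (fun k => BJHom.toFun k (y, h)) (expComparison_ev (forget 𝔓) Y Z)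
  have h2 := BJSet.ev_apply ((forget 𝔓).obj Y) ((forget 𝔓).obj Z)
    (y, BJHom.toFun ((expComparison (forget 𝔓) Y).natTrans.app Z) h)
  have h3 := congrArg (BJMSet.fn ((ihom.ev Y).app Z))
    (inv_prodComparison_forget_apply Y (BJMSet.exp Y Z) (y, h))
  exact h2.symm.trans (h1.trans (h3.trans (BJMSet.ev_apply Y Z (y, h))))

theorem monoidalClosedFunctor_forget_iff :
    MonoidalClosedFunctor (forget 𝔓) ↔ ∀ (Y Z : BJMSet 𝔓), Function.Bijective
      fun h : BJMHom ((BJMStr.regular 𝔓).prod Y.str) Z.str =>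
        BJHom.ofCond Y.str.toBJStr Z.str.toBJStr (fun y => h.toFun (1, y)) (by
          intro b x y
          rw [← h.map_pair_cond, 𝔓.str.cond_self]) := by
  have key : ∀ Y Z : BJMSet 𝔓, IsIso ((expComparison (forget 𝔓) Y).natTrans.app Z) ↔
      Function.Bijective fun h : BJMHom ((BJMStr.regular 𝔓).prod Y.str) Z.str =>
        BJHom.ofCond Y.str.toBJStr Z.str.toBJStr (fun y => h.toFun (1, y)) (by
          intro b x y
          rw [← h.map_pair_cond, 𝔓.str.cond_self]) := by
    intro Y Z
    rw [BJSet.isIso_iff_bijective]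
    refine Eq.to_iff (congrArg Function.Bijective ?_)
    funext h
    exact BJHom.ext (funext fun y => expComparison_forget_apply Y Z h y)
  constructor
  · intro h Y Z
    have := h.comparison_iso Y
    exact (key Y Z).1 inferInstance
  · intro h
    refine ⟨fun Y => ?_⟩
    have : ∀ Z, IsIso ((expComparison (forget 𝔓) Y).natTrans.app Z) := fun Z => (key Y Z).2 (h Y Z)
    exact NatIso.isIso_of_isIso_app _

end Comparison

/-! ### Local inverses -/

namespace MatchedPair

open BStr

variable {B M : Type u} [BooleanAlgebra B] [Monoid M] {𝔓 : MatchedPair B M}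

theorem inf_act_eq_inf {k : M} {b : B} (h : 𝔓.str.Eqv b k 1) (d : B) :
    b ⊓ 𝔓.act k d = b ⊓ d := by
  rw [𝔓.inf_act_eq h, 𝔓.act_one]

theorem le_act_of_eqv_one {k : M} {a b d : B} (h : 𝔓.str.Eqv b k 1) (hb : a ≤ b) (hd : a ≤ d) :
    a ≤ 𝔓.act k d :=
  ((le_inf hb hd).trans (inf_act_eq_inf h d).ge).trans inf_le_right

variable (𝔓) in
/-- `n` is inverse to `m` over `b`: over `b` the element `m` lands in the region `c`, on which `n`
is a left inverse of `m`, and `n` is a right inverse of `m` over `b`. -/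
structure IsLocalInverse (m n : M) (b c : B) : Prop where
  le_act : b ≤ 𝔓.act m c
  mul_eqv : 𝔓.str.Eqv b (m * n) 1
  eqv_mul : 𝔓.str.Eqv c (n * m) 1

theorem hasPartialInverses_iff : 𝔓.HasPartialInverses ↔
    ∀ m : M, ∃ P ∈ 𝔓.J.parts, ∀ b ∈ P, ∃ n c, 𝔓.IsLocalInverse m n b c := by
  constructor
  · intro h m
    obtain ⟨I, b, n, c, hP, h⟩ := h m
    refine ⟨_, hP, ?_⟩
    rintro _ ⟨i, rfl⟩
    exact ⟨n i, c i, (h i).1, (h i).2.1, (h i).2.2⟩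
  · intro h m
    obtain ⟨P, hP, h⟩ := h m
    choose n c h using h
    exact ⟨P, Subtype.val, fun b => n b b.2, fun b => c b b.2, by rwa [Subtype.range_coe],
      fun b => ⟨(h b b.2).le_act, (h b b.2).mul_eqv, (h b b.2).eqv_mul⟩⟩

namespace IsLocalInverse

variable {m n m' n' k : M} {b c b' c' d : B}

theorem one : 𝔓.IsLocalInverse 1 1 ⊤ ⊤ :=
  ⟨(map_top (𝔓.act 1)).ge, by rw [one_mul]; exact Eqv.refl _ _,
    by rw [one_mul]; exact Eqv.refl _ _⟩

theorem mono (h : 𝔓.IsLocalInverse m n b c) (hd : d ≤ b) : 𝔓.IsLocalInverse m n d c :=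
  ⟨hd.trans h.le_act, h.mul_eqv.mono hd, h.eqv_mul⟩

theorem mul (hk : 𝔓.IsLocalInverse k n' b' c') (hm : 𝔓.IsLocalInverse m n b c) :
    𝔓.IsLocalInverse (k * m) (n * n') (b' ⊓ 𝔓.act k b) (c ⊓ 𝔓.act n c') := by
  refine ⟨?_, ?_, ?_⟩
  · rw [𝔓.act_mul, map_inf, map_inf]
    refine le_inf (inf_le_right.trans (OrderHomClass.mono (𝔓.act k) hm.le_act)) ?_
    calc b' ⊓ 𝔓.act k b ≤ 𝔓.act k (b ⊓ c') := by
          rw [map_inf]; exact le_inf inf_le_right (inf_le_left.trans hk.le_act)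
      _ = 𝔓.act k (b ⊓ 𝔓.act m (𝔓.act n c')) := by
          rw [← 𝔓.act_mul, inf_act_eq_inf hm.mul_eqv]
      _ ≤ _ := OrderHomClass.mono (𝔓.act k) inf_le_right
  · have h1 := 𝔓.mul_right_eqv (𝔓.mul_left_eqv k hm.mul_eqv) n'
    rw [mul_one, ← mul_assoc] at h1
    rw [← mul_assoc]
    exact (h1.mono inf_le_right).trans (hk.mul_eqv.mono inf_le_left)
  · have h1 := 𝔓.mul_right_eqv (𝔓.mul_left_eqv n hk.eqv_mul) m
    rw [mul_one, ← mul_assoc] at h1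
    rw [← mul_assoc]
    exact (h1.mono inf_le_right).trans (hm.eqv_mul.mono inf_le_left)

theorem congr (h : 𝔓.IsLocalInverse m n b c) (hd : 𝔓.str.Eqv d m m') :
    𝔓.IsLocalInverse m' n (b ⊓ d) (c ⊓ 𝔓.act n d) := by
  have h1 : 𝔓.str.Eqv (b ⊓ d) (m' * n) 1 :=
    ((𝔓.mul_right_eqv hd n).symm.mono inf_le_right).trans (h.mul_eqv.mono inf_le_left)
  refine ⟨?_, h1, ?_⟩
  · rw [map_inf, ← 𝔓.act_mul]
    refine le_inf ?_ (le_act_of_eqv_one h1 le_rfl inf_le_right)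
    calc b ⊓ d ≤ d ⊓ 𝔓.act m c := le_inf inf_le_right (inf_le_left.trans h.le_act)
      _ = d ⊓ 𝔓.act m' c := 𝔓.inf_act_eq hd c
      _ ≤ _ := inf_le_right
  · exact ((𝔓.mul_left_eqv n hd).symm.mono inf_le_right).trans (h.eqv_mul.mono inf_le_left)

/-- Two local inverses agree on the part of the target where both are defined. -/
theorem unique (h : 𝔓.IsLocalInverse m n b c) (h' : 𝔓.IsLocalInverse m n' b' c') :
    𝔓.str.Eqv (c ⊓ 𝔓.act n b') n n' := by
  have h1 := 𝔓.mul_left_eqv n h'.mul_eqv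
  have h2 := 𝔓.mul_right_eqv h.eqv_mul n'
  rw [mul_one, ← mul_assoc] at h1
  rw [one_mul] at h2
  exact (h1.symm.mono inf_le_right).trans (h2.mono inf_le_left)

theorem inf_le_act (h : 𝔓.IsLocalInverse m n b c) (d : B) :
    b ⊓ d ≤ 𝔓.act m (c ⊓ 𝔓.act n d) := by
  rw [map_inf, ← 𝔓.act_mul]
  exact le_inf (inf_le_left.trans h.le_act) (le_act_of_eqv_one h.mul_eqv inf_le_left inf_le_right)

end IsLocalInverse

end MatchedPair

/-! ### Partial inverses make the forgetful functor cartesian closed -/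

section Extension

open BStr MatchedPair

variable {B M : Type u} [BooleanAlgebra B] [Monoid M] {𝔓 : MatchedPair B M}
  {X Y : Type u} {σ : BJMStr 𝔓 X} {τ : BJMStr 𝔓 Y}

theorem BJHom.map_eqv {J : ZeroDimTopology B} {σ : BJStr J X} {τ : BJStr J Y} (g : BJHom σ τ)
    {b : B} {x y : X} (h : σ.Eqv b x y) : τ.Eqv b (g.toFun x) (g.toFun y) := by
  have h' : σ.cond b x y = y := h
  unfold Eqv
  rw [← g.map_cond, h']

/-- A map preserving all the relations `≡_b` is a homomorphism. -/
theorem BStr.map_cond_of_map_eqv {σ : BStr B X} {τ : BStr B Y} {f : X → Y}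
    (hf : ∀ b x y, σ.Eqv b x y → τ.Eqv b (f x) (f y)) (b : B) (x y : X) :
    f (σ.cond b x y) = τ.cond b (f x) (f y) :=
  eq_cond (hf _ _ _ (cond_eqv_left _ _ _)) (hf _ _ _ (cond_eqv_right _ _ _))

theorem BJMStr.smul_eqv_left (σ : BJMStr 𝔓 X) {b : B} {m n : M} (h : 𝔓.str.Eqv b m n) (x : X) :
    σ.Eqv b (σ.smul m x) (σ.smul n x) := by
  have h' : 𝔓.str.cond b m n = n := h
  unfold Eqv
  rw [← σ.cond_smul, h']

/-- The elements `m · g(n · x)`, for the various local inverses `n` of `m`, are compatible. -/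
theorem MatchedPair.IsLocalInverse.eqv_smul (g : BJHom σ.toBJStr τ.toBJStr) {m n n' : M}
    {b c b' c' : B} (h : 𝔓.IsLocalInverse m n b c) (h' : 𝔓.IsLocalInverse m n' b' c') (x : X) :
    τ.Eqv (b ⊓ b') (τ.smul m (g.toFun (σ.smul n x))) (τ.smul m (g.toFun (σ.smul n' x))) :=
  (τ.smul_eqv m (g.map_eqv (σ.smul_eqv_left (h.unique h') x))).mono (h.inf_le_act b')

variable [Nontrivial B]

theorem exists_unique_extension (hinv : 𝔓.HasPartialInverses) (g : BJHom σ.toBJStr τ.toBJStr)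
    (m : M) (x : X) : ∃! z, ∀ n b c, 𝔓.IsLocalInverse m n b c →
      τ.Eqv b z (τ.smul m (g.toFun (σ.smul n x))) := by
  obtain ⟨P, hP, h⟩ := hasPartialInverses_iff.1 hinv m
  choose n c h using h
  obtain ⟨z, hz⟩ := τ.exists_glue hP
    (fun b => τ.smul m (g.toFun (σ.smul (n b b.2) x)))
  refine ⟨z, fun n' b' c' h' => ?_, fun z' hz' => ?_⟩
  · apply τ.eqv_of_parts hP
    intro b hb
    exact ((hz ⟨b, hb⟩).mono inf_le_right).trans
      (((h b hb).eqv_smul g h' x).mono (inf_comm _ _).le)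
  · apply τ.eq_of_parts hP
    intro b hb
    exact (hz' _ _ _ (h b hb)).trans (hz ⟨b, hb⟩).symm

/-- The element which agrees with `m · g(n · x)` wherever `n` is a local inverse of `m`; informally
it is `m · g(m⁻¹ · x)`. -/
noncomputable def extendFun (hinv : 𝔓.HasPartialInverses) (g : BJHom σ.toBJStr τ.toBJStr)
    (p : M × X) : Y :=
  (exists_unique_extension hinv g p.1 p.2).choose

theorem extendFun_eqv (hinv : 𝔓.HasPartialInverses) (g : BJHom σ.toBJStr τ.toBJStr)
    {m n : M} {b c : B} (h : 𝔓.IsLocalInverse m n b c) (x : X) :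
    τ.Eqv b (extendFun hinv g (m, x)) (τ.smul m (g.toFun (σ.smul n x))) :=
  (exists_unique_extension hinv g m x).choose_spec.1 n b c h

/-- The extension of a homomorphism `X → Y` of `B_J`-sets to a homomorphism `M × X → Y` over the
matched pair. -/
noncomputable def extend (hinv : 𝔓.HasPartialInverses) (g : BJHom σ.toBJStr τ.toBJStr) :
    BJMHom ((BJMStr.regular 𝔓).prod σ) τ :=
  BJMHom.ofCond _ _ (extendFun hinv g)
    (BStr.map_cond_of_map_eqv (σ := ((BJMStr.regular 𝔓).prod σ).toBStr) (τ := τ.toBStr) (by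
      rintro d ⟨m, x⟩ ⟨m', x'⟩ h
      have hm : 𝔓.str.Eqv d m m' := congrArg Prod.fst h
      have hx : σ.Eqv d x x' := congrArg Prod.snd h
      obtain ⟨P, hP, hloc⟩ := hasPartialInverses_iff.1 hinv m
      apply τ.eqv_of_parts hP
      intro b hb
      obtain ⟨n, c, hn⟩ := hloc b hb
      have h1 := (extendFun_eqv hinv g hn x).mono (inf_le_right : d ⊓ b ≤ b)
      have h2 := (extendFun_eqv hinv g (hn.congr hm) x').mono (inf_comm d b).le
      refine h1.trans (Eqv.trans ?_ h2.symm)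
      refine ((τ.smul_eqv_left hm _).mono inf_le_left).trans ?_
      refine (τ.smul_eqv m' (g.map_eqv (σ.smul_eqv n hx))).mono ?_
      rw [← 𝔓.act_mul]
      exact le_act_of_eqv_one (hn.congr hm).mul_eqv (inf_comm d b).le inf_le_left))
    (by
      rintro k ⟨m, x⟩
      obtain ⟨P, hP, hloc⟩ := hasPartialInverses_iff.1 hinv m
      obtain ⟨P', hP', hloc'⟩ := hasPartialInverses_iff.1 hinv k
      apply τ.eq_of_parts hP'
      intro b' hb'
      apply τ.eqv_of_act k hP
      intro b hb
      obtain ⟨n, c, hn⟩ := hloc b hb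
      obtain ⟨n', c', hn'⟩ := hloc' b' hb'
      have h1 := extendFun_eqv hinv g (hn'.mul hn) (σ.smul k x)
      have h2 := τ.smul_eqv k (extendFun_eqv hinv g hn x)
      refine h1.trans (Eqv.trans ?_ (h2.mono inf_le_right).symm)
      rw [τ.mul_smul]
      have h3 : σ.Eqv (𝔓.act n c') (σ.smul (n * n') (σ.smul k x)) (σ.smul n x) := by
        have h4 := σ.smul_eqv_left (𝔓.mul_left_eqv n hn'.eqv_mul) x
        rwa [mul_one, ← mul_assoc, σ.mul_smul _ k] at h4
      refine (τ.smul_eqv k (τ.smul_eqv m (g.map_eqv h3))).mono ?_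
      refine ((hn'.mul hn).le_act.trans ?_)
      rw [𝔓.act_mul]
      exact OrderHomClass.mono (𝔓.act k) (OrderHomClass.mono (𝔓.act m) inf_le_right))

theorem extend_one (hinv : 𝔓.HasPartialInverses) (g : BJHom σ.toBJStr τ.toBJStr) (x : X) :
    (extend hinv g).toFun (1, x) = g.toFun x := by
  have := eqv_top.1 (extendFun_eqv hinv g IsLocalInverse.one x)
  rw [σ.one_smul, τ.one_smul] at this
  exact this

theorem monoidalClosedFunctor_forget (hinv : 𝔓.HasPartialInverses) :
    MonoidalClosedFunctor (forget 𝔓) := by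
  refine monoidalClosedFunctor_forget_iff.2 fun Y Z => ⟨fun h h' hh => ?_, fun g => ?_⟩
  · have hh : ∀ y, h.toFun (1, y) = h'.toFun (1, y) := fun y =>
      congrArg (fun k => BJHom.toFun k y) hh
    refine BJMHom.ext' ?_
    rintro ⟨m, y⟩
    obtain ⟨P, hP, hloc⟩ := hasPartialInverses_iff.1 hinv m
    apply Z.str.eq_of_parts hP
    intro b hb
    obtain ⟨n, c, hn⟩ := hloc b hb
    -- over `b`, the pair `(m, y)` is the translate by `m` of `(1, n · y)`
    have key : ∀ h : BJMHom ((BJMStr.regular 𝔓).prod Y.str) Z.str,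
        Z.str.Eqv b (h.toFun (m, y)) (Z.str.smul m (h.toFun (1, Y.str.smul n y))) := by
      intro h
      rw [← h.map_pair_smul]
      refine BJHom.map_eqv h.toBJHom (x := (m, y)) (y := (m * 1, _)) (Prod.ext ?_ ?_)
      · rw [mul_one]
        exact Eqv.refl _ _
      · have h1 := Y.str.smul_eqv_left hn.mul_eqv y
        rw [Y.str.one_smul, Y.str.mul_smul] at h1
        exact h1.symm
    refine (key h).trans ?_
    rw [hh]
    exact (key h').symm
  · exact ⟨extend hinv g, BJHom.ext (funext fun y => extend_one hinv g y)⟩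

end Extension

/-! ### Refinement of partitions and joins of closed ideals -/

section Refinement

variable {B : Type u} [BooleanAlgebra B] {J : ZeroDimTopology B}

/-- A property which holds locally on every piece of a partition holds locally. -/
theorem ZeroDimTopology.exists_parts_trans {C : B → Prop} {P : Set B} (hP : P ∈ J.parts)
    (h : ∀ p ∈ P, ∃ R ∈ J.parts, ∀ r ∈ R, C (p ⊓ r)) : ∃ R ∈ J.parts, ∀ r ∈ R, C r := by
  choose! R hR hC using h
  refine ⟨_, J.bind_mem P hP R hR, ?_⟩
  rintro _ ⟨⟨p, hp, r, hr, rfl⟩, -⟩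
  exact hC p hp r hr

theorem ZeroDimTopology.top_mem_parts [Nontrivial B] : ({⊤} : Set B) ∈ J.parts := by
  refine J.finite_mem _ (Set.finite_singleton _) ⟨?_, isLUB_singleton, ?_⟩
  · rw [Set.mem_singleton_iff]
    exact bot_ne_top
  · rintro c hc d hd hne
    exact absurd ((Set.mem_singleton_iff.1 hc).trans (Set.mem_singleton_iff.1 hd).symm) hne

namespace ClosedIdeal

theorem eq_top_of_parts {P : Set B} (hP : P ∈ J.parts) {I : ClosedIdeal J} (h : P ⊆ I) :
    I = ⊤ := by
  have h1 : ⊤ ∈ I := I.closed ⟨⟨P, hP, subset_rfl⟩, (J.isPartition P hP).2.1⟩ h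
  exact top_le_iff.1 fun b _ => I.mem_of_le h1 le_top

variable [Nontrivial B]

variable (J) in
/-- The closed ideal of those `b` which are covered by a partition in `J` whose traces on `b` lie
in the lower set `D`. -/
def locally (D : LowerSet B) (hD : ⊥ ∈ D) : ClosedIdeal J where
  carrier := {b | ∃ P ∈ J.parts, ∀ p ∈ P, p ⊓ b ∈ D}
  bot_mem := ⟨_, J.top_mem_parts, fun p _ => by rwa [inf_bot_eq]⟩
  mem_of_le := by
    rintro b c ⟨P, hP, h⟩ hc
    exact ⟨P, hP, fun p hp => D.lower (inf_le_inf_left p hc) (h p hp)⟩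
  sup_mem := by
    rintro b c ⟨P, hP, hb⟩ ⟨Q, hQ, hc⟩
    refine ZeroDimTopology.exists_parts_trans (C := fun p => p ⊓ (b ⊔ c) ∈ D) (J.pair_mem b) ?_
    rintro p ⟨hp, -⟩
    rcases hp with rfl | hp
    · refine ⟨P, hP, fun r hr => D.lower ?_ (hb r hr)⟩
      exact le_inf (inf_le_left.trans inf_le_right) (inf_le_left.trans inf_le_left)
    · rw [Set.mem_singleton_iff] at hp
      subst hp
      refine ⟨Q, hQ, fun r hr => D.lower ?_ (hc r hr)⟩
      refine le_inf (inf_le_left.trans inf_le_right) ?_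
      calc bᶜ ⊓ r ⊓ (b ⊔ c) ≤ bᶜ ⊓ (b ⊔ c) := inf_le_inf_right _ inf_le_left
        _ ≤ c := by rw [inf_sup_left, compl_inf_self, bot_sup_eq]; exact inf_le_right
  closed := by
    rintro b P ⟨⟨Q, hQ, hPQ⟩, hb⟩ h
    refine ZeroDimTopology.exists_parts_trans (C := fun p => p ⊓ b ∈ D) hQ fun q hq => ?_
    by_cases hqP : q ∈ P
    · obtain ⟨R, hR, hr⟩ := h hqP
      refine ⟨R, hR, fun r h => D.lower ?_ (hr r h)⟩
      exact le_inf (inf_le_left.trans inf_le_right) (inf_le_left.trans inf_le_left)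
    · have hbq : b ≤ qᶜ := by
        apply hb.2
        intro p hp
        rw [le_compl_iff_disjoint_right, disjoint_iff]
        exact (J.isPartition Q hQ).2.2 p (hPQ hp) q hq (by rintro rfl; exact hqP hp)
      refine ⟨_, J.top_mem_parts, fun r _ => ?_⟩
      have : q ⊓ r ⊓ b = ⊥ := le_bot_iff.1 <| by
        calc q ⊓ r ⊓ b ≤ q ⊓ qᶜ := inf_le_inf inf_le_left hbq
          _ = ⊥ := inf_compl_self q
      rwa [this]

/-- If a family of closed ideals covers, then some partition in `J` is subordinate to it. -/
theorem exists_parts_of_iSup_eq_top {ι : Type*} {I : ι → ClosedIdeal J} (h : ⨆ i, I i = ⊤) :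
    ∃ P ∈ J.parts, ∀ p ∈ P, ∃ i, p ∈ I i := by
  have hne : Nonempty ι := by
    by_contra hι
    rw [not_nonempty_iff] at hι
    rw [iSup_of_empty] at h
    have h1 : (⊤ : ClosedIdeal J) ≤ principal J ⊥ := h ▸ bot_le
    have h2 : (⊤ : B) ≤ ⊥ := mem_principal.1 (h1 ((le_top : principal J ⊤ ≤ ⊤) le_rfl))
    exact bot_ne_top (le_antisymm bot_le h2)
  let D : LowerSet B := ⟨{b | ∃ i, b ∈ I i}, fun _ _ hc ⟨i, hi⟩ => ⟨i, (I i).mem_of_le hi hc⟩⟩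
  have hD : ⊥ ∈ D := ⟨hne.some, (I _).bot_mem⟩
  have h1 : ⊤ ≤ locally J D hD := by
    rw [← h]
    refine iSup_le fun i b hb => ⟨_, J.top_mem_parts, fun p _ => ?_⟩
    exact ⟨i, (I i).mem_of_le hb inf_le_right⟩
  obtain ⟨P, hP, h2⟩ := h1 ((le_top : principal J ⊤ ≤ ⊤) (mem_principal.2 le_rfl))
  refine ⟨P, hP, fun p hp => ?_⟩
  have := h2 p hp
  rwa [inf_top_eq] at this

end ClosedIdeal

end Refinement

/-! ### The frame of arrows as a set over the matched pair -/

section FrameStructure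

variable {B : Type u} [BooleanAlgebra B] {J : ZeroDimTopology B} {A : Type u} [Order.Frame A]

theorem eq_of_inf_map_eq {φ : BoundedLatticeHom B A} (b : B) {x y : A}
    (h : φ b ⊓ x = φ b ⊓ y) (h' : φ bᶜ ⊓ x = φ bᶜ ⊓ y) : x = y := by
  have key : ∀ z, z = (φ b ⊓ z) ⊔ (φ bᶜ ⊓ z) := fun z => by
    rw [← inf_sup_right, ← map_sup, sup_compl_eq_top, map_top, top_inf_eq]
  rw [key x, key y, h, h']

theorem map_inf_cond (φ : BoundedLatticeHom B A) (b : B) (x y : A) :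
    φ b ⊓ ((φ b ⊓ x) ⊔ (φ bᶜ ⊓ y)) = φ b ⊓ x := by
  rw [inf_sup_left, ← inf_assoc, ← inf_assoc, ← map_inf φ b bᶜ, inf_compl_self, map_bot,
    bot_inf_eq, sup_bot_eq, inf_idem]

theorem map_compl_inf_cond (φ : BoundedLatticeHom B A) (b : B) (x y : A) :
    φ bᶜ ⊓ ((φ b ⊓ x) ⊔ (φ bᶜ ⊓ y)) = φ bᶜ ⊓ y := by
  rw [inf_sup_left, ← inf_assoc, ← inf_assoc, ← map_inf φ bᶜ b, compl_inf_self, map_bot,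
    bot_inf_eq, bot_sup_eq, inf_idem]

/-- A frame with a homomorphism from `B` sending the partitions in `J` to covers is a `B_J`-set,
with `x ≡_b y` iff `x` and `y` have the same meet with the image of `b`. -/
def BJStr.ofFrame (φ : BoundedLatticeHom B A) (hφ : ∀ P ∈ J.parts, ⨆ b : P, φ b = ⊤) :
    BJStr J A where
  cond b x y := (φ b ⊓ x) ⊔ (φ bᶜ ⊓ y)
  cond_self b x := eq_of_inf_map_eq b (map_inf_cond φ b x x) (map_compl_inf_cond φ b x x)
  cond_cond_left b x y z := by rw [map_inf_cond]
  cond_cond_right b x y z := by rw [map_compl_inf_cond]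
  cond_top x y := by rw [compl_top, map_top, map_bot, top_inf_eq, bot_inf_eq, sup_bot_eq]
  cond_compl b x y := by rw [compl_compl, sup_comm]
  cond_inf b c x y := by
    apply eq_of_inf_map_eq (φ := φ) b
    · rw [map_inf_cond, compl_inf, map_sup, map_inf]
      simp only [inf_sup_left, inf_sup_right, ← inf_assoc, inf_idem]
      rw [← map_inf φ b bᶜ, inf_compl_self, map_bot, bot_inf_eq, bot_sup_eq]
    · rw [map_compl_inf_cond, compl_inf, map_sup, map_inf]
      simp only [inf_sup_left, inf_sup_right, ← inf_assoc, inf_idem]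
      rw [← map_inf φ bᶜ b, compl_inf_self, map_bot, bot_inf_eq, bot_inf_eq, bot_sup_eq]
      exact sup_eq_left.2 (inf_le_inf_right _ inf_le_left)
  glue P hP _ x := ⨆ b : P, φ b ⊓ x b
  glue_const P hP _ x := by rw [← iSup_inf_eq, hφ P hP, top_inf_eq]
  glue_cond P hP _ x y := iSup_congr fun b => map_inf_cond φ b (x b) (y b)
  cond_glue P hP hi x b := by
    have h : φ b ⊓ ⨆ c : P, φ c ⊓ x c = φ b ⊓ x b := by
      rw [inf_iSup_eq]
      apply le_antisymm
      · refine iSup_le fun c => ?_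
        rcases eq_or_ne b c with rfl | hne
        · exact inf_le_inf_left _ inf_le_right
        · rw [← inf_assoc, ← map_inf, (J.isPartition P hP).2.2 b b.2 c c.2
            (fun h => hne (Subtype.ext h)), map_bot, bot_inf_eq]
          exact bot_le
      · refine le_trans ?_ (le_iSup _ b)
        rw [← inf_assoc, inf_idem]
    apply eq_of_inf_map_eq (φ := φ) b.1
    · rw [map_inf_cond, h]
    · rw [map_compl_inf_cond]

theorem BJStr.ofFrame_eqv {φ : BoundedLatticeHom B A} {hφ : ∀ P ∈ J.parts, ⨆ b : P, φ b = ⊤}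
    {b : B} {x y : A} : (BJStr.ofFrame φ hφ).Eqv b x y ↔ φ b ⊓ x = φ b ⊓ y := by
  constructor
  · intro h
    have h' : (φ b ⊓ x) ⊔ (φ bᶜ ⊓ y) = y := h
    rw [← h', map_inf_cond]
  · intro h
    apply eq_of_inf_map_eq (φ := φ) b
    · exact (map_inf_cond φ b x y).trans h
    · exact map_compl_inf_cond φ b x y

end FrameStructure

namespace MatchedPair

open ClosedIdeal

variable {B M : Type u} [BooleanAlgebra B] [Monoid M] {𝔓 : MatchedPair B M}

theorem arr_inf (f g : 𝔓.arrFrame) (m : M) : (f ⊓ g).1 m = f.1 m ⊓ g.1 m := rfl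

theorem arr_sup (f g : 𝔓.arrFrame) (m : M) : (f ⊔ g).1 m = f.1 m ⊔ g.1 m := rfl

theorem arr_iSup {ι : Type*} (f : ι → 𝔓.arrFrame) (m : M) :
    (⨆ i, f i).1 m = ⨆ i, (f i).1 m := by
  rw [CompleteSublattice.coe_iSup, iSup_apply]

theorem principal_top : principal 𝔓.J ⊤ = ⊤ := top_le_iff.1 fun _ _ => mem_principal.2 le_top

theorem principal_bot : principal 𝔓.J ⊥ = ⊥ :=
  le_bot_iff.1 (principal_le.2 (ClosedIdeal.bot_mem _))

theorem principal_sup (b c : B) :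
    principal 𝔓.J (b ⊔ c) = principal 𝔓.J b ⊔ principal 𝔓.J c := by
  apply le_antisymm
  · rw [principal_le]
    exact ClosedIdeal.sup_mem _ ((le_sup_left : principal 𝔓.J b ≤ _) le_rfl)
      ((le_sup_right : principal 𝔓.J c ≤ _) le_rfl)
  · exact sup_le (principal_le.2 le_sup_left) (principal_le.2 le_sup_right)

theorem iSup_principal {P : Set B} (hP : P ∈ 𝔓.J.parts) :
    ⨆ b : P, principal 𝔓.J (b : B) = ⊤ :=
  eq_top_of_parts hP fun b hb =>
    (le_iSup (fun b : P => principal 𝔓.J (b : B)) ⟨b, hb⟩) (mem_principal.2 le_rfl)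

variable (𝔓) in
/-- The inverse image along the target map of the clopen subset `b` of the space of objects. -/
def tgtPrincipal : BoundedLatticeHom B 𝔓.arrFrame where
  toFun b := 𝔓.tgtHom (principal 𝔓.J b)
  map_sup' b c := by rw [principal_sup, map_sup]
  map_inf' b c := by rw [principal_inf, map_inf]
  map_top' := by rw [principal_top, map_top]
  map_bot' := by rw [principal_bot, map_bot]

theorem tgtPrincipal_apply (b : B) (m : M) :
    (𝔓.tgtPrincipal b).1 m = principal 𝔓.J (𝔓.act m b) := 𝔓.actIdeal_principal m b

theorem iSup_tgtPrincipal (P : Set B) (hP : P ∈ 𝔓.J.parts) : ⨆ b : P, 𝔓.tgtPrincipal b = ⊤ := by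
  change ⨆ b : P, 𝔓.tgtHom (principal 𝔓.J b) = ⊤
  rw [← map_iSup, iSup_principal hP, map_top]

variable (𝔓) in
/-- The frame of arrows as a set over the matched pair: `x ≡_b y` iff `x` and `y` agree on the
arrows with target in `b`, and `(m · f)(n) = f(nm)`. It is cofree on the `B_J`-set of
closed ideals. -/
def arrStr : BJMStr 𝔓 𝔓.arrFrame where
  toBJStr := BJStr.ofFrame 𝔓.tgtPrincipal iSup_tgtPrincipal
  smul m f := ⟨fun n => f.1 (n * m), fun b n n' h => f.2 b _ _ (𝔓.mul_right_eqv h m)⟩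
  one_smul f := arr_ext fun n => congrArg f.1 (mul_one n)
  mul_smul m n f := arr_ext fun k => congrArg f.1 (mul_assoc k m n).symm
  cond_smul b m n f := by
    apply BStr.eq_cond (σ := (BJStr.ofFrame 𝔓.tgtPrincipal iSup_tgtPrincipal).toBStr)
    · refine BJStr.ofFrame_eqv.2 (arr_ext fun k => ?_)
      rw [arr_inf, arr_inf, tgtPrincipal_apply, inf_comm, inf_comm (principal _ _)]
      exact f.2 _ _ _ (𝔓.mul_left_eqv k (BStr.cond_eqv_left b m n))
    · refine BJStr.ofFrame_eqv.2 (arr_ext fun k => ?_)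
      rw [arr_inf, arr_inf, tgtPrincipal_apply, inf_comm, inf_comm (principal _ _)]
      exact f.2 _ _ _ (𝔓.mul_left_eqv k (BStr.cond_eqv_right b m n))
  smul_cond m b f g := arr_ext fun k => by
    change (((𝔓.tgtPrincipal b) ⊓ f) ⊔ ((𝔓.tgtPrincipal bᶜ) ⊓ g)).1 (k * m) =
      (𝔓.tgtPrincipal (𝔓.act m b)).1 k ⊓ f.1 (k * m) ⊔
        (𝔓.tgtPrincipal (𝔓.act m b)ᶜ).1 k ⊓ g.1 (k * m)
    rw [arr_sup, arr_inf, arr_inf, tgtPrincipal_apply, tgtPrincipal_apply, tgtPrincipal_apply,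
      tgtPrincipal_apply, ← map_compl', 𝔓.act_mul, 𝔓.act_mul]

theorem arrStr_eqv {b : B} {f g : 𝔓.arrFrame} : 𝔓.arrStr.Eqv b f g ↔
    ∀ m, ClosedIdeal.Eqv (𝔓.act m b) (f.1 m) (g.1 m) := by
  refine (BJStr.ofFrame_eqv (hφ := iSup_tgtPrincipal)).trans
    ⟨fun h m => ?_, fun h => arr_ext fun m => ?_⟩
  · have h1 := congrArg (fun f : 𝔓.arrFrame => f.1 m) h
    simp only [arr_inf, tgtPrincipal_apply] at h1
    unfold ClosedIdeal.Eqv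
    rw [inf_comm, h1, inf_comm]
  · rw [arr_inf, arr_inf, tgtPrincipal_apply, inf_comm, inf_comm (principal _ _)]
    exact h m

/-! ### Cartesian closedness of the forgetful functor gives partial inverses -/

variable (𝔓) in
/-- The extent to which `l` is locally of the form `k * n`. -/
def divides (k l : M) : ClosedIdeal 𝔓.J := ⨆ n, (𝔓.sec (k * n)).1 l

theorem divides_eqv {b : B} {k k' l l' : M} (hk : 𝔓.str.Eqv b k k') (hl : 𝔓.str.Eqv b l l') :
    ClosedIdeal.Eqv b (𝔓.divides k l) (𝔓.divides k' l') := by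
  have key : ∀ {k k' l l' : M}, 𝔓.str.Eqv b k k' → 𝔓.str.Eqv b l l' →
      𝔓.divides k l ⊓ principal 𝔓.J b ≤ 𝔓.divides k' l' := by
    intro k k' l l' hk hl
    unfold divides
    rw [iSup_inf_eq]
    refine iSup_le fun n => le_trans ?_ (le_iSup _ n)
    intro c hc
    obtain ⟨h1, h2⟩ := mem_inf.1 hc
    exact (((𝔓.mul_right_eqv hk n).symm.mono h2).trans h1).trans (hl.mono h2)
  exact eqv_iff.2 ⟨key hk hl, key hk.symm hl.symm⟩

variable (𝔓) in
/-- The open set of those arrows `m` for which `m * l` is locally of the form `m * k * n`. -/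
def dividesFun (p : M × M) : 𝔓.arrFrame :=
  ⟨fun m => 𝔓.divides (m * p.1) (m * p.2), fun _ _ _ h =>
    divides_eqv (𝔓.mul_right_eqv h _) (𝔓.mul_right_eqv h _)⟩

variable (𝔓) in
/-- `dividesFun` as a homomorphism over the matched pair. -/
def dividesHom : BJMHom ((BJMStr.regular 𝔓).prod (BJMStr.regular 𝔓)) 𝔓.arrStr :=
  BJMHom.ofCond _ _ 𝔓.dividesFun
    (BStr.map_cond_of_map_eqv (σ := ((BJMStr.regular 𝔓).prod (BJMStr.regular 𝔓)).toBStr)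
      (τ := 𝔓.arrStr.toBStr) fun _ _ _ h => arrStr_eqv.2 fun m =>
        divides_eqv (𝔓.mul_left_eqv m (congrArg Prod.fst h))
          (𝔓.mul_left_eqv m (congrArg Prod.snd h)))
    (fun m p => arr_ext fun k => by
      change 𝔓.divides (k * (m * p.1)) (k * (m * p.2)) = 𝔓.divides (k * m * p.1) (k * m * p.2)
      rw [mul_assoc, mul_assoc])

variable (𝔓) in
/-- The constant homomorphism `M × M → arrFrame` with value `⊤`. -/
def topHom : BJMHom ((BJMStr.regular 𝔓).prod (BJMStr.regular 𝔓)) 𝔓.arrStr :=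
  BJMHom.ofCond _ _ (fun _ => ⊤) (fun b _ _ => (𝔓.arrStr.cond_self b ⊤).symm) (fun _ _ => rfl)

/-- If every element has local right inverses, then these are two-sided. -/
theorem hasPartialInverses_of_right_inverses
    (h : ∀ m : M, ∃ P ∈ 𝔓.J.parts, ∀ p ∈ P, ∃ n, 𝔓.str.Eqv p (m * n) 1) :
    𝔓.HasPartialInverses := by
  refine hasPartialInverses_iff.2 fun m => ?_
  obtain ⟨P, hP, hm⟩ := h m
  refine ZeroDimTopology.exists_parts_trans hP fun p hp => ?_
  obtain ⟨n, hn⟩ := hm p hp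
  obtain ⟨Q, hQ, hn'⟩ := h n
  refine ⟨_, 𝔓.act_parts m Q hQ, ?_⟩
  rintro _ ⟨⟨q, hq, rfl⟩, -⟩
  obtain ⟨d, hd⟩ := hn' q hq
  -- the right inverse `d` of the right inverse `n` of `m` agrees with `m`
  have h1 : 𝔓.str.Eqv (p ⊓ 𝔓.act m q) m d := by
    have h2 := 𝔓.mul_left_eqv m hd
    have h3 := 𝔓.mul_right_eqv hn d
    rw [mul_one, ← mul_assoc] at h2
    rw [one_mul] at h3
    exact (h2.symm.mono inf_le_right).trans (h3.mono inf_le_left)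
  refine ⟨n, q ⊓ 𝔓.act n (p ⊓ 𝔓.act m q), ?_, hn.mono inf_le_left, ?_⟩
  · rw [map_inf, ← 𝔓.act_mul]
    exact le_inf inf_le_right (le_act_of_eqv_one hn inf_le_left le_rfl)
  · exact ((𝔓.mul_left_eqv n h1).mono inf_le_right).trans (hd.mono inf_le_left)

variable [Nontrivial B]

/-- Every element has local right inverses if homomorphisms `M × M → arrFrame` are determined by
their restriction to `{1} × M`. -/
theorem exists_right_inverses (h : MonoidalClosedFunctor (forget 𝔓)) (m : M) :
    ∃ P ∈ 𝔓.J.parts, ∀ p ∈ P, ∃ n, 𝔓.str.Eqv p (m * n) 1 := by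
  have h1 : 𝔓.dividesHom = 𝔓.topHom := by
    apply (monoidalClosedFunctor_forget_iff.1 h ⟨M, BJMStr.regular 𝔓⟩ ⟨_, 𝔓.arrStr⟩).1
    refine BJHom.ext (funext fun l => arr_ext fun k => ?_)
    change 𝔓.divides (k * 1) (k * l) = ⊤
    -- translates of `(1, l)` satisfy the condition, because `k * l` is a multiple of `k`
    rw [mul_one]
    exact top_le_iff.1 ((top_le_sec_self (k * l)).trans
      (le_iSup (fun n => (𝔓.sec (k * n)).1 (k * l)) l))
  have h2 : 𝔓.divides m 1 = ⊤ := by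
    have := congrArg (fun f => (f.toFun (m, 1)).1 1) h1
    change 𝔓.divides (1 * m) (1 * 1) = ⊤ at this
    rwa [one_mul, one_mul] at this
  exact exists_parts_of_iSup_eq_top h2

end MatchedPair

/-! ### The associated restriction monoid -/

namespace MatchedPair

open BStr RestrictionMonoid

variable {B M : Type u} [BooleanAlgebra B] [Monoid M] {𝔓 : MatchedPair B M}

theorem Restr.mk_mul (b c : B) (m n : M) :
    (Restr.mk b m * Restr.mk c n : 𝔓.Restr) = Restr.mk (b ⊓ 𝔓.act m c) (m * n) := rfl

theorem Restr.plus_mk (b : B) (m : M) : plus (Restr.mk b m : 𝔓.Restr) = Restr.mk b 1 := rfl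

theorem Restr.zero_eq : (0 : 𝔓.Restr) = Restr.mk ⊥ 1 := rfl

theorem Restr.mk_one_mul_mk_one (b c : B) :
    (Restr.mk b 1 * Restr.mk c 1 : 𝔓.Restr) = Restr.mk (b ⊓ c) 1 := by
  rw [Restr.mk_mul, 𝔓.act_one, one_mul]

theorem Restr.mk_one_inj {b c : B} :
    (Restr.mk b 1 : 𝔓.Restr) = Restr.mk c 1 ↔ b = c :=
  Restr.mk_eq.trans ⟨fun h => h.1, fun h => ⟨h, Eqv.refl _ _⟩⟩

theorem Restr.mk_le_mk {b c : B} {m n : M} :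
    Le (Restr.mk b m : 𝔓.Restr) (Restr.mk c n) ↔ b ≤ c ∧ 𝔓.str.Eqv b m n := by
  unfold Le
  rw [Restr.plus_mk, Restr.mk_mul, 𝔓.act_one, one_mul, Restr.mk_eq, inf_eq_left]
  constructor
  · rintro ⟨h, k⟩
    rw [inf_eq_left.2 h] at k
    exact ⟨h, k.symm⟩
  · rintro ⟨h, k⟩
    rw [inf_eq_left.2 h]
    exact ⟨h, k.symm⟩

theorem Restr.isPartialIso_mk {b : B} {m : M} :
    IsPartialIso (Restr.mk b m : 𝔓.Restr) ↔ ∃ n c, 𝔓.IsLocalInverse m n b c := by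
  constructor
  · rintro ⟨t, h1, h2⟩
    induction t using Restr.ind with
    | _ c n =>
      rw [Restr.plus_mk, Restr.mk_mul, Restr.mk_eq] at h1 h2
      refine ⟨n, c, inf_eq_left.1 h1.1, ?_, ?_⟩
      · rw [← h1.1]
        exact h1.2
      · rw [← h2.1]
        exact h2.2
  · rintro ⟨n, c, h⟩
    refine ⟨Restr.mk (c ⊓ 𝔓.act n b) n, ?_, ?_⟩
    · have h1 : b ⊓ 𝔓.act m (c ⊓ 𝔓.act n b) = b :=
        inf_eq_left.2 ((le_inf le_rfl le_rfl).trans (h.inf_le_act b))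
      rw [Restr.plus_mk, Restr.mk_mul, Restr.mk_eq]
      exact ⟨h1, h1.symm ▸ h.mul_eqv⟩
    · have h1 : c ⊓ 𝔓.act n b ⊓ 𝔓.act n b = c ⊓ 𝔓.act n b := by rw [inf_assoc, inf_idem]
      rw [Restr.plus_mk, Restr.mk_mul, Restr.mk_eq, h1]
      exact ⟨rfl, h.eqv_mul.mono inf_le_left⟩

theorem isEtale_of_hasPartialInverses (h : 𝔓.HasPartialInverses) : IsEtale 𝔓.restrParts := by
  intro s
  induction s using Restr.ind with
  | _ a m =>
    obtain ⟨P, hP, hloc⟩ := hasPartialInverses_iff.1 h m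
    refine ⟨(fun b => Restr.mk (b ⊓ a) m) '' P, ⟨?_, ?_⟩, ?_, ?_, ?_⟩
    · rintro _ ⟨b, hb, rfl⟩ _ ⟨c, hc, rfl⟩ hne
      have hbc : b ⊓ c = ⊥ := (𝔓.J.isPartition P hP).2.2 b hb c hc (by rintro rfl; exact hne rfl)
      dsimp only
      rw [Restr.plus_mk, Restr.plus_mk, Restr.mk_one_mul_mk_one, Restr.zero_eq, Restr.mk_one_inj,
        ← inf_inf_distrib_right, hbc, bot_inf_eq]
    · refine ⟨_, ⟨_, 𝔓.J.bind_mem P hP (fun _ => {a, aᶜ} \ {⊥}) fun _ _ => 𝔓.J.pair_mem a, rfl⟩, ?_⟩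
      rintro _ ⟨⟨_, ⟨b, hb, rfl⟩, rfl⟩, hne⟩
      have hne' : b ⊓ a ≠ ⊥ := fun h => hne (Restr.mk_one_inj.2 h)
      refine ⟨b ⊓ a, ⟨⟨b, hb, a, ⟨by simp, ?_⟩, rfl⟩, hne'⟩, rfl⟩
      rintro rfl
      exact hne' (inf_bot_eq b)
    · rintro _ ⟨b, hb, rfl⟩
      obtain ⟨n, c, hn⟩ := hloc b hb
      exact Restr.isPartialIso_mk.2 ⟨n, c, hn.mono inf_le_left⟩
    · rintro _ ⟨b, hb, rfl⟩
      exact Restr.mk_le_mk.2 ⟨inf_le_right, Eqv.refl _ _⟩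
    · intro t ht
      induction t using Restr.ind with
      | _ d n =>
        have ht' : ∀ b ∈ P, b ⊓ a ≤ d ∧ 𝔓.str.Eqv (b ⊓ a) m n := fun b hb =>
          Restr.mk_le_mk.1 (ht _ ⟨b, hb, rfl⟩)
        refine Restr.mk_le_mk.2 ⟨?_, 𝔓.str.eqv_of_parts hP fun b hb => inf_comm a b ▸ (ht' b hb).2⟩
        have h1 : (⊤ : B) ≤ a ⇨ d := by
          refine (𝔓.J.isPartition P hP).2.1.2 fun b hb => ?_
          rw [le_himp_iff]
          exact (ht' b hb).1
        rwa [le_himp_iff, top_inf_eq] at h1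

theorem hasPartialInverses_of_isEtale (h : IsEtale 𝔓.restrParts) : 𝔓.HasPartialInverses := by
  refine hasPartialInverses_iff.2 fun m => ?_
  obtain ⟨A, ⟨-, _, ⟨Q, hQ, rfl⟩, hAQ⟩, hiso, hle, hleast⟩ := h (Restr.mk ⊤ m)
  have hA : ∀ s ∈ A, ∃ b, s = Restr.mk b m := by
    intro s hs
    induction s using Restr.ind with
    | _ b n => exact ⟨b, Restr.mk_eq.2 ⟨rfl, (Restr.mk_le_mk.1 (hle _ hs)).2⟩⟩
  refine ⟨Q, hQ, fun q hq => ?_⟩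
  suffices hqA : Restr.mk q m ∈ A from Restr.isPartialIso_mk.1 (hiso _ hqA)
  -- otherwise `A` is bounded above by the restriction of `m` to the complement of `q`
  by_contra hqA
  have h1 : Le (Restr.mk ⊤ m : 𝔓.Restr) (Restr.mk qᶜ m) := by
    apply hleast
    intro s hs
    obtain ⟨b, rfl⟩ := hA s hs
    refine Restr.mk_le_mk.2 ⟨?_, Eqv.refl _ _⟩
    by_cases hb : b = ⊥
    · rw [hb]
      exact bot_le
    · obtain ⟨b', hb', hbb'⟩ := hAQ ⟨⟨_, hs, rfl⟩, fun h => hb (Restr.mk_one_inj.1 h)⟩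
      obtain rfl := Restr.mk_one_inj.1 hbb'
      rw [le_compl_iff_disjoint_right, disjoint_iff]
      exact (𝔓.J.isPartition Q hQ).2.2 b' hb' q hq (by rintro rfl; exact hqA hs)
  have h2 : q = ⊥ := by
    rw [← compl_compl q, top_le_iff.1 (Restr.mk_le_mk.1 h1).1, compl_top]
  exact (𝔓.J.isPartition Q hQ).1 (h2 ▸ hq)

end MatchedPair

/-! ### The classifying localic category -/

theorem ClosedIdeal.Eqv.mono {B : Type u} [BooleanAlgebra B] {J : ZeroDimTopology B} {b c : B}
    {I K : ClosedIdeal J} (h : ClosedIdeal.Eqv b I K) (hc : c ≤ b) : ClosedIdeal.Eqv c I K := by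
  have h1 : principal J c ≤ principal J b := principal_le.2 hc
  obtain ⟨h2, h3⟩ := eqv_iff.1 h
  exact eqv_iff.2 ⟨(inf_le_inf_left _ h1).trans h2, (inf_le_inf_left _ h1).trans h3⟩

namespace MatchedPair

open ClosedIdeal

variable {B M : Type u} [BooleanAlgebra B] [Monoid M] {𝔓 : MatchedPair B M}

/-- The value at `m` of the inverse image of `f` under inversion: the union, over the local
inverses `n` of `m`, of the part of `m^* f(n)` where `n` is inverse to `m`. -/
def invIdeal (f : 𝔓.arrFrame) (m : M) : ClosedIdeal 𝔓.J :=
  ⨆ x : {x : M × B × B // 𝔓.IsLocalInverse m x.1 x.2.1 x.2.2},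
    𝔓.actIdeal m (f.1 x.1.1) ⊓ principal 𝔓.J x.1.2.1

theorem IsLocalInverse.invIdeal_eqv (f : 𝔓.arrFrame) {m n : M} {b c : B}
    (h : 𝔓.IsLocalInverse m n b c) :
    ClosedIdeal.Eqv b (invIdeal f m) (𝔓.actIdeal m (f.1 n)) := by
  refine eqv_iff.2 ⟨?_, ?_⟩
  · unfold invIdeal
    rw [iSup_inf_eq]
    refine iSup_le ?_
    rintro ⟨⟨n', b', c'⟩, h'⟩
    rw [inf_assoc, ← principal_inf, inf_comm b' b]
    exact (eqv_iff.1 ((𝔓.eqv_actIdeal m (f.2 _ _ _ (h.unique h'))).mono (h.inf_le_act b'))).2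
  · exact le_iSup (fun x : {x : M × B × B // 𝔓.IsLocalInverse m x.1 x.2.1 x.2.2} =>
      𝔓.actIdeal m (f.1 x.1.1) ⊓ principal 𝔓.J x.1.2.1) ⟨(n, b, c), h⟩

/-- Equality of closed ideals may be checked on the regions where `m` has an inverse. -/
theorem ideal_ext_of_localInverse (hinv : 𝔓.HasPartialInverses) (m : M) {I K : ClosedIdeal 𝔓.J}
    (h : ∀ n b c, 𝔓.IsLocalInverse m n b c → ClosedIdeal.Eqv b I K) : I = K := by
  obtain ⟨P, hP, hloc⟩ := hasPartialInverses_iff.1 hinv m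
  rw [← inf_top_eq I, ← inf_top_eq K, ← iSup_principal hP, inf_iSup_eq, inf_iSup_eq]
  refine iSup_congr fun b => ?_
  obtain ⟨n, c, hn⟩ := hloc b b.2
  exact h n b c hn

theorem eqv_of_localInverse (hinv : 𝔓.HasPartialInverses) (m : M) {d : B}
    {I K : ClosedIdeal 𝔓.J}
    (h : ∀ n b c, 𝔓.IsLocalInverse m n b c → ClosedIdeal.Eqv (b ⊓ d) I K) :
    ClosedIdeal.Eqv d I K :=
  ideal_ext_of_localInverse hinv m fun n b c hn => by
    have h1 := h n b c hn
    unfold ClosedIdeal.Eqv at h1 ⊢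
    rwa [inf_assoc, inf_assoc, inf_comm (principal 𝔓.J d), ← principal_inf]

/-- The inverse image map of inversion. -/
def invHom (hinv : 𝔓.HasPartialInverses) : FrameHom 𝔓.arrFrame 𝔓.arrFrame where
  toFun f := ⟨invIdeal f, fun d m m' hd => by
    refine eqv_of_localInverse hinv m fun n b c hn => ?_
    have h1 := (hn.invIdeal_eqv f).mono (inf_le_left : b ⊓ d ≤ b)
    have h2 := (hn.congr hd).invIdeal_eqv f
    have h3 := (𝔓.actIdeal_eqv hd (f.1 n)).mono (inf_le_right : b ⊓ d ≤ d)
    exact (Eq.trans h1 h3).trans (Eq.symm h2)⟩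
  map_inf' f g := arr_ext fun m => by
    refine ideal_ext_of_localInverse hinv m fun n b c hn => ?_
    have h1 := hn.invIdeal_eqv f
    have h2 := hn.invIdeal_eqv g
    have h3 := hn.invIdeal_eqv (f ⊓ g)
    change ClosedIdeal.Eqv b (invIdeal (f ⊓ g) m) (invIdeal f m ⊓ invIdeal g m)
    unfold ClosedIdeal.Eqv at h1 h2 h3 ⊢
    rw [h3, arr_inf, 𝔓.actIdeal_inf, inf_inf_distrib_right, ← h1, ← h2, ← inf_inf_distrib_right]
  map_top' := arr_ext fun m => by
    refine ideal_ext_of_localInverse hinv m fun n b c hn => ?_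
    have h1 := hn.invIdeal_eqv ⊤
    exact Eq.trans h1 (congrArg (· ⊓ principal 𝔓.J b) (𝔓.actIdeal_top m))
  map_sSup' S := arr_ext fun m => by
    rw [arr_sSup, iSup_image]
    refine ideal_ext_of_localInverse hinv m fun n b c hn => ?_
    refine Eq.trans (hn.invIdeal_eqv (sSup S)) ?_
    rw [arr_sSup, (𝔓.gc_actIdeal m).l_iSup₂]
    exact Eq.symm (ClosedIdeal.Eqv.sSup fun f _ => hn.invIdeal_eqv f)

variable (hinv : 𝔓.HasPartialInverses)

theorem invHom_eqv (f : 𝔓.arrFrame) {m n : M} {b c : B} (h : 𝔓.IsLocalInverse m n b c) :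
    ClosedIdeal.Eqv b ((invHom hinv f).1 m) (𝔓.actIdeal m (f.1 n)) := h.invIdeal_eqv f

theorem invHom_src (I : ClosedIdeal 𝔓.J) : invHom hinv (𝔓.srcHom I) = 𝔓.tgtHom I :=
  arr_ext fun m => ideal_ext_of_localInverse hinv m fun _ _ _ hn => invHom_eqv hinv (𝔓.srcHom I) hn

theorem invHom_tgt (I : ClosedIdeal 𝔓.J) : invHom hinv (𝔓.tgtHom I) = 𝔓.srcHom I :=
  arr_ext fun m => ideal_ext_of_localInverse hinv m fun n b c hn => by
    refine Eq.trans (invHom_eqv hinv (𝔓.tgtHom I) hn) ?_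
    change 𝔓.actIdeal m (𝔓.actIdeal n I) ⊓ _ = I ⊓ _
    rw [← actIdeal_mul]
    have := 𝔓.actIdeal_eqv hn.mul_eqv I
    rwa [𝔓.actIdeal_one] at this

variable (𝔓) in
/-- The germs of `m` over `b`. -/
def secOver (m : M) (b : B) : 𝔓.arrFrame := 𝔓.sec m ⊓ 𝔓.srcHom (principal 𝔓.J b)

/-- An open set of arrows contains the germs of `m` over `b` as soon as its value at `m`
contains `b`. -/
theorem secOver_le {m : M} {b : B} {f : 𝔓.arrFrame} : 𝔓.secOver m b ≤ f ↔ b ∈ f.1 m := by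
  constructor
  · intro h
    exact h m (mem_inf.2 ⟨BStr.Eqv.refl b m, mem_principal.2 le_rfl⟩)
  · intro h k
    exact le_trans (inf_le_inf_left _ (principal_le.2 h)) (sec_inf_le m k)

/-- Equality of open sets of arrows may be checked on the invertible germs. -/
theorem arr_ext_of_localInverse (hinv : 𝔓.HasPartialInverses) {f g : 𝔓.arrFrame}
    (h : ∀ m n b c, 𝔓.IsLocalInverse m n b c → 𝔓.secOver m b ⊓ f = 𝔓.secOver m b ⊓ g) : f = g :=
  arr_ext fun m => ideal_ext_of_localInverse hinv m fun n b c hn => by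
    have h1 := congrArg (fun f : 𝔓.arrFrame => f.1 m) (h m n b c hn)
    have h2 : (𝔓.secOver m b).1 m = principal 𝔓.J b := by
      refine le_antisymm inf_le_right (le_inf (le_top.trans (top_le_sec_self m)) le_rfl)
    simp only [arr_inf, h2] at h1
    exact (inf_comm _ _).trans (h1.trans (inf_comm _ _))

theorem IsLocalInverse.secOver_le_invHom {m n : M} {b c : B} (h : 𝔓.IsLocalInverse m n b c) :
    𝔓.secOver m b ≤ invHom hinv (𝔓.sec n) := by
  rw [secOver_le]
  have h1 := (eqv_iff.1 (invHom_eqv hinv (𝔓.sec n) h)).2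
  refine h1 (mem_inf.2 ⟨?_, mem_principal.2 le_rfl⟩)
  rw [top_le_iff.1 (top_le_sec_self n), 𝔓.actIdeal_top]
  exact principal_le.1 le_top

theorem secOver_inf_src {m : M} {b : B} {I K : ClosedIdeal 𝔓.J} (h : ClosedIdeal.Eqv b I K) :
    𝔓.secOver m b ⊓ 𝔓.srcHom I = 𝔓.secOver m b ⊓ 𝔓.srcHom K := by
  unfold secOver
  rw [inf_assoc, inf_assoc, ← map_inf, ← map_inf, inf_comm _ I, inf_comm _ K, h]

theorem secOver_inf_tgt {m : M} {b : B} {I K : ClosedIdeal 𝔓.J}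
    (h : ClosedIdeal.Eqv b (𝔓.actIdeal m I) (𝔓.actIdeal m K)) :
    𝔓.secOver m b ⊓ 𝔓.tgtHom I = 𝔓.secOver m b ⊓ 𝔓.tgtHom K := by
  have key : ∀ I, 𝔓.secOver m b ⊓ 𝔓.tgtHom I = 𝔓.secOver m b ⊓ 𝔓.srcHom (𝔓.actIdeal m I) := by
    intro I
    unfold secOver
    rw [inf_right_comm, ← sec_inf_src_le_tgt, inf_right_comm]
  rw [key, key, secOver_inf_src h]

theorem isGroupoid_of_hasPartialInverses (hinv : 𝔓.HasPartialInverses) :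
    𝔓.classifyingLocalicCategory.IsGroupoid := by
  refine ⟨invHom hinv, invHom_src hinv, invHom_tgt hinv, ?_, ?_⟩
  · let l := liftHom (FrameHom.id 𝔓.arrFrame) (invHom hinv) fun I => (invHom_src hinv I).symm
    have hl1 : ∀ f, l (𝔓.fstHom f) = f := liftHom_fst _ _ _
    have hl2 : ∀ f, l (𝔓.sndHom f) = invHom hinv f := liftHom_snd _ _ _
    refine ⟨l, hl1, hl2, fun f => ?_⟩
    refine arr_ext_of_localInverse hinv fun m n b c hn => ?_
    have h1 := hom_local l (𝔓.mulHom f) (e := 𝔓.secOver m b) (m := m) (n := n)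
      (by rw [hl1]; exact inf_le_left) (by rw [hl2]; exact hn.secOver_le_invHom hinv)
    rw [hl1] at h1
    exact h1.trans (secOver_inf_src (f.2 _ _ _ hn.mul_eqv))
  · let r := liftHom (invHom hinv) (FrameHom.id 𝔓.arrFrame) fun I => invHom_tgt hinv I
    have hr1 : ∀ f, r (𝔓.fstHom f) = invHom hinv f := liftHom_fst _ _ _
    have hr2 : ∀ f, r (𝔓.sndHom f) = f := liftHom_snd _ _ _
    refine ⟨r, hr1, hr2, fun f => ?_⟩
    refine arr_ext_of_localInverse hinv fun m n b c hn => ?_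
    have h1 := hom_local r (𝔓.mulHom f) (e := 𝔓.secOver m b) (m := n) (n := m)
      (by rw [hr1]; exact hn.secOver_le_invHom hinv) (by rw [hr2]; exact inf_le_left)
    rw [hr1, invHom_src] at h1
    exact h1.trans (secOver_inf_tgt ((𝔓.eqv_actIdeal m (f.2 _ _ _ hn.eqv_mul)).mono hn.le_act))

theorem hasPartialInverses_of_isGroupoid [Nontrivial B]
    (h : 𝔓.classifyingLocalicCategory.IsGroupoid) : 𝔓.HasPartialInverses := by
  obtain ⟨inv, hsrc, -, ⟨l, hl1, hl2, hl⟩, ⟨r, hr1, hr2, hr⟩⟩ := h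
  change FrameHom 𝔓.arrFrame 𝔓.arrFrame at inv
  change FrameHom 𝔓.compFrame 𝔓.arrFrame at l r
  change ∀ I, inv (𝔓.srcHom I) = 𝔓.tgtHom I at hsrc
  change ∀ f, l (𝔓.fstHom f) = f at hl1
  change ∀ f, l (𝔓.sndHom f) = inv f at hl2
  change ∀ f, l (𝔓.mulHom f) = 𝔓.srcHom (f.1 1) at hl
  change ∀ f, r (𝔓.fstHom f) = inv f at hr1
  change ∀ f, r (𝔓.sndHom f) = f at hr2
  change ∀ f, r (𝔓.mulHom f) = 𝔓.tgtHom (f.1 1) at hr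
  have hone : (𝔓.sec 1).1 1 = ⊤ := top_le_iff.1 (top_le_sec_self 1)
  refine hasPartialInverses_iff.2 fun m => ?_
  -- where `n` represents the inverse of `m`, the composite `n * m` is locally the identity
  have hleft : ∀ n, (inv (𝔓.sec n)).1 m ≤ 𝔓.actIdeal m ((𝔓.sec 1).1 (n * m)) := by
    intro n b hb
    have h1 := hom_local r (𝔓.mulHom (𝔓.sec 1)) (e := 𝔓.secOver m b) (m := n) (n := m)
      (by rw [hr1]; exact secOver_le.2 hb) (by rw [hr2]; exact inf_le_left)
    rw [hr1, hsrc, hr, hone, map_top, inf_top_eq] at h1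
    exact (secOver_le (f := 𝔓.tgtHom ((𝔓.sec 1).1 (n * m)))).1 (inf_eq_left.1 h1.symm)
  have hright : ∀ n, (inv (𝔓.sec n)).1 m ≤ (𝔓.sec 1).1 (m * n) := by
    intro n b hb
    have h1 := hom_local l (𝔓.mulHom (𝔓.sec 1)) (e := 𝔓.secOver m b) (m := m) (n := n)
      (by rw [hl1]; exact inf_le_left) (by rw [hl2]; exact secOver_le.2 hb)
    rw [hl1, hl, hone, map_top, inf_top_eq] at h1
    exact (secOver_le (f := 𝔓.srcHom ((𝔓.sec 1).1 (m * n)))).1 (inf_eq_left.1 h1.symm)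
  -- refining the cover by the sets `inv (sec n)` so that also `n * m = 1` on an element `c` of `B`
  have hcov : ⨆ x : {x : M × B // 𝔓.str.Eqv x.2 (x.1 * m) 1},
      (inv (𝔓.sec x.1.1)).1 m ⊓ principal 𝔓.J (𝔓.act m x.1.2) = ⊤ := by
    apply top_le_iff.1
    have h1 : (⨆ n, (inv (𝔓.sec n)).1 m) = ⊤ := by
      rw [← arr_iSup, iSup_hom_sec]
      rfl
    rw [← h1]
    refine iSup_le fun n => ?_
    refine (le_inf le_rfl (hleft n)).trans ?_
    rw [inf_comm, ← le_imp, actIdeal_le]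
    intro c hc
    rw [← principal_le, le_imp, inf_comm]
    exact le_iSup (fun x : {x : M × B // 𝔓.str.Eqv x.2 (x.1 * m) 1} =>
      (inv (𝔓.sec x.1.1)).1 m ⊓ principal 𝔓.J (𝔓.act m x.1.2)) ⟨(n, c), BStr.Eqv.symm hc⟩
  obtain ⟨P, hP, h⟩ := exists_parts_of_iSup_eq_top hcov
  refine ⟨P, hP, fun p hp => ?_⟩
  obtain ⟨⟨⟨n, c⟩, hnc⟩, hp⟩ := h p hp
  obtain ⟨hp1, hp2⟩ := mem_inf.1 hp
  exact ⟨n, c, mem_principal.1 hp2, BStr.Eqv.symm (hright n hp1), hnc⟩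

end MatchedPair

/-! ### The classifying topological category -/

section Ultrafilter

variable {B : Type u} [BooleanAlgebra B]

theorem BoolUltrafilter.bot_notMem (U : BoolUltrafilter B) : ⊥ ∉ U.carrier := by
  rw [← U.compl_mem_iff, compl_bot]
  exact U.top_mem

theorem BoolUltrafilter.exists_mem_of_isPartition (U : BoolUltrafilter B) {P : Set B}
    (hP : IsPartition P ⊤) (hfin : P.Finite) : ∃ b ∈ P, b ∈ U.carrier := by
  by_contra! h
  have key : ∀ s : Finset B, ↑s ⊆ P → (s.sup id)ᶜ ∈ U.carrier := by
    classical
    intro s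
    induction s using Finset.induction with
    | empty =>
      intro _
      rw [Finset.sup_empty, compl_bot]
      exact U.top_mem
    | insert a s _ ih =>
      intro hs
      rw [Finset.sup_insert, compl_sup]
      have ha : a ∈ P := hs (by simp)
      exact U.inf_mem (U.compl_mem_iff.2 (h a ha)) (ih fun b hb => hs (by simp_all))
  have h1 := key hfin.toFinset (by simp)
  have h2 : (⊤ : B) ≤ hfin.toFinset.sup id :=
    hP.2.1.2 fun b hb => Finset.le_sup (f := id) (by simpa using hb)
  rw [top_le_iff.1 h2, compl_top] at h1
  exact U.bot_notMem h1

/-- A proper ideal is disjoint from some ultrafilter. -/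
theorem ClosedIdeal.exists_ultrafilter {J : ZeroDimTopology B} (I : ClosedIdeal J)
    (hI : ⊤ ∉ I) : ∃ U : BoolUltrafilter B, ∀ b ∈ U.carrier, b ∉ I := by
  let K : Order.Ideal B :=
    { carrier := I
      lower' := fun _ _ hc hb => I.mem_of_le hb hc
      nonempty' := ⟨⊥, I.bot_mem⟩
      directed' := fun b hb c hc => ⟨b ⊔ c, I.sup_mem hb hc, le_sup_left, le_sup_right⟩ }
  have hK : Disjoint (Order.PFilter.principal (⊤ : B) : Set B) K := by
    rw [Set.disjoint_left]
    intro b hb hbK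
    have : ⊤ ≤ b := Order.PFilter.mem_principal.1 hb
    rw [top_le_iff] at this
    exact hI (this ▸ hbK)
  obtain ⟨L, hL, hKL, -⟩ := DistribLattice.prime_ideal_of_disjoint_filter_ideal hK
  refine ⟨⟨{b | b ∉ L}, hL.toIsProper.top_notMem, ?_, ?_, ?_⟩, fun b hb hbI => hb (hKL hbI)⟩
  · intro b c hb hc h
    exact (hL.mem_or_mem h).elim hb hc
  · intro b c hb hbc hc
    exact hb (L.lower hbc hc)
  · intro b
    constructor
    · intro h h'
      rcases hL.mem_or_mem (x := b) (y := bᶜ) (by rw [inf_compl_self]; exact L.bot_mem) with hb | hb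
      · exact h' hb
      · exact h hb
    · intro h h'
      apply h
      intro hb
      apply hL.toIsProper.top_notMem
      rw [← sup_compl_eq_top (x := b)]
      exact Order.Ideal.sup_mem hb h'

end Ultrafilter

namespace MatchedPair

variable {B M : Type u} [BooleanAlgebra B] [Monoid M] {𝔓 : MatchedPair B M}

theorem push_congr {U : BoolUltrafilter B} {m n : M} {b : B} (hb : b ∈ U.carrier)
    (h : 𝔓.str.Eqv b m n) : 𝔓.push m U = 𝔓.push n U :=
  congrArg (fun f : 𝔓.Arr => f.tgt.point) (Arr.mk'_eq hb h)

theorem IsLocalInverse.push_push {U : BoolUltrafilter B} {m n : M} {b c : B}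
    (h : 𝔓.IsLocalInverse m n b c) (hb : b ∈ U.carrier) : 𝔓.push n (𝔓.push m U) = U := by
  rw [← push_mul, push_congr hb h.mul_eqv, push_one]

theorem IsLocalInverse.exists_inverse {U : BoolUltrafilter B} {m n : M} {b c : B}
    (h : 𝔓.IsLocalInverse m n b c) (hb : b ∈ U.carrier) :
    ∃ g : (Arr.mk' 𝔓 U m).tgt ⟶ (Arr.mk' 𝔓 U m).src,
      (Arr.mk' 𝔓 U m).hom ≫ g = 𝟙 _ ∧ g ≫ (Arr.mk' 𝔓 U m).hom = 𝟙 _ ∧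
      (⟨_, _, g⟩ : 𝔓.Arr) = Arr.mk' 𝔓 (𝔓.push m U) n := by
  have key : ∀ (V : BoolUltrafilter B) (hV : 𝔓.push n (𝔓.push m U) = V),
      (⟨⟨𝔓.push m U⟩, ⟨V⟩, Quotient.mk (𝔓.arrowSetoid (𝔓.push m U) V) ⟨n, hV⟩⟩ : 𝔓.Arr) =
        Arr.mk' 𝔓 (𝔓.push m U) n := by
    rintro V rfl
    rfl
  refine ⟨Quotient.mk (𝔓.arrowSetoid (𝔓.push m U) U) ⟨n, h.push_push hb⟩, ?_, ?_,
    key _ (h.push_push hb)⟩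
  · exact Quotient.sound ⟨b, hb, h.mul_eqv⟩
  · exact Quotient.sound ⟨c, U.mem_of_le hb h.le_act, h.eqv_mul⟩

/-- For finite partitions, every ultrafilter contains a region where `m` has an inverse. -/
theorem exists_localInverse_mem (hfin : ∀ P ∈ 𝔓.J.parts, P.Finite)
    (hinv : 𝔓.HasPartialInverses) (U : BoolUltrafilter B) (m : M) :
    ∃ n b c, b ∈ U.carrier ∧ 𝔓.IsLocalInverse m n b c := by
  obtain ⟨P, hP, hloc⟩ := hasPartialInverses_iff.1 hinv m
  obtain ⟨b, hbP, hb⟩ := U.exists_mem_of_isPartition (𝔓.J.isPartition P hP) (hfin P hP)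
  obtain ⟨n, c, hn⟩ := hloc b hbP
  exact ⟨n, b, c, hb, hn⟩

theorem isTopologicalGroupoid_of_hasPartialInverses (hfin : ∀ P ∈ 𝔓.J.parts, P.Finite)
    (hinv : 𝔓.HasPartialInverses) : 𝔓.IsTopologicalGroupoid := by
  have hex : ∀ f : 𝔓.Arr, ∃ g : f.tgt ⟶ f.src, f.hom ≫ g = 𝟙 _ ∧ g ≫ f.hom = 𝟙 _ := by
    intro f
    obtain ⟨U, m, rfl⟩ := f.exists_rep
    obtain ⟨n, b, c, hb, hn⟩ := exists_localInverse_mem hfin hinv U m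
    obtain ⟨g, h1, h2, -⟩ := hn.exists_inverse hb
    exact ⟨g, h1, h2⟩
  choose inv h1 h2 using hex
  refine ⟨fun f => inv ⟨_, _, f⟩, fun f => ⟨h1 ⟨_, _, f⟩, h2 ⟨_, _, f⟩⟩, ?_⟩
  have hval : ∀ {U : BoolUltrafilter B} {m n : M} {b c : B}, 𝔓.IsLocalInverse m n b c →
      b ∈ U.carrier → (⟨_, _, inv (Arr.mk' 𝔓 U m)⟩ : 𝔓.Arr) = Arr.mk' 𝔓 (𝔓.push m U) n := by
    intro U m n b c hn hb
    obtain ⟨g, hg1, hg2, hg⟩ := hn.exists_inverse hb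
    have : inv (Arr.mk' 𝔓 U m) = g := by
      rw [← Category.comp_id (inv _), ← hg1, ← Category.assoc, h2, Category.id_comp]
    rw [this, hg]
  refine continuous_generateFrom_iff.2 ?_
  rintro _ ⟨⟨d, k⟩, rfl⟩
  refine isOpen_iff_mem_nhds.2 fun f hf => ?_
  obtain ⟨U, m, rfl⟩ := f.exists_rep
  obtain ⟨n, b, c, hb, hn⟩ := exists_localInverse_mem hfin hinv U m
  obtain ⟨W, hdW, hW⟩ := hf
  obtain ⟨rfl, e, he, hne⟩ := Arr.mk'_inj ((hval hn hb).symm.trans hW)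
  -- near `(U, m)` the inverse is represented by `n`, hence also by `k`
  refine Filter.mem_of_superset ((isOpen_basicArr (b ⊓ 𝔓.act m (d ⊓ e)) m).mem_nhds
    ⟨U, U.inf_mem hb ((𝔓.push m U).inf_mem hdW he), rfl⟩) ?_
  rintro _ ⟨U', hU', rfl⟩
  have hde : d ⊓ e ∈ (𝔓.push m U').carrier := U'.mem_of_le hU' inf_le_right
  refine ⟨𝔓.push m U', BoolUltrafilter.mem_of_le _ hde inf_le_left, ?_⟩
  exact (hval hn (U'.mem_of_le hU' inf_le_left)).trans
    (Arr.mk'_eq (BoolUltrafilter.mem_of_le _ hde inf_le_right) hne)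

theorem isGroupoid_of_isTopologicalGroupoid (h : 𝔓.IsTopologicalGroupoid) :
    CategoryTheory.IsGroupoid 𝔓.Cls := by
  obtain ⟨inv, h, -⟩ := h
  exact ⟨fun f => ⟨inv f, h f⟩⟩

theorem hasPartialInverses_of_isGroupoid_cls [Nontrivial B]
    (h : CategoryTheory.IsGroupoid 𝔓.Cls) : 𝔓.HasPartialInverses := by
  refine hasPartialInverses_iff.2 fun m => ?_
  let D : LowerSet B := ⟨{b | ∃ n c, 𝔓.IsLocalInverse m n b c},
    fun _ _ hd ⟨n, c, hn⟩ => ⟨n, c, hn.mono hd⟩⟩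
  have hD : ⊥ ∈ D := ⟨1, ⊥, bot_le, BStr.eqv_bot _ _, BStr.eqv_bot _ _⟩
  suffices htop : ⊤ ∈ ClosedIdeal.locally 𝔓.J D hD by
    obtain ⟨P, hP, hloc⟩ := htop
    refine ⟨P, hP, fun p hp => ?_⟩
    have h1 : p ⊓ ⊤ ∈ D := hloc p hp
    rw [inf_top_eq] at h1
    exact h1
  by_contra htop
  obtain ⟨U, hU⟩ := ClosedIdeal.exists_ultrafilter _ htop
  have hiso := h.all_isIso (Arr.mk' 𝔓 U m).hom
  obtain ⟨g, hg1, hg2⟩ := hiso.out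
  obtain ⟨⟨n, hn⟩, rfl⟩ := Quotient.exists_rep g
  obtain ⟨b, hb, hmn⟩ := Quotient.exact hg1
  obtain ⟨c, hc, hnm⟩ := Quotient.exact hg2
  refine hU (b ⊓ 𝔓.act m c) (U.inf_mem hb hc) ⟨_, ZeroDimTopology.top_mem_parts, fun p _ => ?_⟩
  exact D.lower inf_le_right ⟨n, c, inf_le_right, BStr.Eqv.mono hmn inf_le_left, hnm⟩

end MatchedPair

end MatchedPairs

theorem theorem9 {B M : Type u} [BooleanAlgebra B] [Nontrivial B] [Monoid M]
    (𝔓 : MatchedPairs.MatchedPair B M) :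
    List.TFAE [
      CategoryTheory.MonoidalClosedFunctor (MatchedPairs.forget 𝔓),
      𝔓.HasPartialInverses,
      MatchedPairs.RestrictionMonoid.IsEtale 𝔓.restrParts,
      𝔓.classifyingLocalicCategory.IsGroupoid] ∧
    ((∀ P ∈ 𝔓.J.parts, P.Finite) →
      List.TFAE [
        𝔓.classifyingLocalicCategory.IsGroupoid,
        CategoryTheory.IsGroupoid 𝔓.Cls,
        𝔓.IsTopologicalGroupoid]) := by
  constructor
  · tfae_have 1 → 2 := fun h => MatchedPairs.MatchedPair.hasPartialInverses_of_right_inverses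
      (MatchedPairs.MatchedPair.exists_right_inverses h)
    tfae_have 2 → 1 := MatchedPairs.monoidalClosedFunctor_forget
    tfae_have 2 → 3 := MatchedPairs.MatchedPair.isEtale_of_hasPartialInverses
    tfae_have 3 → 2 := MatchedPairs.MatchedPair.hasPartialInverses_of_isEtale
    tfae_have 2 → 4 := MatchedPairs.MatchedPair.isGroupoid_of_hasPartialInverses
    tfae_have 4 → 2 := MatchedPairs.MatchedPair.hasPartialInverses_of_isGroupoid
    tfae_finish
  · intro hfin
    tfae_have 1 → 3 := fun h =>
      MatchedPairs.MatchedPair.isTopologicalGroupoid_of_hasPartialInverses hfin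
        (MatchedPairs.MatchedPair.hasPartialInverses_of_isGroupoid h)
    tfae_have 3 → 2 := MatchedPairs.MatchedPair.isGroupoid_of_isTopologicalGroupoid
    tfae_have 2 → 1 := fun h => MatchedPairs.MatchedPair.isGroupoid_of_hasPartialInverses
      (MatchedPairs.MatchedPair.hasPartialInverses_of_isGroupoid_cls h)
    tfae_finish
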